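/- Let $B$ be a complete Hausdorff topological field of characteristic zero, $G$ a compact topological group acting continuously on $B$ by field automorphisms, $F=B^G$, and $K\subseteq F$ a subfield with $[F:K]<\infty$, with the topology induced from $B$. Let $U=\operatorname{Spec}\mathcal A$ be a pro-unipotent group scheme over $K$ with an action of $G$ by automorphisms of the Hopf $K$-algebra $\mathcal A$ which is continuous for the inductive limit topology on the $K$-vector space $\mathcal A$. Let $U=U^1\supseteq U^2\supseteq\cdots$, $U^{i+1}=[U,U^i]$, be the descending central series, put $U_n=U/U^{n+1}$, and assume that each $U_n$ is an algebraic group, i.e. has a finitely generated coordinate ring $\mathcal A_n\subseteq\mathcal A$. Assume that for all $i\ge 1$, $j\ge 0$ the continuous cohomology groups $H^j(G,(U^i/U^{i+1})(B))$ and $H^j(G,(U^i/U^{i+1})(K))$ of the vector groups $U^i/U^{i+1}$ are finite-dimensional over $F$ and over $K$ respectively. For a commutative $K$-algebra $R$, let $G$ act on $B\otimes_K R$ through $B$ and trivially on $R$, and give $U_n(R)$ and $U_n(B)$ the topologies induced by a closed embedding of $U_n$ in an affine space, $R$ having the inductive limit topology of a $K$-vector space. $H^1(G,-)$ denotes the continuous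 non-abelian cohomology set. An affine variety over $K$ means an affine scheme of finite type over $K$. Let $n\ge 0$ be an integer. (a) The functor $R\mapsto H^0\bigl(G,\,U_n(B\otimes_K R)/U_n(R)\bigr)$ on commutative $K$-algebras is represented by an affine variety over $K$. (b) Whenever the functor $H^1(G,U_n): R\mapsto H^1(G,U_n(R))$ is represented by an affine variety over $K$, the inverse image $H^1_f(G,U_n)(K)$ of the basepoint under $H^1(G,U_n(K))\to H^1(G,U_n(B))$ is the set of $K$-points of a closed subvariety $H^1_f(G,U_n)$ of the variety $H^1(G,U_n)$. (c) If $H^0(G,(U^i/U^{i+1})(K))=0$ for all $i\ge 1$, then $H^1(G,U_n)$ is represented by an affine variety over $K$, so that (b) applies. -/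

import Mathlib

open scoped TensorProduct Topology
open WithConv

universe u v

noncomputable section

namespace UnipotentCohomology

/-! ### Points of affine group schemes -/

section Points

variable (K : Type*) [Field K] (A : Type*) [CommRing A] [HopfAlgebra K A]
  (S : Type*) [CommRing S] [Algebra K S]

/-- The group of `S`-points of the affine group scheme `Spec A` over `K`:
algebra homomorphisms `A → S` with the convolution product. -/
abbrev Pts := WithConv (A →ₐ[K] S)

variable {K A S}

instance : Group (Pts K A S) where
  inv x := toConv (x.ofConv.comp (HopfAlgebra.antipodeAlgHom K A))
  inv_mul_cancel x := by
    apply WithConv.ext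
    ext a
    have h := HopfAlgebra.mul_antipode_rTensor_comul_apply (R := K) a
    have e : (Algebra.TensorProduct.lift (x.ofConv.comp (HopfAlgebra.antipodeAlgHom K A)) x.ofConv
        (fun _ _ ↦ .all _ _)).toLinearMap =
        x.ofConv.toLinearMap ∘ₗ LinearMap.mul' K A ∘ₗ (HopfAlgebra.antipode K).rTensor A := by
      ext a b; simp
    refine (AlgHom.convMul_apply _ _ _).trans ?_
    refine (congr($e (Coalgebra.comul a))).trans ?_
    refine (congrArg x.ofConv h).trans ?_
    exact x.ofConv.commutes _

theorem mul_apply (x y : Pts K A S) (a : A) :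
    (x * y) a = Algebra.TensorProduct.lift x.ofConv y.ofConv (fun _ _ ↦ .all _ _)
      (Coalgebra.comul a) := AlgHom.convMul_apply x y a

variable {S' : Type*} [CommRing S'] [Algebra K S']

/-- The homomorphism on points induced by a homomorphism of coefficient algebras. -/
def Pts.map (f : S →ₐ[K] S') : Pts K A S →* Pts K A S' where
  toFun x := toConv (f.comp x.ofConv)
  map_one' := by
    apply WithConv.ext
    ext a
    change f (algebraMap K S _) = algebraMap K S' _
    exact f.commutes _
  map_mul' x y := congrArg toConv (AlgHom.comp_convMul_distrib f x y)

@[simp] theorem Pts.map_apply (f : S →ₐ[K] S') (x : Pts K A S) (a : A) :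
    Pts.map f x a = f (x a) := rfl

/-- The homomorphism on points induced by an algebra homomorphism compatible with
the coalgebra structures. -/
def Pts.comap {A' : Type*} [CommRing A'] [HopfAlgebra K A'] (h : A →ₐ[K] A')
    (h1 : ∀ a, Coalgebra.counit (R := K) (h a) = Coalgebra.counit (R := K) a)
    (h2 : ∀ a, Coalgebra.comul (R := K) (h a) =
      TensorProduct.map h.toLinearMap h.toLinearMap (Coalgebra.comul a)) :
    Pts K A' S →* Pts K A S where
  toFun x := toConv (x.ofConv.comp h)
  map_one' := by
    apply WithConv.ext
    ext a
    change algebraMap K S (Coalgebra.counit (R := K) (h a)) = algebraMap K S _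
    rw [h1]
    rfl
  map_mul' x y := by
    let h' : A →ₐc[K] A' := BialgHom.ofAlgHom h (AlgHom.ext h1) (AlgHom.ext fun a ↦ (h2 a).symm)
    exact congrArg toConv (AlgHom.convMul_comp_bialgHom_distrib x y h')

end Points

/-- An action of the abstract group `G` on the affine group scheme `Spec A` by automorphisms of
group schemes over `K`, given by the automorphisms of the Hopf algebra `A`. -/
structure HopfAction (G : Type*) [Group G] (K : Type*) [Field K]
    (A : Type*) [CommRing A] [HopfAlgebra K A] where
  /-- The underlying action by algebra automorphisms. -/
  toHom : G →* (A ≃ₐ[K] A)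
  counit_apply : ∀ g a, Coalgebra.counit (R := K) (toHom g a) = Coalgebra.counit (R := K) a
  comul_apply : ∀ g a, Coalgebra.comul (R := K) (toHom g a) =
    TensorProduct.map (toHom g).toLinearMap (toHom g).toLinearMap (Coalgebra.comul a)

section Action

variable {G : Type*} [Group G] {K : Type*} [Field K] {A : Type*} [CommRing A] [HopfAlgebra K A]
  {S : Type*} [CommRing S] [Algebra K S]

/-- Precomposition of points with the automorphism of the Hopf algebra given by `g`. -/
def HopfAction.pre (α : HopfAction G K A) (g : G) : Pts K A S →* Pts K A S :=
  Pts.comap ((α.toHom g : A ≃ₐ[K] A) : A →ₐ[K] A) (α.counit_apply g) (α.comul_apply g)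

@[simp] theorem HopfAction.pre_apply (α : HopfAction G K A) (g : G) (x : Pts K A S) (a : A) :
    α.pre g x a = x (α.toHom g a) := rfl

/-- The action of `G` on the `S`-points, for `G` acting on `A` and on `S`: the element `g` takes
`φ : A → S` to `g ∘ φ ∘ g⁻¹`. -/
def ptsAct (α : HopfAction G K A) (σ : G →* (S ≃ₐ[K] S)) (g : G) : Pts K A S →* Pts K A S :=
  (Pts.map ((σ g : S ≃ₐ[K] S) : S →ₐ[K] S)).comp (α.pre g⁻¹)

@[simp] theorem ptsAct_apply (α : HopfAction G K A) (σ : G →* (S ≃ₐ[K] S)) (g : G)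
    (x : Pts K A S) (a : A) : ptsAct α σ g x a = σ g (x (α.toHom g⁻¹ a)) := rfl

theorem map_ptsAct {S' : Type*} [CommRing S'] [Algebra K S'] (α : HopfAction G K A)
    {σ : G →* (S ≃ₐ[K] S)} {σ' : G →* (S' ≃ₐ[K] S')} (f : S →ₐ[K] S') {g : G}
    (hσ : ∀ s, f (σ g s) = σ' g (f s)) (x : Pts K A S) :
    Pts.map f (ptsAct α σ g x) = ptsAct α σ' g (Pts.map f x) := by
  apply WithConv.ext
  ext a
  exact hσ _

end Action

/-! ### Hopf subalgebras -/

section SubHopf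

variable {K : Type*} [Field K] {A : Type*} [CommRing A] [HopfAlgebra K A] (L : Subalgebra K A)

/-- The inclusion `L ⊗ L → A ⊗ A`. -/
def incl₂ : L ⊗[K] L →ₐ[K] A ⊗[K] A := Algebra.TensorProduct.map L.val L.val

theorem incl₂_injective : Function.Injective (incl₂ L) :=
  TensorProduct.map_injective_of_flat_flat L.val.toLinearMap L.val.toLinearMap
    Subtype.val_injective Subtype.val_injective

/-- A subalgebra of a Hopf algebra stable under the comultiplication and the antipode. -/
structure IsSubHopf : Prop where
  comul_mem : ∀ a ∈ L, (Coalgebra.comul a : A ⊗[K] A) ∈ (incl₂ L).range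
  antipode_mem : ∀ a ∈ L, HopfAlgebra.antipode K a ∈ L

variable {L}

/-- The comultiplication restricted to `L`. -/
def IsSubHopf.comul (h : IsSubHopf L) : L →ₐ[K] L ⊗[K] L :=
  ((AlgEquiv.ofInjective (incl₂ L) (incl₂_injective L)).symm : _ →ₐ[K] L ⊗[K] L).comp
    (((Bialgebra.comulAlgHom K A).comp L.val).codRestrict (incl₂ L).range
      fun a ↦ h.comul_mem a a.2)

theorem IsSubHopf.incl₂_comul (h : IsSubHopf L) (a : L) :
    incl₂ L (h.comul a) = Coalgebra.comul (a : A) := by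
  have := (AlgEquiv.ofInjective (incl₂ L) (incl₂_injective L)).apply_symm_apply
    ((((Bialgebra.comulAlgHom K A).comp L.val).codRestrict (incl₂ L).range
      fun a ↦ h.comul_mem a a.2) a)
  exact congrArg Subtype.val this

theorem IsSubHopf.incl₂_comp_comul (h : IsSubHopf L) :
    (incl₂ L).comp h.comul = (Bialgebra.comulAlgHom K A).comp L.val :=
  AlgHom.ext h.incl₂_comul

theorem IsSubHopf.coassoc (h : IsSubHopf L) :
    (Algebra.TensorProduct.assoc K K K L L L).toAlgHom.comp
      ((Algebra.TensorProduct.map h.comul (.id K L)).comp h.comul)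
      = (Algebra.TensorProduct.map (.id K L) h.comul).comp h.comul := by
  have hinj : Function.Injective (Algebra.TensorProduct.map L.val (incl₂ L)) :=
    TensorProduct.map_injective_of_flat_flat L.val.toLinearMap (incl₂ L).toLinearMap
      Subtype.val_injective (incl₂_injective L)
  have e1 : (Algebra.TensorProduct.map L.val (incl₂ L)).comp
      (Algebra.TensorProduct.assoc K K K L L L).toAlgHom =
      (Algebra.TensorProduct.assoc K K K A A A).toAlgHom.comp
        (Algebra.TensorProduct.map (incl₂ L) L.val) := by
    ext <;> simp [incl₂, Algebra.TensorProduct.one_def]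
  have e2 : (Algebra.TensorProduct.map (incl₂ L) L.val).comp
      (Algebra.TensorProduct.map h.comul (.id K L)) =
      (Algebra.TensorProduct.map (Bialgebra.comulAlgHom K A) (.id K A)).comp (incl₂ L) := by
    rw [← Algebra.TensorProduct.map_comp, h.incl₂_comp_comul, incl₂,
      ← Algebra.TensorProduct.map_comp]
    rfl
  have e3 : (Algebra.TensorProduct.map L.val (incl₂ L)).comp
      (Algebra.TensorProduct.map (.id K L) h.comul) =
      (Algebra.TensorProduct.map (.id K A) (Bialgebra.comulAlgHom K A)).comp (incl₂ L) := by
    rw [← Algebra.TensorProduct.map_comp, h.incl₂_comp_comul, incl₂,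
      ← Algebra.TensorProduct.map_comp]
    rfl
  ext a
  apply hinj
  have h1 := congr($e1 ((Algebra.TensorProduct.map h.comul (.id K L)) (h.comul a)))
  have h2 := congr($e2 (h.comul a))
  have h3 := congr($e3 (h.comul a))
  simp only [AlgHom.comp_apply] at h1 h2 h3 ⊢
  rw [h1, h2, h3, h.incl₂_comul]
  exact Coalgebra.coassoc_apply (R := K) (a : A)

theorem IsSubHopf.rTensor_counit (h : IsSubHopf L) :
    (Algebra.TensorProduct.map ((Bialgebra.counitAlgHom K A).comp L.val) (.id K L)).comp h.comul
      = ((Algebra.TensorProduct.lid K L).symm : L →ₐ[K] K ⊗[K] L) := by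
  have hinj : Function.Injective (Algebra.TensorProduct.map (.id K K) L.val) :=
    TensorProduct.map_injective_of_flat_flat (LinearMap.id : K →ₗ[K] K) L.val.toLinearMap
      (fun _ _ h ↦ h) Subtype.val_injective
  have e1 : (Algebra.TensorProduct.map (.id K K) L.val).comp
      (Algebra.TensorProduct.map ((Bialgebra.counitAlgHom K A).comp L.val) (.id K L)) =
      (Algebra.TensorProduct.map (Bialgebra.counitAlgHom K A) (.id K A)).comp (incl₂ L) := by
    rw [← Algebra.TensorProduct.map_comp, incl₂, ← Algebra.TensorProduct.map_comp]
    rfl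
  ext a
  apply hinj
  have h1 := congr($e1 (h.comul a))
  simp only [AlgHom.comp_apply] at h1 ⊢
  rw [h1, h.incl₂_comul]
  exact Coalgebra.rTensor_counit_comul (R := K) (a : A)

theorem IsSubHopf.lTensor_counit (h : IsSubHopf L) :
    (Algebra.TensorProduct.map (.id K L) ((Bialgebra.counitAlgHom K A).comp L.val)).comp h.comul
      = ((Algebra.TensorProduct.rid K K L).symm : L →ₐ[K] L ⊗[K] K) := by
  have hinj : Function.Injective (Algebra.TensorProduct.map L.val (.id K K)) :=
    TensorProduct.map_injective_of_flat_flat L.val.toLinearMap (LinearMap.id : K →ₗ[K] K)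
      Subtype.val_injective (fun _ _ h ↦ h)
  have e1 : (Algebra.TensorProduct.map L.val (.id K K)).comp
      (Algebra.TensorProduct.map (.id K L) ((Bialgebra.counitAlgHom K A).comp L.val)) =
      (Algebra.TensorProduct.map (.id K A) (Bialgebra.counitAlgHom K A)).comp (incl₂ L) := by
    rw [← Algebra.TensorProduct.map_comp, incl₂, ← Algebra.TensorProduct.map_comp]
    rfl
  ext a
  apply hinj
  have h1 := congr($e1 (h.comul a))
  simp only [AlgHom.comp_apply] at h1 ⊢
  rw [h1, h.incl₂_comul]
  exact Coalgebra.lTensor_counit_comul (R := K) (a : A)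

/-- The antipode restricted to `L`. -/
def IsSubHopf.antipode (h : IsSubHopf L) : L →ₐ[K] L :=
  ((HopfAlgebra.antipodeAlgHom K A).comp L.val).codRestrict L fun a ↦ h.antipode_mem a a.2

/-- The Hopf algebra structure induced on `L`. -/
@[reducible] def IsSubHopf.hopfAlgebra (h : IsSubHopf L) : HopfAlgebra K L :=
  letI : Bialgebra K L := Bialgebra.ofAlgHom h.comul ((Bialgebra.counitAlgHom K A).comp L.val)
    h.coassoc h.rTensor_counit h.lTensor_counit
  HopfAlgebra.ofAlgHom h.antipode
    (by
      have e : (L.val).comp (Algebra.TensorProduct.lift h.antipode (.id K L)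
          fun _ _ ↦ Commute.all _ _) =
          (Algebra.TensorProduct.lift (HopfAlgebra.antipodeAlgHom K A) (.id K A)
          fun _ _ ↦ Commute.all _ _).comp (incl₂ L) := by
        ext a <;> simp [incl₂, IsSubHopf.antipode]; rfl
      ext a
      have h1 := congr($e (h.comul a))
      simp only [AlgHom.comp_apply] at h1 ⊢
      refine h1.trans ?_
      rw [h.incl₂_comul]
      have := HopfAlgebra.mul_antipode_rTensor_comul_apply (R := K) (a : A)
      refine Eq.trans ?_ this
      have e2 : (Algebra.TensorProduct.lift (HopfAlgebra.antipodeAlgHom K A) (.id K A)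
          fun _ _ ↦ Commute.all _ _).toLinearMap =
          LinearMap.mul' K A ∘ₗ (HopfAlgebra.antipode K).rTensor A := by
        ext a b; simp
      exact congr($e2 (Coalgebra.comul (a : A))))
    (by
      have e : (L.val).comp (Algebra.TensorProduct.lift (.id K L) h.antipode
          fun _ _ ↦ Commute.all _ _) =
          (Algebra.TensorProduct.lift (.id K A) (HopfAlgebra.antipodeAlgHom K A)
          fun _ _ ↦ Commute.all _ _).comp (incl₂ L) := by
        ext a <;> simp [incl₂, IsSubHopf.antipode]; rfl
      ext a
      have h1 := congr($e (h.comul a))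
      simp only [AlgHom.comp_apply] at h1 ⊢
      refine h1.trans ?_
      rw [h.incl₂_comul]
      have := HopfAlgebra.mul_antipode_lTensor_comul_apply (R := K) (a : A)
      refine Eq.trans ?_ this
      have e2 : (Algebra.TensorProduct.lift (.id K A) (HopfAlgebra.antipodeAlgHom K A)
          fun _ _ ↦ Commute.all _ _).toLinearMap =
          LinearMap.mul' K A ∘ₗ (HopfAlgebra.antipode K).lTensor A := by
        ext a b; simp
      exact congr($e2 (Coalgebra.comul (a : A))))

end SubHopf

/-! ### The descending central series -/

section CentralSeries

variable (K : Type u) [Field K] {A : Type u} [CommRing A] [HopfAlgebra K A]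

/-- The `S`-points of the closed subscheme of `Spec A` cut out by the ideal `I`. -/
def zeroLocus (I : Ideal A) (S : Type u) [CommRing S] [Algebra K S] : Set (Pts K A S) :=
  {x | ∀ a ∈ I, x a = 0}

/-- The closed subscheme of `Spec A` cut out by `I` is a normal subgroup scheme. -/
def IsNormalSubgroupIdeal (I : Ideal A) : Prop :=
  ∀ (S : Type u) [CommRing S] [Algebra K S],
    ∃ N : Subgroup (Pts K A S), N.Normal ∧ (N : Set (Pts K A S)) = zeroLocus K I S

variable (A) in
/-- The ideal of `U^{k+1}`, where `U = Spec A` and `U = U^1 ⊇ U^2 ⊇ ...` is the descending central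
series: `U^{k+2} = [U, U^{k+1}]` is the smallest closed normal subgroup scheme that contains
all commutators of points of `U` with points of `U^{k+1}`. -/
def lcsIdeal : ℕ → Ideal A
  | 0 => ⊥
  | k + 1 => sSup {I | IsNormalSubgroupIdeal K I ∧
      ∀ (S : Type u) [CommRing S] [Algebra K S] (x y : Pts K A S),
        y ∈ zeroLocus K (lcsIdeal k) S → x * y * x⁻¹ * y⁻¹ ∈ zeroLocus K I S}

variable {K}

theorem mem_zeroLocus_sSup {T : Set (Ideal A)} {S : Type u} [CommRing S] [Algebra K S]
    {x : Pts K A S} : x ∈ zeroLocus K (sSup T) S ↔ ∀ I ∈ T, x ∈ zeroLocus K I S := by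
  have key : ∀ I : Ideal A, x ∈ zeroLocus K I S ↔ I ≤ RingHom.ker x.ofConv := fun I ↦ Iff.rfl
  simp only [key, sSup_le_iff]

theorem isNormalSubgroupIdeal_sSup {T : Set (Ideal A)}
    (hT : ∀ I ∈ T, IsNormalSubgroupIdeal K I) : IsNormalSubgroupIdeal K (sSup T) := by
  intro S _ _
  choose! N hN using fun I hI ↦ hT I hI S
  refine ⟨⨅ I ∈ T, N I, ⟨fun n hn g ↦ ?_⟩, ?_⟩
  · simp only [Subgroup.mem_iInf] at hn ⊢
    exact fun I hI ↦ (hN I hI).1.conj_mem n (hn I hI) g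
  · ext x
    rw [mem_zeroLocus_sSup, SetLike.mem_coe]
    simp only [Subgroup.mem_iInf]
    exact forall₂_congr fun I hI ↦ by rw [← (hN I hI).2]; rfl

theorem isNormalSubgroupIdeal_lcsIdeal (k : ℕ) : IsNormalSubgroupIdeal K (lcsIdeal K A k) := by
  cases k with
  | zero =>
    intro S _ _
    refine ⟨⊤, inferInstance, ?_⟩
    ext x
    simp only [lcsIdeal, zeroLocus, Subgroup.coe_top, Set.mem_univ, Set.mem_ofPred_eq, true_iff]
    rintro a rfl
    exact map_zero x.ofConv
  | succ k => exact isNormalSubgroupIdeal_sSup fun I hI ↦ hI.1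

variable (K A) in
/-- The coordinate ring of `U_n = U / U^{n+1}`, `U = Spec A`: the functions on `U` that are
invariant under translation by `U^{n+1}`. -/
def lcsQuot (n : ℕ) : Subalgebra K A where
  carrier := {a | ∀ (S : Type u) [CommRing S] [Algebra K S] (x y : Pts K A S),
    y ∈ zeroLocus K (lcsIdeal K A n) S → (x * y) a = x a}
  mul_mem' {a b} ha hb S _ _ x y hy := by
    change (x * y).ofConv (a * b) = x.ofConv (a * b)
    rw [map_mul, map_mul]
    exact congrArg₂ _ (ha S x y hy) (hb S x y hy)
  add_mem' {a b} ha hb S _ _ x y hy := by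
    change (x * y).ofConv (a + b) = x.ofConv (a + b)
    rw [map_add, map_add]
    exact congrArg₂ _ (ha S x y hy) (hb S x y hy)
  algebraMap_mem' r S _ _ x y _ := by
    change (x * y).ofConv (algebraMap K A r) = x.ofConv (algebraMap K A r)
    rw [AlgHom.commutes, AlgHom.commutes]

theorem mem_lcsQuot {n : ℕ} {a : A} : a ∈ lcsQuot K A n ↔
    ∀ (S : Type u) [CommRing S] [Algebra K S] (x y : Pts K A S),
      y ∈ zeroLocus K (lcsIdeal K A n) S → (x * y) a = x a := Iff.rfl

theorem mem_lcsQuot_left {n : ℕ} {a : A} : a ∈ lcsQuot K A n ↔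
    ∀ (S : Type u) [CommRing S] [Algebra K S] (x y : Pts K A S),
      y ∈ zeroLocus K (lcsIdeal K A n) S → (y * x) a = x a := by
  constructor
  · intro h S _ _ x y hy
    obtain ⟨N, hN, hN'⟩ := isNormalSubgroupIdeal_lcsIdeal (K := K) (A := A) n S
    rw [← hN'] at hy
    have hy' : x⁻¹ * y * x ∈ N := by simpa using hN.conj_mem y hy x⁻¹
    have := h S x (x⁻¹ * y * x) (by rw [← hN']; exact hy')
    simpa [← mul_assoc] using this
  · intro h S _ _ x y hy
    obtain ⟨N, hN, hN'⟩ := isNormalSubgroupIdeal_lcsIdeal (K := K) (A := A) n S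
    rw [← hN'] at hy
    have hy' : x * y * x⁻¹ ∈ N := hN.conj_mem y hy x
    have := h S x (x * y * x⁻¹) (by rw [← hN']; exact hy')
    simpa using this

/-- `a ↦ (id ⊗ π) (comul a) - a ⊗ 1` -/
def rightDefect (I : Ideal A) : A →ₗ[K] A ⊗[K] (A ⧸ I) :=
  (Ideal.Quotient.mkₐ K I).toLinearMap.lTensor A ∘ₗ Coalgebra.comul -
    (TensorProduct.mk K A (A ⧸ I)).flip 1

/-- `a ↦ (π ⊗ id) (comul a) - 1 ⊗ a` -/
def leftDefect (I : Ideal A) : A →ₗ[K] (A ⧸ I) ⊗[K] A :=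
  (Ideal.Quotient.mkₐ K I).toLinearMap.rTensor A ∘ₗ Coalgebra.comul -
    TensorProduct.mk K (A ⧸ I) A 1

theorem lift_eq_lTensor {S : Type*} [CommRing S] [Algebra K S] (x y : A →ₐ[K] S)
    {I : Ideal A} (y' : (A ⧸ I) →ₐ[K] S) (hy : ∀ b, y b = y' (Ideal.Quotient.mk I b))
    (z : A ⊗[K] A) :
    Algebra.TensorProduct.lift x y (fun _ _ ↦ .all _ _) z =
    Algebra.TensorProduct.lift x y' (fun _ _ ↦ .all _ _)
      ((Ideal.Quotient.mkₐ K I).toLinearMap.lTensor A z) := by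
  induction z with
  | zero => simp
  | tmul a b => simp [hy]
  | add a b ha hb => simp only [map_add, ha, hb]

theorem lift_eq_rTensor {S : Type*} [CommRing S] [Algebra K S] (y x : A →ₐ[K] S)
    {I : Ideal A} (y' : (A ⧸ I) →ₐ[K] S) (hy : ∀ b, y b = y' (Ideal.Quotient.mk I b))
    (z : A ⊗[K] A) :
    Algebra.TensorProduct.lift y x (fun _ _ ↦ .all _ _) z =
    Algebra.TensorProduct.lift y' x (fun _ _ ↦ .all _ _)
      ((Ideal.Quotient.mkₐ K I).toLinearMap.rTensor A z) := by
  induction z with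
  | zero => simp
  | tmul a b => simp [hy]
  | add a b ha hb => simp only [map_add, ha, hb]

theorem lift_include {M N : Type*} [CommRing M] [Algebra K M] [CommRing N] [Algebra K N]
    (z : M ⊗[K] N) : Algebra.TensorProduct.lift
      (Algebra.TensorProduct.includeLeft : M →ₐ[K] M ⊗[K] N)
      Algebra.TensorProduct.includeRight (fun _ _ ↦ .all _ _) z = z := by
  induction z with
  | zero => simp
  | tmul a b => simp
  | add a b ha hb => simp only [map_add, ha, hb]

theorem mem_lcsQuot_iff_right {n : ℕ} {a : A} :
    a ∈ lcsQuot K A n ↔ rightDefect (K := K) (lcsIdeal K A n) a = 0 := by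
  set I := lcsIdeal K A n
  constructor
  · intro h
    have := h (A ⊗[K] (A ⧸ I)) (toConv Algebra.TensorProduct.includeLeft)
      (toConv (Algebra.TensorProduct.includeRight.comp (Ideal.Quotient.mkₐ K I)))
      (fun b hb ↦ by
        change (1 : A) ⊗ₜ[K] (Ideal.Quotient.mk I b) = 0
        rw [Ideal.Quotient.eq_zero_iff_mem.mpr hb, TensorProduct.tmul_zero])
    rw [mul_apply, lift_eq_lTensor _ _ Algebra.TensorProduct.includeRight (fun _ ↦ rfl)] at this
    rw [ofConv_toConv, lift_include] at this
    exact sub_eq_zero.mpr this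
  · intro h S _ _ x y hy
    rw [mul_apply, lift_eq_lTensor _ _ (Ideal.Quotient.liftₐ I y.ofConv hy) (fun _ ↦ rfl)]
    have h' := sub_eq_zero.mp h
    rw [LinearMap.comp_apply] at h'
    rw [h']
    simp

theorem mem_lcsQuot_iff_left {n : ℕ} {a : A} :
    a ∈ lcsQuot K A n ↔ leftDefect (K := K) (lcsIdeal K A n) a = 0 := by
  rw [mem_lcsQuot_left]
  set I := lcsIdeal K A n
  constructor
  · intro h
    have := h ((A ⧸ I) ⊗[K] A) (toConv Algebra.TensorProduct.includeRight)
      (toConv (Algebra.TensorProduct.includeLeft.comp (Ideal.Quotient.mkₐ K I)))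
      (fun b hb ↦ by
        change (Ideal.Quotient.mk I b) ⊗ₜ[K] (1 : A) = 0
        rw [Ideal.Quotient.eq_zero_iff_mem.mpr hb, TensorProduct.zero_tmul])
    rw [mul_apply, lift_eq_rTensor _ _ Algebra.TensorProduct.includeLeft (fun _ ↦ rfl)] at this
    rw [ofConv_toConv, lift_include] at this
    exact sub_eq_zero.mpr this
  · intro h S _ _ x y hy
    rw [mul_apply, lift_eq_rTensor _ _ (Ideal.Quotient.liftₐ I y.ofConv hy) (fun _ ↦ rfl)]
    have h' := sub_eq_zero.mp h
    rw [LinearMap.comp_apply] at h'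
    rw [h']
    simp

theorem lTensor_rightDefect (I : Ideal A) (a : A) :
    (rightDefect (K := K) I).lTensor A (Coalgebra.comul a) =
      TensorProduct.assoc K A A (A ⧸ I)
        ((Coalgebra.comul (R := K)).rTensor (A ⧸ I) (rightDefect (K := K) I a)) := by
  have e1 : (TensorProduct.assoc K A A (A ⧸ I)).toLinearMap ∘ₗ
      (Coalgebra.comul (R := K)).rTensor (A ⧸ I) ∘ₗ
        (Ideal.Quotient.mkₐ K I).toLinearMap.lTensor A =
      ((Ideal.Quotient.mkₐ K I).toLinearMap.lTensor A).lTensor A ∘ₗ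
        (TensorProduct.assoc K A A A).toLinearMap ∘ₗ (Coalgebra.comul (R := K)).rTensor A := by
    ext a b
    simp only [TensorProduct.AlgebraTensorModule.curry_apply, TensorProduct.curry_apply,
      LinearMap.restrictScalars_self, LinearMap.comp_apply, LinearMap.lTensor_tmul,
      LinearMap.rTensor_tmul, LinearEquiv.coe_coe]
    induction (Coalgebra.comul (R := K) a) with
    | zero => simp
    | tmul c d => simp
    | add c d hc hd => simp only [TensorProduct.add_tmul, map_add, hc, hd]
  have e2 (z : A ⊗[K] A) : TensorProduct.assoc K A A (A ⧸ I) (z ⊗ₜ 1) =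
      ((TensorProduct.mk K A (A ⧸ I)).flip 1).lTensor A z := by
    induction z with
    | zero => simp
    | tmul c d => simp
    | add c d hc hd => simp only [TensorProduct.add_tmul, map_add, hc, hd]
  have h1 := congr($e1 (Coalgebra.comul a))
  simp only [LinearMap.comp_apply, LinearEquiv.coe_coe, Coalgebra.coassoc_apply] at h1
  simp only [rightDefect, LinearMap.lTensor_sub, LinearMap.sub_apply, map_sub,
    LinearMap.comp_apply, h1, LinearMap.lTensor_comp, LinearMap.flip_apply,
    TensorProduct.mk_apply, LinearMap.rTensor_tmul, e2]

theorem rTensor_leftDefect (I : Ideal A) (a : A) :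
    TensorProduct.assoc K (A ⧸ I) A A
      ((leftDefect (K := K) I).rTensor A (Coalgebra.comul a)) =
        (Coalgebra.comul (R := K)).lTensor (A ⧸ I) (leftDefect (K := K) I a) := by
  have e1 : (Coalgebra.comul (R := K)).lTensor (A ⧸ I) ∘ₗ
        (Ideal.Quotient.mkₐ K I).toLinearMap.rTensor A =
      (Ideal.Quotient.mkₐ K I).toLinearMap.rTensor (A ⊗[K] A) ∘ₗ
        (Coalgebra.comul (R := K)).lTensor A := by
    ext a b
    simp
  have e2 (z : (A ⊗[K] A) ⊗[K] A) : TensorProduct.assoc K (A ⧸ I) A A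
      (((Ideal.Quotient.mkₐ K I).toLinearMap.rTensor A).rTensor A z) =
      (Ideal.Quotient.mkₐ K I).toLinearMap.rTensor (A ⊗[K] A) (TensorProduct.assoc K A A A z) := by
    have : (TensorProduct.assoc K (A ⧸ I) A A).toLinearMap ∘ₗ
      ((Ideal.Quotient.mkₐ K I).toLinearMap.rTensor A).rTensor A =
      (Ideal.Quotient.mkₐ K I).toLinearMap.rTensor (A ⊗[K] A) ∘ₗ
        (TensorProduct.assoc K A A A).toLinearMap := by
      ext; simp
    exact congr($this z)
  have e3 (z : A ⊗[K] A) : TensorProduct.assoc K (A ⧸ I) A A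
      ((TensorProduct.mk K (A ⧸ I) A 1).rTensor A z) = 1 ⊗ₜ z := by
    induction z with
    | zero => simp
    | tmul c d => simp
    | add c d hc hd => simp only [TensorProduct.tmul_add, map_add, hc, hd]
  have h1 := congr($e1 (Coalgebra.comul a))
  simp only [LinearMap.comp_apply] at h1
  have h2 : (leftDefect (K := K) I).rTensor A (Coalgebra.comul a) =
      ((Ideal.Quotient.mkₐ K I).toLinearMap.rTensor A).rTensor A
        ((Coalgebra.comul (R := K)).rTensor A (Coalgebra.comul a)) -
      (TensorProduct.mk K (A ⧸ I) A 1).rTensor A (Coalgebra.comul a) := by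
    rw [leftDefect, LinearMap.rTensor_sub, LinearMap.rTensor_comp]
    rfl
  have h3 : leftDefect (K := K) I a = (Ideal.Quotient.mkₐ K I).toLinearMap.rTensor A
      (Coalgebra.comul a) - 1 ⊗ₜ a := rfl
  rw [h2, h3, map_sub, map_sub, e2, e3, Coalgebra.coassoc_apply, h1, LinearMap.lTensor_tmul]

theorem isSubHopf_lcsQuot (n : ℕ) : IsSubHopf (lcsQuot K A n) := by
  set I := lcsIdeal K A n with hI
  set L := lcsQuot K A n with hL
  have exR : Function.Exact L.val.toLinearMap (rightDefect (K := K) I) := fun a ↦ by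
    rw [← mem_lcsQuot_iff_right]
    exact ⟨fun h ↦ ⟨⟨a, h⟩, rfl⟩, fun ⟨b, hb⟩ ↦ hb ▸ b.2⟩
  have exL : Function.Exact L.val.toLinearMap (leftDefect (K := K) I) := fun a ↦ by
    rw [← mem_lcsQuot_iff_left]
    exact ⟨fun h ↦ ⟨⟨a, h⟩, rfl⟩, fun ⟨b, hb⟩ ↦ hb ▸ b.2⟩
  refine ⟨fun a ha ↦ ?_, fun a ha ↦ ?_⟩
  · have h1 : (leftDefect (K := K) I).rTensor A (Coalgebra.comul a) = 0 := by
      apply (TensorProduct.assoc K (A ⧸ I) A A).injective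
      rw [rTensor_leftDefect, mem_lcsQuot_iff_left.mp ha, map_zero, map_zero]
    have h2 : (rightDefect (K := K) I).lTensor A (Coalgebra.comul a) = 0 := by
      rw [lTensor_rightDefect, mem_lcsQuot_iff_right.mp ha, map_zero, map_zero]
    obtain ⟨w, hw⟩ := (Module.Flat.rTensor_exact A exL _).mp h1
    have h3 : (rightDefect (K := K) I).lTensor L w = 0 := by
      apply Module.Flat.rTensor_preserves_injective_linearMap
        (M := A ⊗[K] (A ⧸ I)) L.val.toLinearMap Subtype.val_injective
      rw [map_zero, ← h2, ← hw]
      exact congr($(LinearMap.rTensor_comp_lTensor (f := L.val.toLinearMap)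
        (g := rightDefect (K := K) I)) w).trans
        congr($(LinearMap.lTensor_comp_rTensor (f := L.val.toLinearMap)
        (g := rightDefect (K := K) I)) w).symm
    obtain ⟨t, ht⟩ := (Module.Flat.lTensor_exact L exR _).mp h3
    refine ⟨t, ?_⟩
    rw [← hw, ← ht]
    exact congr($(LinearMap.rTensor_comp_lTensor (f := L.val.toLinearMap)
        (g := L.val.toLinearMap)) t).symm
  · intro S _ _ x y hy
    obtain ⟨N, hN, hN'⟩ := isNormalSubgroupIdeal_lcsIdeal (K := K) (A := A) n S
    have hy' : y⁻¹ ∈ zeroLocus K (lcsIdeal K A n) S := by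
      rw [← hN'] at hy ⊢
      exact N.inv_mem hy
    have := mem_lcsQuot_left.mp ha S x⁻¹ y⁻¹ hy'
    rw [← mul_inv_rev] at this
    exact this

end CentralSeries

/-! ### The quotients `U_n` with their action of `G` -/

section Quotients

variable {G : Type*} [Group G] {K : Type u} [Field K] {A : Type u} [CommRing A] [HopfAlgebra K A]

instance lcsQuotHopf (n : ℕ) : HopfAlgebra K (lcsQuot K A n) :=
  (isSubHopf_lcsQuot n).hopfAlgebra

theorem lcsQuot_counit (n : ℕ) (a : lcsQuot K A n) :
    Coalgebra.counit (R := K) a = Coalgebra.counit (R := K) (a : A) := rfl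

theorem lcsQuot_comul (n : ℕ) (a : lcsQuot K A n) :
    incl₂ (lcsQuot K A n) (Coalgebra.comul (R := K) a) = Coalgebra.comul (R := K) (a : A) :=
  (isSubHopf_lcsQuot n).incl₂_comul a

theorem HopfAction.pre_inv_pre (α : HopfAction G K A) {S : Type*} [CommRing S] [Algebra K S]
    (g : G) (x : Pts K A S) : α.pre g⁻¹ (α.pre g x) = x := by
  apply WithConv.ext
  ext a
  change x (α.toHom g (α.toHom g⁻¹ a)) = x a
  rw [← AlgEquiv.mul_apply, ← map_mul, mul_inv_cancel, map_one, AlgEquiv.one_apply]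

theorem HopfAction.lcsIdeal_stable (α : HopfAction G K A) (k : ℕ) :
    ∀ g, ∀ a ∈ lcsIdeal K A k, α.toHom g a ∈ lcsIdeal K A k := by
  induction k with
  | zero =>
    rintro g a rfl
    rw [map_zero]
    exact Ideal.zero_mem _
  | succ k ih =>
    intro g
    suffices h : lcsIdeal K A (k + 1) ≤ (lcsIdeal K A (k + 1)).comap (α.toHom g) from
      fun a ha ↦ h ha
    refine sSup_le fun I ⟨hI, hI'⟩ ↦ ?_
    have key : I.comap (α.toHom g⁻¹) ≤ lcsIdeal K A (k + 1) := by
      have hz (S : Type u) [CommRing S] [Algebra K S] (x : Pts K A S) :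
          x ∈ zeroLocus K (I.comap (α.toHom g⁻¹)) S ↔ α.pre g x ∈ zeroLocus K I S := by
        constructor
        · intro h a ha
          refine h (α.toHom g a) ?_
          change α.toHom g⁻¹ (α.toHom g a) ∈ I
          rwa [← AlgEquiv.mul_apply, ← map_mul, inv_mul_cancel, map_one, AlgEquiv.one_apply]
        · intro h a ha
          have := h _ ha
          rwa [HopfAction.pre_apply, ← AlgEquiv.mul_apply, ← map_mul, mul_inv_cancel, map_one,
            AlgEquiv.one_apply] at this
      refine le_sSup ⟨fun S _ _ ↦ ?_, fun S _ _ x y hy ↦ ?_⟩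
      · obtain ⟨N, hN, hN'⟩ := hI S
        refine ⟨N.comap (α.pre g), hN.comap _, ?_⟩
        ext x
        rw [hz, ← hN']
        rfl
      · rw [hz, map_mul, map_mul, map_mul, map_inv, map_inv]
        exact hI' S _ _ fun a ha ↦ hy _ (ih g a ha)
    intro a ha
    refine key ?_
    change α.toHom g⁻¹ (α.toHom g a) ∈ I
    rwa [← AlgEquiv.mul_apply, ← map_mul, inv_mul_cancel, map_one, AlgEquiv.one_apply]

theorem HopfAction.lcsQuot_stable (α : HopfAction G K A) (n : ℕ) (g : G) :
    ∀ a ∈ lcsQuot K A n, α.toHom g a ∈ lcsQuot K A n := by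
  intro a ha S _ _ x y hy
  have := ha S (α.pre g x) (α.pre g y) fun b hb ↦ hy _ (α.lcsIdeal_stable n g b hb)
  rw [← map_mul] at this
  exact this

/-- The automorphism of `lcsQuot K A n` given by `g`. -/
def HopfAction.quotAut (α : HopfAction G K A) (n : ℕ) (g : G) :
    lcsQuot K A n ≃ₐ[K] lcsQuot K A n :=
  AlgEquiv.ofAlgHom
    ((((α.toHom g : A ≃ₐ[K] A) : A →ₐ[K] A).comp (lcsQuot K A n).val).codRestrict _
      fun a ↦ α.lcsQuot_stable n g a a.2)
    ((((α.toHom g⁻¹ : A ≃ₐ[K] A) : A →ₐ[K] A).comp (lcsQuot K A n).val).codRestrict _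
      fun a ↦ α.lcsQuot_stable n g⁻¹ a a.2)
    (by
      ext a
      change α.toHom g (α.toHom g⁻¹ (a : A)) = a
      rw [← AlgEquiv.mul_apply, ← map_mul, mul_inv_cancel, map_one, AlgEquiv.one_apply])
    (by
      ext a
      change α.toHom g⁻¹ (α.toHom g (a : A)) = a
      rw [← AlgEquiv.mul_apply, ← map_mul, inv_mul_cancel, map_one, AlgEquiv.one_apply])

theorem HopfAction.coe_quotAut (α : HopfAction G K A) (n : ℕ) (g : G) (a : lcsQuot K A n) :
    (α.quotAut n g a : A) = α.toHom g a := rfl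

/-- The action of `G` on `U_n = U / U^{n+1}` induced by an action on `U`. -/
def HopfAction.quot (α : HopfAction G K A) (n : ℕ) : HopfAction G K (lcsQuot K A n) where
  toHom :=
    { toFun := α.quotAut n
      map_one' := by
        ext a
        rw [HopfAction.coe_quotAut, map_one]
        rfl
      map_mul' := fun g h ↦ by
        ext a
        rw [HopfAction.coe_quotAut, map_mul]
        rfl }
  counit_apply g a := α.counit_apply g a
  comul_apply g a := by
    apply incl₂_injective
    change incl₂ (lcsQuot K A n) (Coalgebra.comul (R := K) (α.quotAut n g a)) = incl₂ (lcsQuot K A n) (TensorProduct.map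
      (α.quotAut n g).toLinearMap (α.quotAut n g).toLinearMap (Coalgebra.comul (R := K) a))
    rw [lcsQuot_comul, HopfAction.coe_quotAut, α.comul_apply, ← lcsQuot_comul]
    generalize (Coalgebra.comul (R := K) a) = z
    induction z with
    | zero => simp
    | tmul c d => simp [incl₂, HopfAction.coe_quotAut]
    | add c d hc hd => simp only [map_add, hc, hd]

end Quotients

/-! ### Unipotence -/

/-- The affine group scheme `Spec A` is (pro-)unipotent: its Hopf algebra is coconnected, that is, it
is the union of an increasing sequence `C 0 ⊆ C 1 ⊆ ...` of subspaces with `C 0 = K` and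
`comul (C r) ⊆ ∑ C i ⊗ C (r - i)`. (Equivalently: every non-zero representation of `Spec A` has a
non-zero fixed vector.) -/
def IsUnipotent (K : Type*) [Field K] (A : Type*) [CommRing A] [HopfAlgebra K A] : Prop :=
  ∃ C : ℕ → Submodule K A, Monotone C ∧ C 0 = Submodule.span K {1} ∧ (∀ a, ∃ r, a ∈ C r) ∧
    ∀ r, ∀ a ∈ C r, (Coalgebra.comul a : A ⊗[K] A) ∈
      ⨆ p ∈ Finset.HasAntidiagonal.antidiagonal r, (TensorProduct.map (C p.1).subtype (C p.2).subtype).range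

/-! ### Topologies -/

section Topology

/-- The inductive limit topology on a vector space `M` over a topological field `k`: the finest
topology for which all `k`-linear maps `k ^ m → M` are continuous. On a finite-dimensional space
it is the product topology with respect to any basis; in general it is the inductive limit
topology with respect to the finite-dimensional subspaces. -/
@[reducible] def indTopology (k : Type*) [Field k] [TopologicalSpace k] (M : Type*) [AddCommGroup M]
    [Module k M] : TopologicalSpace M :=
  ⨆ (m : ℕ) (w : Fin m → M),
    TopologicalSpace.coinduced (fun c : Fin m → k ↦ ∑ i, c i • w i) inferInstance

/-- The topology on the `S`-points of `Spec A`, where `S` is a vector space over the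
topological field `k`: the coarsest topology for which evaluation at any finite family
`a_1, ..., a_m` of elements of `A` is continuous as a map to `S ^ m` with its inductive limit
topology. If `A` is of finite type, it is induced by `Spec A → 𝔸 ^ m` for any
finite system of generators. -/
@[reducible] def ptsTopology (k : Type*) [Field k] [TopologicalSpace k] (K : Type*) [Field K]
    (A : Type*) [CommRing A] [HopfAlgebra K A] (S : Type*) [CommRing S] [Algebra K S]
    [Module k S] : TopologicalSpace (Pts K A S) :=
  ⨅ (m : ℕ) (e : Fin m → A),
    TopologicalSpace.induced (fun x i ↦ x (e i)) (indTopology k (Fin m → S))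

variable {k : Type*} [Field k] [TopologicalSpace k] {k' : Type*} [Field k'] [TopologicalSpace k']
  {K : Type*} [Field K] {A : Type*} [CommRing A] [HopfAlgebra K A]
  {S : Type*} [CommRing S] [Algebra K S] [Module k S]
  {S' : Type*} [CommRing S'] [Algebra K S'] [Module k' S']

theorem continuous_indTopology {M M' : Type*} [AddCommGroup M] [Module k M] [AddCommGroup M']
    [Module k' M'] (j : k → k') (hj : Continuous j) (f : M →+ M')
    (hf : ∀ (c : k) (s : M), f (c • s) = j c • f s) :
    Continuous[indTopology k M, indTopology k' M'] f := by
  rw [continuous_iff_coinduced_le, indTopology]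
  simp only [coinduced_iSup, iSup_le_iff, coinduced_compose]
  intro m w
  rw [← continuous_iff_coinduced_le]
  have h : (⇑f ∘ fun c : Fin m → k ↦ ∑ i, c i • w i) =
      (fun c : Fin m → k' ↦ ∑ i, c i • f (w i)) ∘ fun c i ↦ j (c i) := by
    ext c
    simp [map_sum, hf]
  rw [h]
  let _ : TopologicalSpace M' := indTopology k' M'
  have h1 : Continuous fun c : Fin m → k' ↦ ∑ i, c i • f (w i) := by
    rw [continuous_iff_coinduced_le]
    exact le_iSup₂_of_le (f := fun (m : ℕ) (w : Fin m → M') ↦ TopologicalSpace.coinduced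
      (fun c : Fin m → k' ↦ ∑ i, c i • w i) inferInstance) m (fun i ↦ f (w i)) le_rfl
  have h2 : Continuous fun (c : Fin m → k) (i : Fin m) ↦ j (c i) := by fun_prop
  exact h1.comp h2

theorem Pts.continuous_map (j : k → k') (hj : Continuous j) (f : S →ₐ[K] S')
    (hf : ∀ (c : k) (s : S), f (c • s) = j c • f s) :
    Continuous[ptsTopology k K A S, ptsTopology k' K A S'] (Pts.map (A := A) f) := by
  let _ : TopologicalSpace (Pts K A S) := ptsTopology k K A S
  refine continuous_iInf_rng.2 fun m ↦ continuous_iInf_rng.2 fun e ↦ continuous_induced_rng.2 ?_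
  let _ : TopologicalSpace (Fin m → S) := indTopology k (Fin m → S)
  let _ : TopologicalSpace (Fin m → S') := indTopology k' (Fin m → S')
  have h1 : Continuous fun (x : Pts K A S) (i : Fin m) ↦ x (e i) :=
    
    continuous_iff_le_induced.2 (iInf₂_le (f := fun (m : ℕ) (e : Fin m → A) ↦
      TopologicalSpace.induced (fun (x : Pts K A S) i ↦ x (e i)) (indTopology k (Fin m → S))) m e)
  have h2 : Continuous (fun (w : Fin m → S) (i : Fin m) ↦ f (w i)) :=
    continuous_indTopology j hj
      (AddMonoidHom.mk' (fun (w : Fin m → S) (i : Fin m) ↦ f (w i))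
        fun a b ↦ by ext i; simp)
      (fun c s ↦ by ext i; simp [hf])
  exact h2.comp h1

end Topology

/-! ### Non-abelian continuous cohomology in degree one -/

section H1

variable {G : Type v} [Group G] [TopologicalSpace G]
  (k : Type*) [Field k] [TopologicalSpace k] {K : Type u} [Field K]
  {A : Type u} [CommRing A] [HopfAlgebra K A] (α : HopfAction G K A)
  {S : Type u} [CommRing S] [Algebra K S] [Module k S] (σ : G →* (S ≃ₐ[K] S))

/-- Continuous 1-cocycles of `G` with values in the `S`-points of `Spec A`, where `S` carries the
topology of a vector space over the topological field `k`. -/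
abbrev Cocycles : Type (max u v) :=
  {c : G → Pts K A S // Continuous[inferInstance, ptsTopology k K A S] c ∧
    ∀ g h, c (g * h) = c g * ptsAct α σ g (c h)}

/-- Two cocycles are equivalent if they are in one orbit of the action
`(u c)(g) = u c(g) g(u⁻¹)`. -/
def cocycleSetoid : Setoid (Cocycles k α σ) where
  r c c' := ∃ u : Pts K A S, ∀ g, c'.1 g = u * c.1 g * ptsAct α σ g u⁻¹
  iseqv :=
    { refl := fun c ↦ ⟨1, fun g ↦ by simp⟩
      symm := fun {c c'} ⟨u, hu⟩ ↦ ⟨u⁻¹, fun g ↦ by simp [hu, mul_assoc]⟩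
      trans := fun {c c' c''} ⟨u, hu⟩ ⟨w, hw⟩ ↦
        ⟨w * u, fun g ↦ by simp only [hw, hu, mul_inv_rev, map_mul, mul_assoc]⟩ }

/-- The continuous cohomology set `H¹(G, (Spec A)(S))`. -/
def H1 : Type (max u v) := Quotient (cocycleSetoid k α σ)

/-- The basepoint of `H¹`: the class of the trivial cocycle. -/
def H1.basepoint : H1 k α σ :=
  Quotient.mk _ ⟨fun _ ↦ 1, @continuous_const _ _ _ (ptsTopology k K A S) _,
    fun g _ ↦ by rw [map_one, mul_one]⟩

variable {k σ} {k' : Type*} [Field k'] [TopologicalSpace k']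
  {S' : Type u} [CommRing S'] [Algebra K S'] [Module k' S'] {σ' : G →* (S' ≃ₐ[K] S')}

/-- The map on `H¹` induced by a `G`-equivariant homomorphism `f : S → S'` of coefficient algebras
that is semilinear with respect to a continuous map `j : k → k'` of topological fields. -/
def H1.map (j : k → k') (hj : Continuous j) (f : S →ₐ[K] S')
    (hf : ∀ (c : k) (s : S), f (c • s) = j c • f s)
    (hσ : ∀ g s, f (σ g s) = σ' g (f s)) : H1 k α σ → H1 k' α σ' :=
  Quotient.map
    (fun c ↦ ⟨fun g ↦ Pts.map f (c.1 g),
      @Continuous.comp _ _ _ _ (ptsTopology k K A S) (ptsTopology k' K A S') _ _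
        (Pts.continuous_map j hj f hf) c.2.1,
      fun g h ↦ by
        change Pts.map f (c.1 (g * h)) = _
        rw [c.2.2, map_mul, map_ptsAct α f (hσ g)]⟩)
    (by
      rintro c c' ⟨u, hu⟩
      exact ⟨Pts.map f u, fun g ↦ by
        change Pts.map f (c'.1 g) = Pts.map f u * Pts.map f (c.1 g) * _
        rw [hu, map_mul, map_mul, map_ptsAct α f (hσ _), map_inv]⟩)

open CategoryTheory

/-- The functor `R ↦ H¹(G, (Spec A)(R))` on commutative `K`-algebras, where `G` acts
trivially on `R` and `R` has the inductive limit topology of a `K`-vector space. -/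
def H1Functor [TopologicalSpace K] : CommAlgCat.{u} K ⥤ Type (max u v) where
  obj R := H1 K α (1 : G →* (R ≃ₐ[K] R))
  map f := ↾(H1.map α (σ := 1) (σ' := 1) id continuous_id f.hom
    (fun c s ↦ map_smul f.hom c s) (fun _ _ ↦ rfl))
  map_id R := by
    ext x
    induction x using Quotient.inductionOn
    rfl
  map_comp f g := by
    ext x
    induction x using Quotient.inductionOn
    rfl

/-- The map `H¹(G, (Spec A)(K)) → H¹(G, (Spec A)(B))` for a topological field `B` with an action
`τ` of `G` by automorphisms over `K`. -/
def H1.toField [TopologicalSpace K] {B : Type u} [Field B] [TopologicalSpace B] [Algebra K B]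
    (hB : Continuous (algebraMap K B)) (τ : G →* (B ≃ₐ[K] B)) :
    H1 K α (1 : G →* (K ≃ₐ[K] K)) → H1 B α τ :=
  H1.map α (algebraMap K B) hB (Algebra.ofId K B)
    (fun c s ↦ by simp [Algebra.ofId_apply])
    (fun g s ↦ by simp [Algebra.ofId_apply])

end H1

/-! ### Invariants of the quotient sets -/

section H0

variable {G : Type*} [Group G] {K : Type u} [Field K] {A : Type u} [CommRing A] [HopfAlgebra K A]
  (α : HopfAction G K A) {B : Type u} [Field B] [Algebra K B] (σ : G →* (B ≃ₐ[K] B))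
  (R : Type u) [CommRing R] [Algebra K R]

/-- The action of `G` on `B ⊗ R` by `g (b ⊗ r) = g b ⊗ r`. -/
def tensorAct : G →* (B ⊗[K] R ≃ₐ[K] B ⊗[K] R) where
  toFun g := Algebra.TensorProduct.congr (σ g) AlgEquiv.refl
  map_one' := by
    ext x
    simp only [map_one]
    induction x with
    | zero => simp
    | tmul c d => simp
    | add c d hc hd => simp only [map_add, hc, hd]
  map_mul' g h := by
    ext x
    simp only [map_mul]
    induction x with
    | zero => simp
    | tmul c d => simp
    | add c d hc hd => simp only [map_add, hc, hd]

variable (K A B) in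
/-- The subgroup `(Spec A)(R)` of `(Spec A)(B ⊗ R)`. -/
def ratPts : Subgroup (Pts K A (B ⊗[K] R)) :=
  (Pts.map (A := A) (Algebra.TensorProduct.includeRight : R →ₐ[K] B ⊗[K] R)).range

theorem ptsAct_mem_ratPts (g : G) {x : Pts K A (B ⊗[K] R)} (hx : x ∈ ratPts K A B R) :
    ptsAct α (tensorAct σ R) g x ∈ ratPts K A B R := by
  obtain ⟨y, rfl⟩ := hx
  refine ⟨ptsAct α (1 : G →* (R ≃ₐ[K] R)) g y, map_ptsAct α _ (fun r ↦ ?_) y⟩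
  simp [tensorAct]

/-- The action of `g` on the quotient set `(Spec A)(B ⊗ R) / (Spec A)(R)`. -/
def quotientAct (g : G) :
    Pts K A (B ⊗[K] R) ⧸ ratPts K A B R → Pts K A (B ⊗[K] R) ⧸ ratPts K A B R :=
  Quotient.map' (ptsAct α (tensorAct σ R) g) fun x y h ↦ by
    rw [QuotientGroup.leftRel_apply] at h ⊢
    rw [← map_inv, ← map_mul]
    exact ptsAct_mem_ratPts α σ R g h

/-- `H⁰(G, (Spec A)(B ⊗ R) / (Spec A)(R))` -/
def H0 : Type u := {q : Pts K A (B ⊗[K] R) ⧸ ratPts K A B R // ∀ g, quotientAct α σ R g q = q}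

variable {R} {R' : Type u} [CommRing R'] [Algebra K R']

variable (A B) in
/-- The map of quotient sets induced by a homomorphism `R → R'`. -/
def quotientMap (f : R →ₐ[K] R') :
    Pts K A (B ⊗[K] R) ⧸ ratPts K A B R → Pts K A (B ⊗[K] R') ⧸ ratPts K A B R' :=
  Quotient.map' (Pts.map (Algebra.TensorProduct.map (AlgHom.id K B) f)) fun x y h ↦ by
    rw [QuotientGroup.leftRel_apply] at h ⊢
    rw [← map_inv, ← map_mul]
    obtain ⟨z, hz⟩ := h
    refine ⟨Pts.map f z, ?_⟩
    rw [← hz]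
    apply WithConv.ext
    ext a
    simp

theorem quotientAct_quotientMap (f : R →ₐ[K] R') (g : G)
    (q : Pts K A (B ⊗[K] R) ⧸ ratPts K A B R) :
    quotientAct α σ R' g (quotientMap A B f q) = quotientMap A B f (quotientAct α σ R g q) := by
  induction q using Quotient.inductionOn' with
  | h x =>
    change Quotient.mk'' _ = Quotient.mk'' _
    congr 1
    refine (map_ptsAct α _ (fun s ↦ ?_) x).symm
    induction s with
    | zero => simp
    | tmul c d => simp [tensorAct]
    | add c d hc hd => simp only [map_add, hc, hd]

/-- The map on `H⁰` induced by a homomorphism `R → R'`. -/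
def H0.map (f : R →ₐ[K] R') (q : H0 α σ R) : H0 α σ R' :=
  ⟨quotientMap A B f q.1, fun g ↦ by rw [quotientAct_quotientMap, q.2]⟩

open CategoryTheory

/-- The functor `R ↦ H⁰(G, (Spec A)(B ⊗ R) / (Spec A)(R))` on commutative `K`-algebras. -/
def H0Functor : CommAlgCat.{u} K ⥤ Type u where
  obj R := H0 α σ R
  map f := ↾(H0.map α σ f.hom)
  map_id R := by
    ext ⟨q, hq⟩
    apply Subtype.ext
    change quotientMap A B _ q = q
    induction q using Quotient.inductionOn' with
    | h x =>
      change Quotient.mk'' _ = Quotient.mk'' _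
      congr 1
      apply WithConv.ext
      ext a
      change Algebra.TensorProduct.map (AlgHom.id K B) (AlgHom.id K R) (x a) = x a
      rw [Algebra.TensorProduct.map_id]
      rfl
  map_comp {R R' R''} f f' := by
    ext ⟨q, hq⟩
    apply Subtype.ext
    change quotientMap A B _ q = quotientMap A B _ (quotientMap A B _ q)
    induction q using Quotient.inductionOn' with
    | h x =>
      change Quotient.mk'' _ = Quotient.mk'' _
      congr 1
      apply WithConv.ext
      ext a
      change Algebra.TensorProduct.map (AlgHom.id K B) (f'.hom.comp f.hom) (x a) =
        Algebra.TensorProduct.map (AlgHom.id K B) f'.hom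
          (Algebra.TensorProduct.map (AlgHom.id K B) f.hom (x a))
      rw [← AlgHom.comp_apply (Algebra.TensorProduct.map (AlgHom.id K B) f'.hom),
        ← Algebra.TensorProduct.map_comp]
      rfl

end H0

/-! ### Abelian continuous cohomology -/

section AbelianCohomology

variable {G : Type*} [Group G] [TopologicalSpace G] {F : Type*} [Field F]
  {M : Type*} [AddCommGroup M] [Module F M] (ρ : Representation F G M)

/-- The differential of inhomogeneous cochains. -/
def cochainD (j : ℕ) : ((Fin j → G) → M) →ₗ[F] ((Fin (j + 1) → G) → M) where
  toFun f g := ρ (g 0) (f fun i ↦ g i.succ) +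
    ∑ i : Fin (j + 1), (-1 : F) ^ ((i : ℕ) + 1) • f (Fin.contractNth i (· * ·) g)
  map_add' f f' := by
    ext g
    simp [Finset.sum_add_distrib, add_add_add_comm]
  map_smul' r f := by
    ext g
    simp [Finset.smul_sum, smul_smul, mul_comm r]

variable (F M) in
/-- Continuous cochains. -/
def contCochains (G : Type*) [TopologicalSpace G] [TopologicalSpace M] [IsTopologicalAddGroup M]
    [ContinuousConstSMul F M] (j : ℕ) : Submodule F ((Fin j → G) → M) where
  carrier := {f | Continuous f}
  add_mem' hf hg := hf.add hg
  zero_mem' := continuous_const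
  smul_mem' c _ hf := hf.const_smul c

variable [TopologicalSpace M] [IsTopologicalAddGroup M] [ContinuousConstSMul F M]

/-- Continuous cocycles. -/
def contCocycles (j : ℕ) : Submodule F ((Fin j → G) → M) :=
  contCochains F M G j ⊓ LinearMap.ker (cochainD ρ j)

/-- Coboundaries of continuous cochains. -/
def contCoboundaries : (j : ℕ) → Submodule F ((Fin j → G) → M)
  | 0 => ⊥
  | j + 1 => (contCochains F M G j).map (cochainD ρ j)

/-- The continuous cohomology `Hʲ(G, M)`, as an `F`-vector space. -/
abbrev ContH (j : ℕ) : Type _ :=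
  contCocycles ρ j ⧸ (contCoboundaries ρ j).comap (contCocycles ρ j).subtype

end AbelianCohomology

/-! ### The graded pieces of the descending central series -/

section Graded

variable {G : Type*} [Group G] {K : Type u} [Field K] (A : Type u) [CommRing A] [HopfAlgebra K A]
  (α : HopfAction G K A) (B : Type*) [Field B] [Algebra K B] (σ : G →* (B ≃ₐ[K] B))

/-- The `B`-points of the vector group `V = U^{i+1} / U^{i+2}`, which is the kernel of
`U_{i+1} → U_i`, as a vector space over `B`.
A vector group in characteristic zero is identified with its Lie algebra by the exponential map,
so `V(B) = Lie(V) ⊗ B` is the space of `B`-valued derivations at the identity of the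
coordinate ring of `U_{i+1}` that vanish on the coordinate ring of `U_i`. -/
def gradedPts (i : ℕ) : Submodule B (lcsQuot K A (i + 1) →ₗ[K] B) where
  carrier := {D | (∀ a b, D (a * b) = algebraMap K B (Coalgebra.counit (R := K) a) * D b +
      algebraMap K B (Coalgebra.counit (R := K) b) * D a) ∧
    ∀ a : lcsQuot K A (i + 1), (a : A) ∈ lcsQuot K A i → D a = 0}
  add_mem' {D D'} h h' := ⟨fun a b ↦ by
      simp only [LinearMap.add_apply, h.1 a b, h'.1 a b]; ring,
    fun a ha ↦ by rw [LinearMap.add_apply, h.2 a ha, h'.2 a ha, add_zero]⟩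
  zero_mem' := ⟨fun a b ↦ by simp, fun a _ ↦ rfl⟩
  smul_mem' c D h := ⟨fun a b ↦ by
      simp only [LinearMap.smul_apply, h.1 a b, smul_eq_mul]; ring,
    fun a ha ↦ by rw [LinearMap.smul_apply, h.2 a ha, smul_zero]⟩

variable {A B}

/-- The topology of pointwise convergence, which is the unique Hausdorff vector space topology
coming from a basis if the space is finite-dimensional. -/
instance [TopologicalSpace B] (i : ℕ) : TopologicalSpace (gradedPts (K := K) A B i) :=
  .induced (fun D a ↦ D.1 a) (Pi.topologicalSpace (t₂ := fun _ : lcsQuot K A (i + 1) ↦ inferInstance))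

/-- Evaluation of elements of `gradedPts`. -/
def gradedEval (i : ℕ) : gradedPts (K := K) A B i →+ (lcsQuot K A (i + 1) → B) where
  toFun D a := D.1 a
  map_zero' := rfl
  map_add' _ _ := rfl

instance [TopologicalSpace B] [IsTopologicalAddGroup B] (i : ℕ) :
    IsTopologicalAddGroup (gradedPts (K := K) A B i) :=
  topologicalAddGroup_induced (gradedEval (A := A) (B := B) i)

instance [TopologicalSpace B] [IsTopologicalRing B] (F : IntermediateField K B) (i : ℕ) :
    ContinuousConstSMul F (gradedPts (K := K) A B i) :=
  Topology.IsInducing.continuousConstSMul (g := gradedEval (A := A) (B := B) i)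
    (α := lcsQuot K A (i + 1) → B) ⟨rfl⟩ (fun c : F ↦ (c : B)) rfl

/-- The action of `G` on `V(B)` for `V = U^{i+1} / U^{i+2}`, linear over the fixed field of `G`:
the element `g` takes `D` to `g ∘ D ∘ g⁻¹`. -/
def gradedRep (i : ℕ) : Representation (IntermediateField.fixedField σ.range) G
    (gradedPts (K := K) A B i) where
  toFun g :=
    { toFun := fun D ↦ ⟨(σ g).toLinearMap ∘ₗ D.1 ∘ₗ ((α.quot (i + 1)).toHom g⁻¹).toLinearMap,
        fun a b ↦ by
          simp only [LinearMap.comp_apply, AlgEquiv.toLinearMap_apply, map_mul, D.2.1, map_add,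
            (α.quot (i + 1)).counit_apply, AlgEquiv.commutes],
        fun a ha ↦ by
          simp only [LinearMap.comp_apply, AlgEquiv.toLinearMap_apply]
          rw [D.2.2 _ (α.lcsQuot_stable i g⁻¹ _ ha), map_zero]⟩
      map_add' := fun D D' ↦ by
        ext a
        simp
      map_smul' := fun c D ↦ by
        ext a
        have hc : σ g (c : B) = c :=
          (IntermediateField.mem_fixedField_iff _ _).mp c.2 _ ⟨g, rfl⟩
        change σ g ((c : B) * _) = (c : B) * _
        rw [map_mul, hc]
        rfl }
  map_one' := by
    ext D a
    change σ 1 (D.1 ((α.quot (i + 1)).toHom 1⁻¹ a)) = D.1 a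
    simp
  map_mul' g h := by
    ext D a
    change σ (g * h) (D.1 ((α.quot (i + 1)).toHom (g * h)⁻¹ a)) =
      σ g (σ h (D.1 ((α.quot (i + 1)).toHom h⁻¹ ((α.quot (i + 1)).toHom g⁻¹ a))))
    simp [mul_inv_rev]

/-- The continuous cohomology `Hʲ(G, (U^{i+1} / U^{i+2})(B))`, a vector space over the fixed
field of `G` in `B`. -/
abbrev GradedH [TopologicalSpace G] [TopologicalSpace B] [IsTopologicalRing B] (i j : ℕ) : Type _ :=
  ContH (F := IntermediateField.fixedField σ.range) (M := gradedPts (K := K) A B i)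
    (gradedRep α σ i) j

/-- The groups `Hʲ(G, (U^i / U^{i+1})(B))`, for `i ≥ 1` and `j ≥ 0`, are finite-dimensional vector
spaces over the fixed field of `G` in `B`. -/
def FiniteGradedCohomology [TopologicalSpace G] [TopologicalSpace B] [IsTopologicalRing B] : Prop :=
  ∀ i j, Module.Finite (IntermediateField.fixedField σ.range) (GradedH α σ i j)

end Graded

end UnipotentCohomology

end

open UnipotentCohomology

open scoped TensorProduct Topology
open WithConv Coalgebra

noncomputable section

/-! Write V for the graded piece U^{n+1}/U^{n+2}. The extension of U_n by V given by U_{n+1} is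
central, U_0 is trivial, and all three assertions are proved by induction along these extensions.
Two facts turn each step into linear algebra.

The first is the exponential correspondence in characteristic zero, over an arbitrary coefficient
algebra. Coconnectedness makes x^m a polynomial in m (`exists_powPt`); its linear coefficient is log
x, a derivation at the identity. The curve x^X solves F' = F * log x (`isFlow_powPt`), so x is
determined by log x (`logPt_injective`), and every derivation has an exponential. Consequently
U_{n+1}(S) → U_n(S) is surjective for every S (`Pts.res_surjective`), and its kernel consists of
exponentials of linear forms on a finite-dimensional cotangent space. These are central
(`commute_of_res_eq_one`), so they multiply by adding forms.

The second is compactness of G: a continuous map from G to a space with the inductive limit topology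
spans a finite-dimensional subspace (`isContComb_of_continuous`). A family of points indexed by G is
thus a single point with coefficients in C(G,K) ⊗ R or (G → B) ⊗ R, and lifting and logarithms apply
to the whole family at once.

For (a) and (c), lift the universal object for U_n to U_{n+1}. The failure of the lift to be
invariant, or to be a cocycle, is a form o. Multiplying the lift by exp l changes the failure by a
linear expression d₁ l, and l counts only modulo the image of a map d₀. As K is a field, tensoring
with R is exact; so d₁ l = o is solvable on a closed subscheme (`exists_obstruction_ideal`), and
solutions modulo im d₀ form a torsor under (ker d₁ / im d₀) ⊗ R. If that cohomology is
finite-dimensional, the new functor is represented by an affine space over the closed subscheme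
(`exists_torsor`). In (a) it is H⁰(G, V(B)/V(K)), controlled by H⁰(G, V(B)) and H¹(G, V(K)); in (c)
it is H¹(G, V(K)), and the vanishing of H⁰ removes the automorphisms of a cocycle that would
otherwise identify further solutions. In (b) only closedness of the solvable locus is needed,
applied to a cocycle representing the universal class. -/

namespace UnipotentCohomology

/-! ### Jointly injective families; polynomials tested at natural numbers. -/

section Lifting

variable {K : Type*} [Field K]

/-- Algebra homomorphisms into the factors of a jointly injective family lift as soon as every
element lifts. -/
theorem exists_algHom_lift {H T ι : Type*} {S : ι → Type*} [CommRing H] [Algebra K H]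
    [CommRing T] [Algebra K T] [∀ i, CommRing (S i)] [∀ i, Algebra K (S i)]
    (ev : ∀ i, T →ₐ[K] S i) (hev : ∀ t, (∀ i, ev i t = 0) → t = 0)
    (φ : ∀ i, H →ₐ[K] S i) (h : ∀ a, ∃ t, ∀ i, ev i t = φ i a) :
    ∃ Φ : H →ₐ[K] T, ∀ i a, ev i (Φ a) = φ i a := by
  choose f hf using h
  have uniq : ∀ t t', (∀ i, ev i t = ev i t') → t = t' := fun t t' h ↦
    sub_eq_zero.mp (hev _ fun i ↦ by rw [map_sub, h, sub_self])
  exact ⟨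
    { toFun := f
      map_one' := uniq _ _ fun i ↦ by simp [hf]
      map_mul' := fun a b ↦ uniq _ _ fun i ↦ by simp [hf]
      map_zero' := uniq _ _ fun i ↦ by simp [hf]
      map_add' := fun a b ↦ uniq _ _ fun i ↦ by simp [hf]
      commutes' := fun r ↦ uniq _ _ fun i ↦ by simp [hf] }, fun i a ↦ hf a i⟩

theorem pts_eq_of_map_eq {H T ι : Type*} {S : ι → Type*} [CommRing H] [HopfAlgebra K H]
    [CommRing T] [Algebra K T] [∀ i, CommRing (S i)] [∀ i, Algebra K (S i)]
    (ev : ∀ i, T →ₐ[K] S i) (hev : ∀ t, (∀ i, ev i t = 0) → t = 0)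
    {x y : Pts K H T} (h : ∀ i, Pts.map (ev i) x = Pts.map (ev i) y) : x = y := by
  apply WithConv.ext
  ext a
  refine sub_eq_zero.mp (hev _ fun i ↦ ?_)
  have := congr($(h i) a)
  rw [Pts.map_apply, Pts.map_apply] at this
  rw [map_sub]
  exact sub_eq_zero.mpr this

open Polynomial

variable {S : Type*} [CommRing S] [Algebra K S]

variable (K) in
/-- Evaluation of polynomials at a natural number. -/
def evalNat (m : ℕ) : S[X] →ₐ[K] S := (Polynomial.aeval (R := S) (m : S)).restrictScalars K

@[simp] theorem evalNat_apply (m : ℕ) (p : S[X]) : evalNat K m p = p.eval (m : S) := by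
  simp [evalNat, Polynomial.aeval_def, Polynomial.eval₂_eq_eval_map]

/-- Applying a `K`-linear functional on `S` to the coefficients gives a polynomial over the field
`K` with infinitely many roots, hence zero; functionals separate the elements of `S`. This avoids
any assumption that `S` is a domain. -/
theorem eq_zero_of_evalNat [CharZero K] (p : S[X]) (h : ∀ m, evalNat K m p = 0) : p = 0 := by
  have key : ∀ l : Module.Dual K S, ∀ n, l (p.coeff n) = 0 := by
    intro l
    let q : K[X] := ∑ i ∈ Finset.range (p.natDegree + 1), Polynomial.monomial i (l (p.coeff i))
    have hq : q = 0 := by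
      apply Polynomial.eq_zero_of_infinite_isRoot
      refine (Set.infinite_range_of_injective (Nat.cast_injective (R := K))).mono ?_
      rintro _ ⟨m, rfl⟩
      have := congrArg l (h m)
      rw [evalNat_apply, Polynomial.eval_eq_sum_range, map_sum, map_zero] at this
      change q.eval _ = 0
      rw [← this, Polynomial.eval_finsetSum]
      refine Finset.sum_congr rfl fun i _ ↦ ?_
      rw [Polynomial.eval_monomial]
      have e : p.coeff i * (m : S) ^ i = ((m : K) ^ i) • p.coeff i := by
        rw [Algebra.smul_def, map_pow, map_natCast, mul_comm]
      rw [e, map_smul, smul_eq_mul, mul_comm]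
    intro n
    by_cases hn : n < p.natDegree + 1
    · have := congrArg (fun r ↦ r.coeff n) hq
      simp only [q, Polynomial.finsetSum_coeff, Polynomial.coeff_monomial, Polynomial.coeff_zero] at this
      rw [Finset.sum_ite_eq' (Finset.range (p.natDegree + 1)) n] at this
      rwa [if_pos (Finset.mem_range.mpr hn)] at this
    · rw [Polynomial.coeff_eq_zero_of_natDegree_lt (by omega), map_zero]
  ext n
  rw [Polynomial.coeff_zero]
  exact (Module.forall_dual_apply_eq_zero_iff K _).mp fun l ↦ key l n

end Lifting

/-! ### Convolution powers and conilpotence. -/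

section Convolution

variable {K : Type*} [Field K] {H : Type*} [CommRing H] [HopfAlgebra K H]

theorem convPow_comp {S S' : Type*} [Ring S] [Algebra K S] [Ring S'] [Algebra K S']
    (h : S →ₐ[K] S') (f : H →ₗ[K] S) (k : ℕ) (a : H) :
    (toConv (h.toLinearMap ∘ₗ f) ^ k) a = h ((toConv f ^ k) a) := by
  induction k generalizing a with
  | zero => simp
  | succ k ih =>
    have e : (toConv (h.toLinearMap ∘ₗ f) ^ k) = toConv (h.toLinearMap ∘ₗ (toConv f ^ k).ofConv) := by
      apply WithConv.ext
      ext a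
      exact ih a
    rw [pow_succ, pow_succ, e]
    exact congr($(LinearMap.algHom_comp_convMul_distrib h (toConv f ^ k) (toConv f)) a).symm

variable (K H) in
/-- The projection to the augmentation ideal, as a map to the tensor algebra. -/
def augTensor : H →ₗ[K] TensorAlgebra K H :=
  TensorAlgebra.ι K ∘ₗ (LinearMap.id - Algebra.linearMap K H ∘ₗ Coalgebra.counit)

variable (K H) in
/-- A Hopf algebra is conilpotent if iterated reduced coproducts vanish on each element. -/
def IsConilpotent : Prop := ∀ a : H, ∃ r, ∀ k ≥ r, (toConv (augTensor K H) ^ k) a = 0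

/-- The tensor algebra is universal: a functional killing 1 factors as an algebra homomorphism after
`augTensor`, so the exponent found for `augTensor` works for all such functionals at once. -/
theorem IsConilpotent.pow_apply (hH : IsConilpotent K H) {S : Type*} [Ring S] [Algebra K S]
    (f : H →ₗ[K] S) (hf : f 1 = 0) (a : H) : ∃ r, ∀ k ≥ r, (toConv f ^ k) a = 0 := by
  obtain ⟨r, hr⟩ := hH a
  refine ⟨r, fun k hk ↦ ?_⟩
  have e : f = (TensorAlgebra.lift K f).toLinearMap ∘ₗ augTensor K H := by
    ext b
    simp [augTensor, Algebra.algebraMap_eq_smul_one, hf]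
  rw [e, convPow_comp, hr k hk, map_zero]

theorem toConv_mul_apply_eq_zero {S : Type*} [Ring S] [Algebra K S] (f g : WithConv (H →ₗ[K] S))
    (t : H ⊗[K] H) (C : ℕ → Submodule K H) (r : ℕ)
    (ht : t ∈ ⨆ p ∈ Finset.HasAntidiagonal.antidiagonal r,
      (TensorProduct.map (C p.1).subtype (C p.2).subtype).range)
    (h : ∀ p ∈ Finset.HasAntidiagonal.antidiagonal r, ∀ b ∈ C p.1, ∀ c ∈ C p.2, f b * g c = 0) :
    LinearMap.mul' K S (TensorProduct.map f.ofConv g.ofConv t) = 0 := by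
  suffices H : (⨆ p ∈ Finset.HasAntidiagonal.antidiagonal r,
      (TensorProduct.map (C p.1).subtype (C p.2).subtype).range) ≤
      LinearMap.ker (LinearMap.mul' K S ∘ₗ TensorProduct.map f.ofConv g.ofConv) from H ht
  refine iSup₂_le fun p hp ↦ ?_
  rintro _ ⟨z, rfl⟩
  induction z with
  | zero => simp
  | tmul b c => exact h p hp b b.2 c c.2
  | add b c hb hc => rw [map_add]; exact Submodule.add_mem _ hb hc

/-- On `C r` every power with exponent above `r` vanishes. Split off one factor: its argument either
lies in `C 0`, the scalars, and is killed by `f`, or the other argument has smaller filtration index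
and induction applies. -/
theorem IsUnipotent.pow_apply (hH : IsUnipotent K H) {S : Type*} [Ring S] [Algebra K S]
    (f : H →ₗ[K] S) (hf : f 1 = 0) (a : H) : ∃ r, ∀ k ≥ r, (toConv f ^ k) a = 0 := by
  obtain ⟨C, hmono, h0, hex, hcomul⟩ := hH
  have key : ∀ k r, r < k → ∀ b ∈ C r, (toConv f ^ k) b = 0 := by
    intro k
    induction k with
    | zero => intro r hr; omega
    | succ k ih =>
      intro r hr b hb
      rw [pow_succ']
      refine toConv_mul_apply_eq_zero _ _ _ C r (hcomul r b hb) fun p hp c hc d hd ↦ ?_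
      rw [Finset.HasAntidiagonal.mem_antidiagonal] at hp
      rcases Nat.eq_zero_or_pos p.1 with h1 | h1
      · rw [h1, h0, Submodule.mem_span_singleton] at hc
        obtain ⟨s, rfl⟩ := hc
        change f (s • 1) * _ = 0
        rw [map_smul, hf, smul_zero, zero_mul]
      · rw [ih p.2 (by omega) d hd, mul_zero]
  obtain ⟨r, hr⟩ := hex a
  exact ⟨r + 1, fun k hk ↦ key k r (by omega) a hr⟩

theorem IsUnipotent.isConilpotent (hH : IsUnipotent K H) : IsConilpotent K H :=
  fun a ↦ hH.pow_apply _ (by simp [augTensor]) a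

/-- Precomposition with a coalgebra map commutes with convolution powers. -/
theorem convPow_comp_bialgHom {H' : Type*} [CommRing H'] [HopfAlgebra K H'] {S : Type*} [Ring S]
    [Algebra K S] (φ : H' →ₐc[K] H) (f : H →ₗ[K] S) (k : ℕ) (a : H') :
    (toConv (f ∘ₗ (φ : H' →ₐ[K] H).toLinearMap) ^ k) a = (toConv f ^ k) (φ a) := by
  induction k generalizing a with
  | zero => simp
  | succ k ih =>
    have e : (toConv (f ∘ₗ (φ : H' →ₐ[K] H).toLinearMap) ^ k) =
        toConv ((toConv f ^ k).ofConv ∘ₗ (φ : H' →ₐ[K] H).toLinearMap) := by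
      apply WithConv.ext
      ext a
      exact ih a
    rw [pow_succ, pow_succ, e]
    exact congr($(LinearMap.convMul_comp_coalgHom_distrib (toConv f ^ k) (toConv f)
      (φ : H' →ₗc[K] H)) a).symm

/-- A linear retraction of `φ` extends the functional `augTensor` from `H'` to `H`, where its powers
are known to vanish. Conilpotence thus passes to the coordinate rings of quotient groups without
restricting the filtration. -/
theorem IsConilpotent.of_injective (hH : IsConilpotent K H) {H' : Type*} [CommRing H']
    [HopfAlgebra K H'] (φ : H' →ₐc[K] H) (hφ : Function.Injective φ) : IsConilpotent K H' := by
  intro a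
  obtain ⟨ρ, hρ⟩ := LinearMap.exists_leftInverse_of_injective (φ : H' →ₐ[K] H).toLinearMap
    (LinearMap.ker_eq_bot.mpr hφ)
  have hρ' : ∀ b, ρ (φ b) = b := fun b ↦ congr($hρ b)
  obtain ⟨r, hr⟩ := hH.pow_apply (augTensor K H' ∘ₗ ρ) (by
    have := hρ' 1
    rw [map_one] at this
    simp [this, augTensor]) (φ a)
  refine ⟨r, fun k hk ↦ ?_⟩
  have e : augTensor K H' = (augTensor K H' ∘ₗ ρ) ∘ₗ (φ : H' →ₐ[K] H).toLinearMap := by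
    rw [LinearMap.comp_assoc, hρ, LinearMap.comp_id]
  rw [e, convPow_comp_bialgHom, hr k hk]

end Convolution

/-! ### One-parameter subgroups and the logarithm. -/

section Powers

open Polynomial

variable {K : Type*} [Field K] {H : Type*} [CommRing H] [HopfAlgebra K H]
  {S : Type*} [CommRing S] [Algebra K S] {S' : Type*} [CommRing S'] [Algebra K S']

/-- The linear map underlying a point, in the convolution ring. -/
def Pts.lin (x : Pts K H S) : WithConv (H →ₗ[K] S) := toConv x.ofConv.toLinearMap

@[simp] theorem Pts.lin_apply (x : Pts K H S) (a : H) : x.lin a = x a := rfl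

theorem Pts.lin_mul (x y : Pts K H S) : (x * y).lin = x.lin * y.lin := rfl

theorem Pts.lin_one : (1 : Pts K H S).lin = 1 := rfl

theorem Pts.lin_pow (x : Pts K H S) (m : ℕ) : (x ^ m).lin = x.lin ^ m := by
  induction m with
  | zero => rfl
  | succ m ih => rw [pow_succ, Pts.lin_mul, ih, pow_succ]

theorem Pts.one_apply (a : H) :
    (1 : Pts K H S) a = algebraMap K S (Coalgebra.counit (R := K) a) := rfl

theorem Pts.ext_apply {x y : Pts K H S} (h : ∀ a, x a = y a) : x = y := by
  apply WithConv.ext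
  ext a
  exact h a

theorem mul_eq_sum (x y : Pts K H S) (a : H) :
    (x * y) a = ∑ i ∈ (ℛ K a).index, x ((ℛ K a).left i) * y ((ℛ K a).right i) :=
  (ℛ K a).convMul_apply x.lin y.lin

theorem Pts.map_injective {f : S →ₐ[K] S'} (hf : Function.Injective f) :
    Function.Injective (Pts.map (A := H) f) := by
  intro x y h
  exact Pts.ext_apply fun a ↦ hf congr($h a)

variable [CharZero K]

/-- With x = 1 + f in the convolution algebra, the binomial formula reads x^m = ∑ binom(m,k) f^k, a
finite sum on each element because f kills 1. Only the existence of a polynomial for each element is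
checked by hand; multiplicativity is inherited from the points x^m, since evaluations at natural
numbers are jointly injective. -/
theorem exists_powPt (hH : IsConilpotent K H) (x : Pts K H S) :
    ∃ y : Pts K H S[X], ∀ m : ℕ, Pts.map (evalNat K m) y = x ^ m := by
  obtain ⟨Φ, hΦ⟩ := exists_algHom_lift (K := K) (H := H) (T := S[X]) (ι := ℕ) (S := fun _ ↦ S)
    (evalNat K) eq_zero_of_evalNat (fun m ↦ (x ^ m).ofConv) fun a ↦ by
      let f : WithConv (H →ₗ[K] S) := x.lin - 1
      have hf : f.ofConv 1 = 0 := by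
        change x.ofConv 1 - algebraMap K S (Coalgebra.counit (R := K) (1 : H)) = 0
        simp
      obtain ⟨r, hr⟩ := hH.pow_apply f.ofConv hf a
      -- Newton's series for (1 + f)^X: the falling factorial divided by k! is the binomial
      -- coefficient as a polynomial.
      refine ⟨∑ k ∈ Finset.range r, C ((f ^ k) a) *
        (C ((k.factorial : K)⁻¹) * descPochhammer K k).map (algebraMap K S), fun m ↦ ?_⟩
      have e1 : (x ^ m) a = ∑ k ∈ Finset.range (m + 1), (m.choose k) • (f ^ k) a := by
        rw [← Pts.lin_apply, Pts.lin_pow, show x.lin = f + 1 by simp [f],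
          (Commute.one_right f).add_pow]
        simp only [one_pow, mul_one]
        change (∑ k ∈ Finset.range (m + 1), f ^ k * ((m.choose k : ℕ) : WithConv (H →ₗ[K] S))).ofConv a = _
        rw [WithConv.ofConv_sum, LinearMap.sum_apply]
        refine Finset.sum_congr rfl fun k _ ↦ ?_
        rw [← nsmul_eq_mul']
        rfl
      have e2 : ∀ k, ((C ((k.factorial : K)⁻¹) * descPochhammer K k).map (algebraMap K S)).eval
          (m : S) = (m.choose k : S) := by
        intro k
        rw [← map_natCast (algebraMap K S) m, Polynomial.eval_map_apply, Polynomial.eval_mul,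
          Polynomial.eval_C, descPochhammer_eval_eq_descFactorial,
          Nat.descFactorial_eq_factorial_mul_choose, Nat.cast_mul,
          inv_mul_cancel_left₀ (Nat.cast_ne_zero.mpr k.factorial_ne_zero), map_natCast]
      change _ = (x ^ m) a
      rw [e1, evalNat_apply, Polynomial.eval_finsetSum]
      simp only [Polynomial.eval_mul, Polynomial.eval_C, e2]
      have e3 : ∀ k, (f ^ k) a * (m.choose k : S) = m.choose k • (f ^ k) a := fun k ↦ by
        rw [nsmul_eq_mul, mul_comm]
      simp only [e3]
      -- Extend both sums to a common range: the added terms vanish because f^k kills a for k ≥ r,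
      -- respectively because binom(m,k) = 0 for k > m.
      rw [Finset.sum_subset (Finset.range_subset_range.mpr (le_max_left r (m + 1))),
        Finset.sum_subset (Finset.range_subset_range.mpr (le_max_right r (m + 1)))]
      · intro k _ hk
        rw [Nat.choose_eq_zero_of_lt (by simpa using hk), zero_smul]
      · intro k _ hk
        have : (f ^ k) a = 0 := hr k (by simpa using hk)
        rw [this, smul_zero]
  exact ⟨toConv Φ, fun m ↦ Pts.ext_apply fun a ↦ hΦ m a⟩

/-- The one-parameter subgroup through a point of a unipotent group. -/
def powPt (hH : IsConilpotent K H) (x : Pts K H S) : Pts K H S[X] := (exists_powPt hH x).choose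

variable (hH : IsConilpotent K H)

theorem map_evalNat_powPt (x : Pts K H S) (m : ℕ) :
    Pts.map (evalNat K m) (powPt hH x) = x ^ m := (exists_powPt hH x).choose_spec m

theorem eq_of_map_evalNat {y y' : Pts K H S[X]}
    (h : ∀ m, Pts.map (evalNat K m) y = Pts.map (evalNat K m) y') : y = y' :=
  pts_eq_of_map_eq (ι := ℕ) (S := fun _ ↦ S) (evalNat K) eq_zero_of_evalNat h

theorem eq_powPt {x : Pts K H S} {y : Pts K H S[X]}
    (h : ∀ m, Pts.map (evalNat K m) y = x ^ m) : y = powPt hH x :=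
  eq_of_map_evalNat fun m ↦ by rw [h, map_evalNat_powPt]

theorem powPt_map (f : S →ₐ[K] S') (x : Pts K H S) :
    powPt hH (Pts.map f x) = Pts.map (Polynomial.mapAlgHom f) (powPt hH x) := by
  refine (eq_powPt hH fun m ↦ ?_).symm
  rw [← map_pow, ← map_evalNat_powPt hH x m]
  refine Pts.ext_apply fun a ↦ ?_
  simp only [Pts.map_apply, evalNat_apply, Polynomial.coe_mapAlgHom]
  rw [← map_natCast (f : S →+* S') m, Polynomial.eval_map_apply]
  rfl

theorem powPt_mul {x y : Pts K H S} (h : Commute x y) :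
    powPt hH (x * y) = powPt hH x * powPt hH y := by
  refine (eq_powPt hH fun m ↦ ?_).symm
  rw [map_mul, map_evalNat_powPt, map_evalNat_powPt, h.mul_pow]

theorem powPt_coeff_zero (x : Pts K H S) (a : H) :
    (powPt hH x a).coeff 0 = algebraMap K S (Coalgebra.counit (R := K) a) := by
  have := congr($(map_evalNat_powPt hH x 0) a)
  rwa [Pts.map_apply, evalNat_apply, Nat.cast_zero, ← Polynomial.coeff_zero_eq_eval_zero,
    pow_zero] at this

/-- The logarithm of a point of a unipotent group. -/
def logPt (x : Pts K H S) : H →ₗ[K] S :=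
  (Polynomial.lcoeff S 1).restrictScalars K ∘ₗ (powPt hH x).lin.ofConv

theorem logPt_apply (x : Pts K H S) (a : H) : logPt hH x a = (powPt hH x a).coeff 1 := rfl

theorem logPt_map (f : S →ₐ[K] S') (x : Pts K H S) (a : H) :
    logPt hH (Pts.map f x) a = f (logPt hH x a) := by
  rw [logPt_apply, powPt_map, logPt_apply, Pts.map_apply, Polynomial.coe_mapAlgHom,
    Polynomial.coeff_map]
  rfl

/-- For commuting points x^X y^X = (xy)^X. Both curves have the counit, the unit of convolution, as
constant term, so the linear coefficient of their product is the sum of the linear coefficients. -/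
theorem logPt_mul {x y : Pts K H S} (h : Commute x y) (a : H) :
    logPt hH (x * y) a = logPt hH x a + logPt hH y a := by
  have h1 : ∀ b : H, (algebraMap K S (Coalgebra.counit (R := K) b)) =
    (1 : Pts K H S) b := fun _ ↦ rfl
  have key : ∀ f : WithConv (H →ₗ[K] S), (∑ i ∈ (ℛ K a).index,
      (1 : Pts K H S).lin ((ℛ K a).left i) * f ((ℛ K a).right i)) = f a ∧
      (∑ i ∈ (ℛ K a).index,
      f ((ℛ K a).left i) * (1 : Pts K H S).lin ((ℛ K a).right i)) = f a := by
    intro f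
    rw [← (ℛ K a).convMul_apply, ← (ℛ K a).convMul_apply, Pts.lin_one, one_mul, mul_one]
    exact ⟨rfl, rfl⟩
  rw [logPt_apply, powPt_mul hH h, mul_eq_sum, Polynomial.finsetSum_coeff]
  simp only [Polynomial.mul_coeff_one, powPt_coeff_zero, h1, Finset.sum_add_distrib]
  have k1 := (key (toConv (logPt hH y))).1
  have k2 := (key (toConv (logPt hH x))).2
  simp only [logPt_apply, Pts.lin_apply] at k1 k2 ⊢
  rw [k1, k2, add_comm]

theorem logPt_one (a : H) : logPt hH (1 : Pts K H S) a = 0 := by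
  have := logPt_mul hH (Commute.one_right (1 : Pts K H S)) a
  rw [one_mul] at this
  simpa using this

theorem logPt_pow (x : Pts K H S) (m : ℕ) (a : H) : logPt hH (x ^ m) a = m • logPt hH x a := by
  induction m with
  | zero => rw [pow_zero, logPt_one, zero_smul]
  | succ m ih => rw [pow_succ, logPt_mul hH (Commute.pow_self x m), ih, succ_nsmul]

/-- `D` is an `S`-valued derivation at the identity. -/
def IsDer (D : H →ₗ[K] S) : Prop := ∀ a b,
  D (a * b) = algebraMap K S (Coalgebra.counit (R := K) a) * D b +
    algebraMap K S (Coalgebra.counit (R := K) b) * D a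

omit [CharZero K] in
theorem IsDer.map_one {D : H →ₗ[K] S} (hD : IsDer D) : D 1 = 0 := by
  have := hD 1 1
  simpa using this

/-- The linear coefficient of a curve of algebra homomorphisms starting at the counit satisfies the
Leibniz rule. -/
theorem isDer_logPt (x : Pts K H S) : IsDer (logPt hH x) := by
  intro a b
  have : powPt hH x (a * b) = powPt hH x a * powPt hH x b := map_mul (powPt hH x).ofConv a b
  rw [logPt_apply, this, Polynomial.mul_coeff_one, powPt_coeff_zero, powPt_coeff_zero, logPt_apply,
    logPt_apply, mul_comm ((powPt hH x a).coeff 1)]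

variable {H' : Type*} [CommRing H'] [HopfAlgebra K H']

/-- Precomposition of points with a homomorphism of Hopf algebras. -/
def Pts.res (φ : H' →ₐc[K] H) : Pts K H S →* Pts K H' S where
  toFun x := toConv (x.ofConv.comp (φ : H' →ₐ[K] H))
  map_one' := Pts.ext_apply fun a ↦ by
    change algebraMap K S (Coalgebra.counit (R := K) (φ a)) = algebraMap K S _
    rw [CoalgHomClass.counit_comp_apply]
    rfl
  map_mul' x y := congrArg toConv (AlgHom.convMul_comp_bialgHom_distrib x y φ)

omit [CharZero K] in
@[simp] theorem Pts.res_apply (φ : H' →ₐc[K] H) (x : Pts K H S) (a : H') :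
    Pts.res φ x a = x (φ a) := rfl

omit [CharZero K] in
theorem Pts.res_map (φ : H' →ₐc[K] H) (f : S →ₐ[K] S') (x : Pts K H S) :
    Pts.res φ (Pts.map f x) = Pts.map f (Pts.res φ x) := rfl

theorem powPt_res (hH' : IsConilpotent K H') (φ : H' →ₐc[K] H) (x : Pts K H S) :
    powPt hH' (Pts.res φ x) = Pts.res φ (powPt hH x) := by
  refine (eq_powPt hH' fun m ↦ ?_).symm
  rw [← Pts.res_map, map_evalNat_powPt, map_pow]

theorem logPt_res (hH' : IsConilpotent K H') (φ : H' →ₐc[K] H) (x : Pts K H S) (a : H') :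
    logPt hH' (Pts.res φ x) a = logPt hH x (φ a) := by
  rw [logPt_apply, powPt_res hH, logPt_apply, Pts.res_apply]

end Powers

/-! ### The differential equation F' = F * D and the exponential. -/

section Exponential

open Polynomial

variable {K : Type*} [Field K] {H : Type*} [CommRing H] [HopfAlgebra K H]
  {S : Type*} [CommRing S] [Algebra K S] {S' : Type*} [CommRing S'] [Algebra K S']

/-- The coefficients of a polynomial-valued functional. -/
def coeffConv (k : ℕ) (F : WithConv (H →ₗ[K] S[X])) : WithConv (H →ₗ[K] S) :=
  toConv ((Polynomial.lcoeff S k).restrictScalars K ∘ₗ F.ofConv)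

theorem coeffConv_apply (k : ℕ) (F : WithConv (H →ₗ[K] S[X])) (a : H) :
    coeffConv k F a = (F a).coeff k := rfl

/-- A functional, regarded as a constant polynomial-valued functional. -/
def constConv (D : WithConv (H →ₗ[K] S)) : WithConv (H →ₗ[K] S[X]) :=
  toConv ((Polynomial.CAlgHom : S →ₐ[K] S[X]).toLinearMap ∘ₗ D.ofConv)

theorem constConv_apply (D : WithConv (H →ₗ[K] S)) (a : H) : constConv D a = C (D a) := rfl

theorem coeffConv_mul_constConv (k : ℕ) (F : WithConv (H →ₗ[K] S[X]))
    (D : WithConv (H →ₗ[K] S)) : coeffConv k (F * constConv D) = coeffConv k F * D := by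
  apply WithConv.ext
  ext a
  rw [(ℛ K a).convMul_apply, coeffConv_apply, (ℛ K a).convMul_apply, Polynomial.finsetSum_coeff]
  simp only [constConv_apply, Polynomial.coeff_mul_C, coeffConv_apply]

theorem coeffConv_constConv_mul (k : ℕ) (F : WithConv (H →ₗ[K] S[X]))
    (D : WithConv (H →ₗ[K] S)) : coeffConv k (constConv D * F) = D * coeffConv k F := by
  apply WithConv.ext
  ext a
  rw [(ℛ K a).convMul_apply, coeffConv_apply, (ℛ K a).convMul_apply, Polynomial.finsetSum_coeff]
  simp only [constConv_apply, Polynomial.coeff_C_mul, coeffConv_apply]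

/-- `F` solves the differential equation `F' = F * D`. -/
def IsFlow (F : WithConv (H →ₗ[K] S[X])) (D : WithConv (H →ₗ[K] S)) : Prop :=
  ∀ a, derivative (F a) = (F * constConv D) a

/-- Comparing coefficients in F' = F * D gives (k + 1) F_{k+1} = F_k * D. In characteristic zero a
solution is therefore determined by its constant term. -/
theorem IsFlow.coeff {F : WithConv (H →ₗ[K] S[X])} {D : WithConv (H →ₗ[K] S)} (h : IsFlow F D)
    (k : ℕ) : (k.factorial : K) • coeffConv k F = coeffConv 0 F * D ^ k := by
  induction k with
  | zero => simp
  | succ k ih =>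
    rw [pow_succ, ← mul_assoc, ← ih, smul_mul_assoc, ← coeffConv_mul_constConv]
    apply WithConv.ext
    ext a
    have e : coeffConv k (F * constConv D) a = ((k + 1 : ℕ) : K) • coeffConv (k + 1) F a := by
      rw [coeffConv_apply, ← h a, Polynomial.coeff_derivative, coeffConv_apply, Algebra.smul_def,
        map_natCast, mul_comm, Nat.cast_succ]
    change ((k + 1).factorial : K) • coeffConv (k + 1) F a =
      (k.factorial : K) • coeffConv k (F * constConv D) a
    rw [e, smul_smul, Nat.factorial_succ, Nat.cast_mul, mul_comm]

variable [CharZero K]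

theorem IsFlow.eq {F F' : WithConv (H →ₗ[K] S[X])} {D : WithConv (H →ₗ[K] S)} (h : IsFlow F D)
    (h' : IsFlow F' D) (h0 : coeffConv 0 F = coeffConv 0 F') : F = F' := by
  apply WithConv.ext
  ext a k
  have := (h.coeff k).trans ((congrArg (· * D ^ k) h0).trans (h'.coeff k).symm)
  have := smul_right_injective _ (Nat.cast_ne_zero (R := K).mpr k.factorial_ne_zero) this
  exact congr($this a)

variable (K S) in
/-- The shift `p(X) ↦ p(X + Y)`. -/
def shiftHom : S[X] →ₐ[K] S[X][X] :=
  ((Polynomial.taylorAlgHom (Polynomial.X : S[X])).restrictScalars K).comp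
    (Polynomial.mapAlgHom (Polynomial.CAlgHom : S →ₐ[K] S[X]))

omit [CharZero K] in
theorem shiftHom_apply (p : S[X]) :
    shiftHom K S p = taylor (Polynomial.X : S[X]) (p.map (C : S →+* S[X])) := rfl

omit [CharZero K] in
theorem shiftHom_eval (p : S[X]) (r : S[X]) :
    (shiftHom K S p).eval r = p.comp (r + X) := by
  rw [shiftHom_apply, Polynomial.taylor_eval, Polynomial.eval_map, Polynomial.comp]

omit [CharZero K] in
theorem shiftHom_coeff_one (p : S[X]) : (shiftHom K S p).coeff 1 = derivative p := by
  rw [shiftHom_apply, Polynomial.taylor_coeff_one, Polynomial.derivative_map, Polynomial.eval_map,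
    Polynomial.eval₂_C_X]

/-- The identity x^{X+Y} = x^X x^Y holds at natural numbers, hence for polynomials in two variables;
the coefficient of Y to the first power is the differential equation. In `S[X][X]` the outer
variable plays the role of Y. -/
theorem isFlow_powPt (hH : IsConilpotent K H) (x : Pts K H S) :
    IsFlow (powPt hH x).lin (toConv (logPt hH x)) := by
  set y := powPt hH x with hy
  have key : Pts.map (shiftHom K S) y = Pts.map (Polynomial.CAlgHom : S[X] →ₐ[K] S[X][X]) y *
      Pts.map (Polynomial.mapAlgHom (Polynomial.CAlgHom : S →ₐ[K] S[X])) y := by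
    refine eq_of_map_evalNat fun m ↦ eq_of_map_evalNat fun m' ↦ ?_
    have e1 : Pts.map (evalNat K m') (Pts.map (evalNat K m) (Pts.map (shiftHom K S) y)) =
        Pts.map (evalNat K (m' + m)) y := by
      refine Pts.ext_apply fun a ↦ ?_
      simp only [Pts.map_apply, evalNat_apply, shiftHom_eval, Polynomial.eval_comp]
      simp [add_comm]
    have e2 : Pts.map (evalNat K m') (Pts.map (evalNat K m)
        (Pts.map (Polynomial.CAlgHom : S[X] →ₐ[K] S[X][X]) y)) = Pts.map (evalNat K m') y := by
      refine Pts.ext_apply fun a ↦ ?_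
      simp [Polynomial.CAlgHom]
    have e3 : Pts.map (evalNat K m') (Pts.map (evalNat K m)
        (Pts.map (Polynomial.mapAlgHom (Polynomial.CAlgHom : S →ₐ[K] S[X])) y)) =
        Pts.map (evalNat K m) y := by
      refine Pts.ext_apply fun a ↦ ?_
      simp only [Pts.map_apply, evalNat_apply, Polynomial.coe_mapAlgHom]
      rw [← map_natCast ((Polynomial.CAlgHom : S →ₐ[K] S[X]) : S →+* S[X]) m,
        Polynomial.eval_map_apply]
      simp [Polynomial.CAlgHom]
    rw [map_mul, map_mul, e1, e2, e3, hy]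
    simp only [map_evalNat_powPt, pow_add]
  intro a
  have h1 := congrArg (fun p ↦ Polynomial.coeff p 1) congr($key a)
  rw [Pts.map_apply, shiftHom_coeff_one, mul_eq_sum, Polynomial.finsetSum_coeff] at h1
  rw [Pts.lin_apply, h1, (ℛ K a).convMul_apply]
  refine Finset.sum_congr rfl fun i _ ↦ ?_
  change (C _ * Polynomial.map _ _).coeff 1 = _
  rw [Polynomial.coeff_C_mul, Polynomial.coeff_map]
  rfl

omit [CharZero K] in
theorem coeffConv_lin_powPt [CharZero K] (hH : IsConilpotent K H) (x : Pts K H S) :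
    coeffConv 0 (powPt hH x).lin = 1 := by
  apply WithConv.ext
  ext a
  exact powPt_coeff_zero hH x a

theorem powPt_coeff (hH : IsConilpotent K H) (x : Pts K H S) (k : ℕ) :
    (k.factorial : K) • coeffConv k (powPt hH x).lin = toConv (logPt hH x) ^ k := by
  rw [(isFlow_powPt hH x).coeff, coeffConv_lin_powPt, one_mul]

theorem eq_map_evalNat_one (hH : IsConilpotent K H) (x : Pts K H S) :
    x = Pts.map (evalNat K 1) (powPt hH x) := by
  rw [map_evalNat_powPt, pow_one]

/-- Both curves solve the same equation from the same constant term, so they agree, and x is the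
value of x^X at 1. -/
theorem logPt_injective (hH : IsConilpotent K H) {x y : Pts K H S}
    (h : ∀ a, logPt hH x a = logPt hH y a) : x = y := by
  have h' : logPt hH x = logPt hH y := LinearMap.ext h
  have e : (powPt hH x).lin = (powPt hH y).lin := by
    refine (isFlow_powPt hH x).eq (h' ▸ isFlow_powPt hH y) ?_
    rw [coeffConv_lin_powPt, coeffConv_lin_powPt]
  rw [eq_map_evalNat_one hH x, eq_map_evalNat_one hH y]
  refine Pts.ext_apply fun a ↦ ?_
  have := congr($e a)
  rw [Pts.lin_apply, Pts.lin_apply] at this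
  rw [Pts.map_apply, Pts.map_apply, this]

/-! ### The exponential of a derivation -/

omit [CharZero K] in
/-- The external product of functionals on `H`, as a functional on `H ⊗ H`. -/
def extProd (f g : WithConv (H →ₗ[K] S)) : WithConv (H ⊗[K] H →ₗ[K] S) :=
  toConv ((Algebra.TensorProduct.lmul' K : S ⊗[K] S →ₐ[K] S).toLinearMap ∘ₗ
    TensorProduct.map f.ofConv g.ofConv)

omit [CharZero K] in
theorem extProd_tmul (f g : WithConv (H →ₗ[K] S)) (a b : H) :
    extProd f g (a ⊗ₜ b) = f a * g b := by simp [extProd]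

omit [CharZero K] in
theorem extProd_mul (f g h k : WithConv (H →ₗ[K] S)) :
    extProd f g * extProd h k = extProd (f * h) (g * k) := by
  have e := TensorProduct.map_convMul_map (f := f) (g := g) (h := h) (k := k)
  have e2 := LinearMap.algHom_comp_convMul_distrib
    (Algebra.TensorProduct.lmul' K : S ⊗[K] S →ₐ[K] S)
    (toConv (TensorProduct.map f.ofConv g.ofConv)) (toConv (TensorProduct.map h.ofConv k.ofConv))
  rw [e] at e2
  exact (WithConv.ofConv_injective e2).symm

omit [CharZero K] in
theorem extProd_one : extProd (1 : WithConv (H →ₗ[K] S)) 1 = 1 := by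
  apply WithConv.ext
  ext a b
  change extProd (1 : WithConv (H →ₗ[K] S)) 1 (a ⊗ₜ b) = (1 : WithConv (H ⊗[K] H →ₗ[K] S)) (a ⊗ₜ b)
  rw [extProd_tmul]
  simp [mul_comm]

omit [CharZero K] in
theorem extProd_pow (f g : WithConv (H →ₗ[K] S)) (k : ℕ) :
    extProd f g ^ k = extProd (f ^ k) (g ^ k) := by
  induction k with
  | zero => simp [extProd_one]
  | succ k ih => rw [pow_succ, ih, extProd_mul, ← pow_succ, ← pow_succ]

omit [CharZero K] in
-- The Leibniz rule says that D composed with multiplication is D ⊗ 1 + 1 ⊗ D in the convolution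
-- algebra of H ⊗ H. The two summands commute, so the binomial theorem applies; multiplication is a
-- coalgebra map, so it may be pulled out of convolution powers.
theorem IsDer.pow_mul {D : H →ₗ[K] S} (hD : IsDer D) (k : ℕ) (a b : H) :
    (toConv D ^ k) (a * b) = ∑ m ∈ Finset.HasAntidiagonal.antidiagonal k,
      k.choose m.1 • ((toConv D ^ m.1) a * (toConv D ^ m.2) b) := by
  have e1 : toConv (D ∘ₗ ((Bialgebra.mulBialgHom K H : H ⊗[K] H →ₐc[K] H) :
      H ⊗[K] H →ₐ[K] H).toLinearMap) = extProd (toConv D) 1 + extProd 1 (toConv D) := by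
    apply WithConv.ext
    ext c d
    change D (c * d) = extProd (toConv D) 1 (c ⊗ₜ d) + extProd 1 (toConv D) (c ⊗ₜ d)
    rw [extProd_tmul, extProd_tmul, hD]
    simp [mul_comm, add_comm]
  have hc : Commute (extProd (toConv D) 1) (extProd 1 (toConv D)) := by
    change _ * _ = _ * _
    rw [extProd_mul, extProd_mul]
    simp
  have e2 := convPow_comp_bialgHom (Bialgebra.mulBialgHom K H) D k (a ⊗ₜ b)
  rw [e1, hc.add_pow'] at e2
  refine Eq.trans e2.symm ?_
  rw [WithConv.ofConv_sum, LinearMap.sum_apply]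
  refine Finset.sum_congr rfl fun m _ ↦ ?_
  rw [extProd_pow, extProd_pow, extProd_mul, one_pow, one_pow, one_mul, mul_one]
  exact congrArg (fun s : S ↦ k.choose m.1 • s) (extProd_tmul _ _ a b)

variable (hH : IsConilpotent K H)

include hH in
-- This is exp(XD): conilpotence makes the series polynomial on each element, and the higher Leibniz
-- formula makes it multiplicative.
theorem exists_flow {D : H →ₗ[K] S} (hD : IsDer D) : ∃ y : Pts K H S[X],
    ∀ k a, (y a).coeff k = (k.factorial : K)⁻¹ • (toConv D ^ k) a := by
  have hex : ∀ a, ∃ p : S[X], ∀ k, p.coeff k = (k.factorial : K)⁻¹ • (toConv D ^ k) a := by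
    intro a
    obtain ⟨r, hr⟩ := hH.pow_apply D hD.map_one a
    refine ⟨∑ k ∈ Finset.range r, Polynomial.monomial k ((k.factorial : K)⁻¹ • (toConv D ^ k) a),
      fun k ↦ ?_⟩
    rw [Polynomial.finsetSum_coeff]
    simp only [Polynomial.coeff_monomial]
    rw [Finset.sum_ite_eq' (Finset.range r) k]
    split_ifs with h
    · rfl
    · rw [hr k (by simpa using h), smul_zero]
  choose f hf using hex
  have h1 : ∀ k, (toConv D ^ (k + 1)) (1 : H) = 0 := fun k ↦ by
    rw [pow_succ', LinearMap.convMul_apply, Bialgebra.comul_one, Algebra.TensorProduct.one_def,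
      TensorProduct.map_tmul]
    simp [hD.map_one]
  refine ⟨toConv
    { toFun := f
      map_one' := ?_
      map_mul' := ?_
      map_zero' := ?_
      map_add' := ?_
      commutes' := ?_ }, fun k a ↦ hf a k⟩
  · ext k
    rw [hf]
    cases k with
    | zero => simp
    | succ k => rw [h1, smul_zero, Polynomial.coeff_one, if_neg (by omega)]
  · intro a b
    ext k
    rw [hf, Polynomial.coeff_mul, hD.pow_mul, Finset.smul_sum]
    refine Finset.sum_congr rfl fun m hm ↦ ?_
    rw [Finset.HasAntidiagonal.mem_antidiagonal] at hm
    -- With k = m.1 + m.2 it remains that binom(k, m.1) / k! = 1 / (m.1! m.2!).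
    rw [hf, hf, smul_mul_smul_comm, ← Nat.cast_smul_eq_nsmul K, smul_smul]
    congr 1
    rw [← hm, Nat.cast_choose K (Nat.le_add_right m.1 m.2), Nat.add_sub_cancel_left]
    have := fun n : ℕ ↦ (Nat.cast_ne_zero (R := K)).mpr n.factorial_ne_zero
    field_simp [this]
  · ext k
    rw [hf]
    simp
  · intro a b
    ext k
    rw [Polynomial.coeff_add, hf, hf, hf, map_add, smul_add]
  · intro r
    ext k
    rw [hf, Algebra.algebraMap_eq_smul_one, map_smul, Polynomial.algebraMap_apply,
      Polynomial.coeff_C]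
    cases k with
    | zero => simp [Algebra.algebraMap_eq_smul_one]
    | succ k => rw [h1, smul_zero, smul_zero, if_neg (by omega)]

/-- The exponential of an `S`-valued derivation. -/
def expPt {D : H →ₗ[K] S} (hD : IsDer D) : Pts K H S :=
  Pts.map (evalNat K 1) (exists_flow hH hD).choose

/-- It is enough that exp(mD) is the m-th power of exp(D). This follows by induction on m from the
translation property exp((X+1)D) = exp(D) exp(XD). -/
theorem powPt_expPt {D : H →ₗ[K] S} (hD : IsDer D) :
    powPt hH (expPt hH hD) = (exists_flow hH hD).choose := by
  set y := (exists_flow hH hD).choose with hy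
  have hyc : ∀ k a, (y a).coeff k = (k.factorial : K)⁻¹ • (toConv D ^ k) a :=
    (exists_flow hH hD).choose_spec
  have hc : ∀ k, coeffConv k y.lin = (k.factorial : K)⁻¹ • toConv D ^ k := fun k ↦ by
    apply WithConv.ext
    ext a
    exact hyc k a
  have hflow : IsFlow y.lin (toConv D) := by
    intro a
    ext k
    have e : (k.factorial : K)⁻¹ = ((k + 1).factorial : K)⁻¹ * ((k : K) + 1) := by
      rw [Nat.factorial_succ, Nat.cast_mul, Nat.cast_succ, mul_inv,
        mul_comm ((k : K) + 1)⁻¹, inv_mul_cancel_right₀ (Nat.cast_add_one_ne_zero k)]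
    have e1 : ((y.lin * constConv (toConv D)) a).coeff k =
        ((k.factorial : K)⁻¹ • toConv D ^ (k + 1)) a := by
      rw [← coeffConv_apply, coeffConv_mul_constConv, hc, smul_mul_assoc, ← pow_succ]
    rw [e1, Polynomial.coeff_derivative, Pts.lin_apply, hyc, e]
    change _ = (_ * _ : K) • (toConv D ^ (k + 1)) a
    rw [mul_smul, Algebra.smul_def ((k : K) + 1), map_add, map_natCast, map_one, mul_comm,
      mul_smul_comm]
  have hx : expPt hH hD = Pts.map (evalNat K 1) y := rfl
  -- The translate of y by 1 and the left multiple of y by the constant exp(D) both solve F' = F * D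
  -- with constant term exp(D), so they coincide.
  have hshift : ∀ m : ℕ, Pts.map (evalNat K (m + 1)) y =
      expPt hH hD * Pts.map (evalNat K m) y := by
    intro m
    let τ : S[X] →ₐ[K] S[X] := (Polynomial.taylorAlgHom (1 : S)).restrictScalars K
    have e1 : IsFlow (Pts.map τ y).lin (toConv D) := by
      intro a
      change derivative (taylor (1 : S) (y a)) = _
      have h2 := congrArg (taylor (1 : S)) (hflow a)
      rw [(ℛ K a).convMul_apply, map_sum] at h2
      rw [(ℛ K a).convMul_apply, Polynomial.taylor_apply, Polynomial.derivative_comp]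
      simp only [Polynomial.derivative_add, Polynomial.derivative_X, Polynomial.derivative_C,
        add_zero, one_mul, ← Polynomial.taylor_apply]
      refine h2.trans (Finset.sum_congr rfl fun i _ ↦ ?_)
      rw [Polynomial.taylor_mul, constConv_apply, Polynomial.taylor_C]
      rfl
    have e2 : IsFlow (constConv (expPt hH hD).lin * y.lin) (toConv D) := by
      intro a
      rw [mul_assoc]
      rw [(ℛ K a).convMul_apply, (ℛ K a).convMul_apply, Polynomial.derivative_sum]
      refine Finset.sum_congr rfl fun i _ ↦ ?_
      rw [constConv_apply, Polynomial.derivative_C_mul, hflow]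
    have e3 := e1.eq e2 (by
      rw [coeffConv_constConv_mul, hc]
      simp only [Nat.factorial_zero, Nat.cast_one, inv_one, pow_zero, one_smul, mul_one]
      apply WithConv.ext
      ext a
      change (taylor (1 : S) (y a)).coeff 0 = evalNat K 1 (y a)
      rw [Polynomial.taylor_coeff_zero, evalNat_apply, Nat.cast_one])
    refine Pts.ext_apply fun a ↦ ?_
    have e4 := congrArg (evalNat K m) congr($e3 a)
    rw [(ℛ K a).convMul_apply, map_sum] at e4
    rw [mul_eq_sum, Pts.map_apply, evalNat_apply]
    refine Eq.trans ?_ (e4.trans (Finset.sum_congr rfl fun i _ ↦ ?_))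
    · change _ = evalNat K m (taylor (1 : S) (y a))
      rw [evalNat_apply, Polynomial.taylor_eval, Nat.cast_succ]
    · rw [constConv_apply, map_mul, evalNat_apply, Polynomial.eval_C]
      rfl
  refine (eq_powPt hH fun m ↦ ?_).symm
  induction m with
  | zero =>
    rw [pow_zero]
    refine Pts.ext_apply fun a ↦ ?_
    rw [Pts.map_apply, evalNat_apply, Nat.cast_zero, ← Polynomial.coeff_zero_eq_eval_zero, hyc]
    simp
  | succ m ih => rw [hshift, ih, pow_succ']

theorem logPt_expPt {D : H →ₗ[K] S} (hD : IsDer D) (a : H) : logPt hH (expPt hH hD) a = D a := by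
  rw [logPt_apply, powPt_expPt, (exists_flow hH hD).choose_spec]
  simp

/-- A derivation factors through the logarithm of the identity. -/
theorem IsDer.apply_log_id {D : H →ₗ[K] S} (hD : IsDer D) (a : H) :
    D (logPt hH (toConv (AlgHom.id K H)) a) = D a := by
  set e := logPt hH (toConv (AlgHom.id K H))
  set x := expPt hH hD
  have h1 : ∀ y : Pts K H S[X], logPt hH y a = y (e a) := fun y ↦ by
    rw [← logPt_map]
    rfl
  -- At X = m the left side is log(x^m) applied to a, which is m log x = m D on a; comparing linear
  -- coefficients finishes the argument.
  have h2 : powPt hH x (e a) = X * C (D a) := by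
    refine sub_eq_zero.mp (eq_zero_of_evalNat (K := K) _ fun m ↦ ?_)
    rw [map_sub, ← h1, ← logPt_map, map_evalNat_powPt, logPt_pow, logPt_expPt]
    simp only [nsmul_eq_mul, evalNat_apply, Polynomial.eval_mul, Polynomial.eval_X,
      Polynomial.eval_C, sub_self]
  rw [← logPt_expPt hH hD (e a), logPt_apply, h2]
  simp

end Exponential

/-! ### Surjectivity of quotient maps on points. -/

section Extension

variable {K : Type*} [Field K] [CharZero K] {H : Type*} [CommRing H] [HopfAlgebra K H]
  {H' : Type*} [CommRing H'] [HopfAlgebra K H'] {S : Type*} [CommRing S] [Algebra K S]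

/-- Naturality of the logarithm, as y is the image of the universal point `AlgHom.id`. Thus log(id)
a is the function y ↦ (log y)(a) on the group. -/
theorem map_logPt_id (hH : IsConilpotent K H) (y : Pts K H S) (a : H) :
    y (logPt hH (toConv (AlgHom.id K H)) a) = logPt hH y a := by
  rw [← logPt_map]
  rfl

/-- A quotient map of unipotent groups is surjective on points. -/
theorem Pts.res_surjective (hH : IsConilpotent K H) (φ : H' →ₐc[K] H)
    (hφ : Function.Injective φ) : Function.Surjective (Pts.res (S := S) φ) := by
  intro x'
  have hH' := hH.of_injective φ hφ
  obtain ⟨ρ, hρ⟩ := LinearMap.exists_leftInverse_of_injective (φ : H' →ₐ[K] H).toLinearMap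
    (LinearMap.ker_eq_bot.mpr hφ)
  have hρ' : ∀ b, ρ (φ b) = b := fun b ↦ congr($hρ b)
  set e := logPt hH (toConv (AlgHom.id K H))
  -- The derivation log x' of H' is extended to H. The retraction ρ is only linear, but e is already
  -- a derivation with scalar coefficients from K, so any linear map after e is a derivation; and e
  -- maps the image of H' into itself, where ρ inverts φ.
  have hD : IsDer (logPt hH' x' ∘ₗ ρ ∘ₗ e) := by
    intro a b
    have := isDer_logPt hH (toConv (AlgHom.id K H)) a b
    simp only [LinearMap.comp_apply, e] at this ⊢
    rw [this, ← Algebra.smul_def, ← Algebra.smul_def, ← Algebra.smul_def, ← Algebra.smul_def]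
    simp only [map_add, map_smul]
  refine ⟨expPt hH hD, logPt_injective hH' fun a ↦ ?_⟩
  rw [logPt_res hH, logPt_expPt]
  have h1 : e (φ a) = φ (logPt hH' (toConv (AlgHom.id K H')) a) := by
    rw [← logPt_res hH hH' φ]
    exact logPt_map hH' (φ : H' →ₐ[K] H) (toConv (AlgHom.id K H')) a
  change logPt hH' x' (ρ (e (φ a))) = _
  rw [h1, hρ', (isDer_logPt hH' x').apply_log_id hH']

omit [CharZero K] in
open Polynomial in
theorem coeff_one_mul {y z : Pts K H S[X]} (hy : Pts.map (evalNat K 0) y = 1)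
    (hz : Pts.map (evalNat K 0) z = 1) (a : H) :
    ((y * z) a).coeff 1 = (y a).coeff 1 + (z a).coeff 1 := by
  have h0 : ∀ {y : Pts K H S[X]}, Pts.map (evalNat K 0) y = 1 →
      ∀ b, (y b).coeff 0 = (1 : Pts K H S) b := fun {y} hy b ↦ by
    rw [← hy, Pts.map_apply, evalNat_apply, Nat.cast_zero, Polynomial.coeff_zero_eq_eval_zero]
  have key : ∀ f : WithConv (H →ₗ[K] S), (∑ i ∈ (ℛ K a).index,
      (1 : Pts K H S).lin ((ℛ K a).left i) * f ((ℛ K a).right i)) = f a ∧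
      (∑ i ∈ (ℛ K a).index,
      f ((ℛ K a).left i) * (1 : Pts K H S).lin ((ℛ K a).right i)) = f a := by
    intro f
    rw [← (ℛ K a).convMul_apply, ← (ℛ K a).convMul_apply, Pts.lin_one, one_mul, mul_one]
    exact ⟨rfl, rfl⟩
  rw [mul_eq_sum, Polynomial.finsetSum_coeff]
  simp only [Polynomial.mul_coeff_one, h0 hy, h0 hz, Finset.sum_add_distrib]
  have k1 := (key (coeffConv 1 z.lin)).1
  have k2 := (key (coeffConv 1 y.lin)).2
  simp only [coeffConv_apply, Pts.lin_apply] at k1 k2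
  rw [k1, k2, add_comm]

end Extension

/-! ### Kernels and centrality in the descending central series. -/

section Normal

open Polynomial

variable {K : Type u} [Field K] {A : Type u} [CommRing A] [HopfAlgebra K A]

/-- The product of the two universal points of the subgroup over (A/I) ⊗ (A/I) again lies in the
subgroup. Hence the comultiplication sends I to zero in (A/I) ⊗ (A/I), through which functionals
vanishing on I factor. -/
theorem convMul_apply_eq_zero {I : Ideal A} (hI : IsNormalSubgroupIdeal K I) {S : Type*}
    [CommRing S] [Algebra K S] {f g : WithConv (A →ₗ[K] S)} (hf : ∀ a ∈ I, f a = 0)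
    (hg : ∀ a ∈ I, g a = 0) {a : A} (ha : a ∈ I) : (f * g) a = 0 := by
  set q : A →ₐ[K] A ⧸ I := Ideal.Quotient.mkₐ K I with hq
  obtain ⟨s, hs⟩ := LinearMap.exists_rightInverse_of_surjective q.toLinearMap
    (LinearMap.range_eq_top.mpr (Ideal.Quotient.mkₐ_surjective K I))
  have hs' : ∀ b, q (s b) = b := fun b ↦ congr($hs b)
  have key : ∀ {h : WithConv (A →ₗ[K] S)}, (∀ a ∈ I, h a = 0) →
      h.ofConv = (h.ofConv ∘ₗ s) ∘ₗ q.toLinearMap := by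
    intro h hh
    ext b
    have : b - s (q b) ∈ I := by
      rw [← Ideal.Quotient.eq_zero_iff_mem]
      change q (b - s (q b)) = 0
      rw [map_sub, hs', sub_self]
    have := hh _ this
    rw [map_sub] at this
    exact sub_eq_zero.mp this
  obtain ⟨N, -, hN⟩ := hI ((A ⧸ I) ⊗[K] (A ⧸ I))
  let x : Pts K A ((A ⧸ I) ⊗[K] (A ⧸ I)) := toConv (Algebra.TensorProduct.includeLeft.comp q)
  let y : Pts K A ((A ⧸ I) ⊗[K] (A ⧸ I)) := toConv (Algebra.TensorProduct.includeRight.comp q)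
  have hx : x ∈ N := by
    rw [← SetLike.mem_coe, hN]
    intro b hb
    change (q b) ⊗ₜ[K] (1 : A ⧸ I) = 0
    rw [hq, Ideal.Quotient.mkₐ_eq_mk, Ideal.Quotient.eq_zero_iff_mem.mpr hb,
      TensorProduct.zero_tmul]
  have hy : y ∈ N := by
    rw [← SetLike.mem_coe, hN]
    intro b hb
    change (1 : A ⧸ I) ⊗ₜ[K] (q b) = 0
    rw [hq, Ideal.Quotient.mkₐ_eq_mk, Ideal.Quotient.eq_zero_iff_mem.mpr hb,
      TensorProduct.tmul_zero]
  have hxy : (x * y) a = 0 := by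
    have := N.mul_mem hx hy
    rw [← SetLike.mem_coe, hN] at this
    exact this a ha
  rw [mul_apply] at hxy
  have e : ∀ z : A ⊗[K] A, Algebra.TensorProduct.lift x.ofConv y.ofConv (fun _ _ ↦ .all _ _) z =
      TensorProduct.map q.toLinearMap q.toLinearMap z := by
    intro z
    induction z with
    | zero => simp
    | tmul b c => simp [x, y]
    | add b c hb hc => rw [map_add, map_add, hb, hc]
  rw [e] at hxy
  rw [LinearMap.convMul_apply, key hf, key hg, TensorProduct.map_comp, LinearMap.comp_apply, hxy,
    map_zero, map_zero]

theorem counit_eq_zero_of_mem {I : Ideal A} (hI : IsNormalSubgroupIdeal K I) {a : A} (ha : a ∈ I) :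
    Coalgebra.counit (R := K) a = 0 := by
  obtain ⟨N, -, hN⟩ := hI K
  have h1 := N.one_mem
  rw [← SetLike.mem_coe, hN] at h1
  exact h1 a ha

variable [CharZero K]

/-- Modulo the normal subgroup x and xy agree, hence so do their powers, and the curve x^{-X} (xy)^X
stays in the subgroup. It vanishes on I, and its linear coefficient is log(xy) - log x. -/
theorem logPt_mul_of_mem_zeroLocus (hA : IsConilpotent K A) {I : Ideal A}
    (hI : IsNormalSubgroupIdeal K I) {S : Type u} [CommRing S] [Algebra K S] (x : Pts K A S)
    {y : Pts K A S} (hy : y ∈ zeroLocus K I S) {a : A} (ha : a ∈ I) :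
    logPt hA (x * y) a = logPt hA x a := by
  obtain ⟨N, hN, hN'⟩ := hI S
  set p := (powPt hA x)⁻¹ * powPt hA (x * y) with hp
  have h0 : ∀ z : Pts K A S, Pts.map (evalNat K 0) (powPt hA z) = 1 := fun z ↦ by
    rw [map_evalNat_powPt, pow_zero]
  have h0' : Pts.map (evalNat K 0) (powPt hA x)⁻¹ = 1 := by
    rw [map_inv, h0, inv_one]
  have h1 : p a = 0 := by
    refine eq_zero_of_evalNat (K := K) _ fun m ↦ ?_
    have h2 : Pts.map (evalNat K m) p ∈ N := by
      rw [hp, map_mul, map_inv, map_evalNat_powPt, map_evalNat_powPt, ← QuotientGroup.eq,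
        QuotientGroup.mk_pow, QuotientGroup.mk_pow, QuotientGroup.mk_mul]
      have : ((y : Pts K A S) : Pts K A S ⧸ N) = 1 := by
        rw [QuotientGroup.eq_one_iff, ← SetLike.mem_coe, hN']
        exact hy
      rw [this, mul_one]
    rw [← SetLike.mem_coe, hN'] at h2
    exact h2 a ha
  have h3 := coeff_one_mul h0' (h0 (x * y)) a
  rw [← hp, h1] at h3
  have h4 := coeff_one_mul h0' (h0 x) a
  rw [inv_mul_cancel, Pts.one_apply, counit_eq_zero_of_mem hI ha, map_zero] at h4
  rw [logPt_apply, logPt_apply]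
  exact add_left_cancel (h3.symm.trans h4)

/-- The function x ↦ (log x)(a) is invariant under translation by U^{n+1} when a lies in its ideal.
This supplies enough functions on the quotient to identify the kernel of U → U_n. -/
theorem logPt_id_mem_lcsQuot (hA : IsConilpotent K A) {n : ℕ} {a : A}
    (ha : a ∈ lcsIdeal K A n) : logPt hA (toConv (AlgHom.id K A)) a ∈ lcsQuot K A n := by
  intro S _ _ x y hy
  rw [map_logPt_id, map_logPt_id,
    logPt_mul_of_mem_zeroLocus hA (isNormalSubgroupIdeal_lcsIdeal n) x hy ha]

/-- The kernel of the quotient map `U → U_n` is `U^{n+1}`. -/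
theorem mem_zeroLocus_of_eq_one (hA : IsConilpotent K A) {n : ℕ} {S : Type u} [CommRing S]
    [Algebra K S] {y : Pts K A S}
    (hy : ∀ a ∈ lcsQuot K A n, y a = algebraMap K S (Coalgebra.counit (R := K) a)) :
    y ∈ zeroLocus K (lcsIdeal K A n) S := by
  have hI := isNormalSubgroupIdeal_lcsIdeal (K := K) (A := A) n
  -- The logarithm of y on the ideal is y evaluated at an element of the coordinate ring of U_n,
  -- where y agrees with the counit. All convolution powers of log y then vanish on the ideal, hence
  -- so does y = exp(log y).
  have hlog : ∀ a ∈ lcsIdeal K A n, logPt hA y a = 0 := fun a ha ↦ by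
    rw [← map_logPt_id, hy _ (logPt_id_mem_lcsQuot hA ha), ← Pts.one_apply, map_logPt_id, logPt_one]
  have hpow : ∀ k, ∀ a ∈ lcsIdeal K A n, (toConv (logPt hA y) ^ k) a = 0 := by
    intro k
    induction k with
    | zero =>
      intro a ha
      rw [pow_zero, LinearMap.convOne_apply, counit_eq_zero_of_mem hI ha, map_zero]
    | succ k ih =>
      intro a ha
      rw [pow_succ]
      exact convMul_apply_eq_zero hI ih hlog ha
  intro a ha
  have h1 : powPt hA y a = 0 := by
    ext k
    have := congr($(powPt_coeff hA y k) a)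
    rw [hpow k a ha] at this
    change (k.factorial : K) • (powPt hA y a).coeff k = 0 at this
    rw [smul_eq_zero_iff_right (Nat.cast_ne_zero.mpr k.factorial_ne_zero)] at this
    rw [this, Polynomial.coeff_zero]
  rw [eq_map_evalNat_one hA y, Pts.map_apply, h1, map_zero]

omit [CharZero K] in
-- Normality puts commutators with U^{n+1} into U^{n+1}, so the ideal of U^{n+1} is itself one of
-- those whose supremum defines the ideal of U^{n+2}.
theorem lcsIdeal_le_succ (n : ℕ) : lcsIdeal K A n ≤ lcsIdeal K A (n + 1) := by
  refine le_sSup ⟨isNormalSubgroupIdeal_lcsIdeal n, fun S _ _ x y hy ↦ ?_⟩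
  obtain ⟨N, hN, hN'⟩ := isNormalSubgroupIdeal_lcsIdeal (K := K) (A := A) n S
  rw [← hN', SetLike.mem_coe] at hy ⊢
  exact N.mul_mem (hN.conj_mem y hy x) (N.inv_mem hy)

omit [CharZero K] in
theorem lcsQuot_le_succ (n : ℕ) : lcsQuot K A n ≤ lcsQuot K A (n + 1) :=
  fun _ ha S _ _ x y hy ↦ ha S x y fun b hb ↦ hy b (lcsIdeal_le_succ n hb)

variable (K A) in
omit [CharZero K] in
/-- The inclusion of the coordinate ring of `U_n` in that of `U`. -/
def lcsIncl (n : ℕ) : lcsQuot K A n →ₐc[K] A :=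
  BialgHom.ofAlgHom (lcsQuot K A n).val (AlgHom.ext fun _ ↦ rfl)
    (AlgHom.ext fun a ↦ lcsQuot_comul n a)

variable (K A) in
omit [CharZero K] in
theorem comul_inclusion (n : ℕ) (a : lcsQuot K A n) :
    TensorProduct.map (Subalgebra.inclusion (lcsQuot_le_succ n)).toLinearMap
      (Subalgebra.inclusion (lcsQuot_le_succ n)).toLinearMap (Coalgebra.comul (R := K) a) =
      Coalgebra.comul (R := K) (Subalgebra.inclusion (lcsQuot_le_succ n) a) := by
  refine incl₂_injective (lcsQuot K A (n + 1)) ?_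
  rw [lcsQuot_comul, Subalgebra.coe_inclusion, ← lcsQuot_comul]
  generalize Coalgebra.comul (R := K) a = z
  induction z with
  | zero => rw [map_zero, map_zero, map_zero]
  | tmul c d => rfl
  | add c d hc hd => rw [map_add, map_add, map_add, hc, hd]

variable (K A) in
omit [CharZero K] in
/-- The inclusion of the coordinate ring of `U_n` in that of `U_{n+1}`. -/
def lcsStep (n : ℕ) : lcsQuot K A n →ₐc[K] lcsQuot K A (n + 1) :=
  BialgHom.ofAlgHom (Subalgebra.inclusion (lcsQuot_le_succ n)) (AlgHom.ext fun _ ↦ rfl)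
    (AlgHom.ext fun a ↦ comul_inclusion K A n a)

omit [CharZero K] in
theorem lcsStep_injective (n : ℕ) : Function.Injective (lcsStep K A n) :=
  fun _ _ h ↦ Subtype.ext congr(($h : A))

omit [CharZero K] in
theorem lcsIncl_injective (n : ℕ) : Function.Injective (lcsIncl K A n) := Subtype.val_injective

omit [CharZero K] in
theorem lcsQuot_isConilpotent (hA : IsConilpotent K A) (n : ℕ) :
    IsConilpotent K (lcsQuot K A n) := hA.of_injective (lcsIncl K A n) (lcsIncl_injective n)

/-- The kernel of `U_{n+1} → U_n` is central. -/
theorem commute_of_res_eq_one (hA : IsConilpotent K A) {n : ℕ} {S : Type u} [CommRing S]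
    [Algebra K S] (x y : Pts K (lcsQuot K A (n + 1)) S) (hy : Pts.res (lcsStep K A n) y = 1) :
    x * y = y * x := by
  obtain ⟨x, rfl⟩ := Pts.res_surjective hA (lcsIncl K A (n + 1)) (lcsIncl_injective _) x
  obtain ⟨y, rfl⟩ := Pts.res_surjective hA (lcsIncl K A (n + 1)) (lcsIncl_injective _) y
  have hy' : y ∈ zeroLocus K (lcsIdeal K A n) S := by
    refine mem_zeroLocus_of_eq_one hA fun a ha ↦ ?_
    exact congr($hy ⟨a, ha⟩)
  -- For lifts to U this is the commutator of x⁻¹ and y⁻¹, with y in U^{n+1}; functions on U_{n+1}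
  -- do not see it.
  have hz : (y * x)⁻¹ * (x * y) ∈ zeroLocus K (lcsIdeal K A (n + 1)) S := by
    obtain ⟨N, hN, hN'⟩ := isNormalSubgroupIdeal_lcsIdeal (K := K) (A := A) n S
    have hy'' : y⁻¹ ∈ zeroLocus K (lcsIdeal K A n) S := by
      rw [← hN', SetLike.mem_coe] at hy' ⊢
      exact N.inv_mem hy'
    change _ ∈ zeroLocus K (sSup _) S
    rw [mem_zeroLocus_sSup]
    rintro I ⟨-, hI⟩
    have h1 := hI S x⁻¹ y⁻¹ hy''
    rwa [inv_inv, inv_inv, ← mul_inv_rev, mul_assoc] at h1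
  rw [← map_mul, ← map_mul]
  refine Pts.ext_apply fun a ↦ ?_
  have := a.2 S (y * x) ((y * x)⁻¹ * (x * y)) hz
  rwa [mul_inv_cancel_left] at this

omit [CharZero K] in
-- Functions invariant under all translations are constant: translate the identity by the universal
-- point. So U_0 is trivial, which starts every induction.
theorem lcsQuot_zero_pts {S : Type*} [CommRing S] [Algebra K S]
    (x y : Pts K (lcsQuot K A 0) S) : x = y := by
  have h : ∀ a : lcsQuot K A 0, a = algebraMap K _ (Coalgebra.counit (R := K) a) := by
    intro a
    have := a.2 A 1 (toConv (AlgHom.id K A)) (by rintro b rfl; exact map_zero _)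
    rw [one_mul] at this
    exact Subtype.ext this
  refine Pts.ext_apply fun a ↦ ?_
  rw [h a]
  exact (x.ofConv.commutes _).trans (y.ofConv.commutes _).symm

end Normal

/-! ### Linear systems and cohomology under base change. -/

section TensorAlgebraLemmas

variable {K : Type*} [Field K]

/-- A basis of R reduces the claim to coordinates in M, so infinite families are allowed. -/
theorem eq_zero_of_rTensor_eq_zero {M ι : Type*} {N : ι → Type*} [AddCommGroup M] [Module K M]
    [∀ i, AddCommGroup (N i)] [∀ i, Module K (N i)] (R : Type*) [AddCommGroup R] [Module K R]
    (φ : ∀ i, M →ₗ[K] N i) (hφ : ∀ m, (∀ i, φ i m = 0) → m = 0) (t : M ⊗[K] R)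
    (ht : ∀ i, (φ i).rTensor R t = 0) : t = 0 := by
  classical
  let b := Module.Basis.ofVectorSpace K R
  have nat : ∀ i j, ∀ t : M ⊗[K] R, TensorProduct.equivFinsuppOfBasisRight b ((φ i).rTensor R t) j =
      φ i (TensorProduct.equivFinsuppOfBasisRight b t j) := by
    intro i j t
    induction t with
    | zero => simp
    | tmul m r => simp
    | add s t hs ht => simp only [map_add, Finsupp.add_apply, hs, ht]
  apply (TensorProduct.equivFinsuppOfBasisRight b).injective
  rw [map_zero]
  ext j
  refine hφ _ fun i ↦ ?_
  rw [← nat, ht, map_zero, Finsupp.zero_apply]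

/-- The ideal is generated by the coordinates of o in a basis of M, and these are compatible with
change of coefficients. -/
theorem exists_ideal_of_tensor {M X : Type*} [AddCommGroup M] [Module K M] [CommRing X]
    [Algebra K X] (o : M ⊗[K] X) : ∃ J : Ideal X, ∀ (R : Type u) [CommRing R] [Algebra K R]
      (f : X →ₐ[K] R), f.toLinearMap.lTensor M o = 0 ↔ ∀ a ∈ J, f a = 0 := by
  classical
  let b := Module.Basis.ofVectorSpace K M
  refine ⟨Ideal.span (Set.range fun i ↦ TensorProduct.equivFinsuppOfBasisLeft b o i),
    fun R _ _ f ↦ ?_⟩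
  have nat : ∀ i, ∀ t : M ⊗[K] X, TensorProduct.equivFinsuppOfBasisLeft b
      (f.toLinearMap.lTensor M t) i = f (TensorProduct.equivFinsuppOfBasisLeft b t i) := by
    intro i t
    induction t with
    | zero => simp
    | tmul m r => simp
    | add s t hs ht => simp only [map_add, Finsupp.add_apply, hs, ht]
  constructor
  · intro h
    change Ideal.span _ ≤ RingHom.ker f
    rw [Ideal.span_le]
    rintro _ ⟨i, rfl⟩
    change f _ = 0
    rw [← nat, h, map_zero, Finsupp.zero_apply]
  · intro h
    apply (TensorProduct.equivFinsuppOfBasisLeft b).injective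
    rw [map_zero]
    ext i
    rw [nat, Finsupp.zero_apply]
    exact h _ (Ideal.subset_span ⟨i, rfl⟩)

theorem mem_range_rTensor_iff {L M : Type*} [AddCommGroup L] [Module K L] [AddCommGroup M]
    [Module K M] (d : L →ₗ[K] M) (R : Type*) [AddCommGroup R] [Module K R] (t : M ⊗[K] R) :
    t ∈ LinearMap.range (d.rTensor R) ↔ (LinearMap.range d).mkQ.rTensor R t = 0 :=
  ((rTensor_exact R (f := d) (g := (LinearMap.range d).mkQ)
    (LinearMap.exact_iff.mpr (Submodule.ker_mkQ _)) (Submodule.mkQ_surjective _)) t).symm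

/-- The locus where a family of cochains becomes a coboundary is closed. -/
theorem exists_obstruction_ideal {L M X : Type*} [AddCommGroup L] [Module K L] [AddCommGroup M]
    [Module K M] [CommRing X] [Algebra K X] (d : L →ₗ[K] M) (o : M ⊗[K] X) :
    ∃ J : Ideal X, ∀ (R : Type u) [CommRing R] [Algebra K R] (f : X →ₐ[K] R),
      f.toLinearMap.lTensor M o ∈ LinearMap.range (d.rTensor R) ↔ ∀ a ∈ J, f a = 0 := by
  obtain ⟨J, hJ⟩ := exists_ideal_of_tensor ((LinearMap.range d).mkQ.rTensor X o)
  refine ⟨J, fun R _ _ f ↦ ?_⟩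
  rw [← hJ R f, mem_range_rTensor_iff]
  have h1 := congr($(LinearMap.rTensor_comp_lTensor (f := (LinearMap.range d).mkQ)
    (g := f.toLinearMap)) o)
  have h2 := congr($(LinearMap.lTensor_comp_rTensor (f := (LinearMap.range d).mkQ)
    (g := f.toLinearMap)) o)
  rw [LinearMap.comp_apply] at h1 h2
  rw [h1, h2]

/-- Cohomology of a three-term complex commutes with base change along free modules. -/
theorem exists_cohomology_basis {L₀ L₁ L₂ : Type*} [AddCommGroup L₀] [Module K L₀]
    [AddCommGroup L₁] [Module K L₁] [AddCommGroup L₂] [Module K L₂] (d₀ : L₀ →ₗ[K] L₁)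
    (d₁ : L₁ →ₗ[K] L₂) (h : ∀ l, d₁ (d₀ l) = 0)
    (hfin : Module.Finite K (LinearMap.ker d₁ ⧸
      (LinearMap.range d₀).comap (LinearMap.ker d₁).subtype)) :
    ∃ (k : ℕ) (z : Fin k → L₁), (∀ j, d₁ (z j) = 0) ∧
      ∀ (R : Type u) [CommRing R] [Algebra K R] (l : L₁ ⊗[K] R), d₁.rTensor R l = 0 →
        ∃! r : Fin k → R, l - ∑ j, z j ⊗ₜ r j ∈ LinearMap.range (d₀.rTensor R) := by
  classical
  set Z := LinearMap.ker d₁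
  set E := Z ⧸ (LinearMap.range d₀).comap Z.subtype
  let q : Z →ₗ[K] E := Submodule.mkQ _
  have hq : Function.Surjective q := Submodule.mkQ_surjective _
  let b := Module.finBasis K E
  choose z hz using fun j ↦ hq (b j)
  let d₀' : L₀ →ₗ[K] Z := d₀.codRestrict Z h
  have hex : Function.Exact d₀' q := by
    rw [LinearMap.exact_iff, Submodule.ker_mkQ]
    ext y
    constructor
    · rintro ⟨l, hl⟩
      exact ⟨l, Subtype.ext hl⟩
    · rintro ⟨l, rfl⟩
      exact ⟨l, rfl⟩
  refine ⟨Module.finrank K E, fun j ↦ (z j : L₁), fun j ↦ (z j).2, fun R _ _ l hl ↦ ?_⟩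
  have hexZ : Function.Exact Z.subtype d₁ := by
    rw [LinearMap.exact_iff, Submodule.range_subtype]
  obtain ⟨t, rfl⟩ := (Module.Flat.rTensor_exact R hexZ l).mp hl
  have hinj : Function.Injective (Z.subtype.rTensor R) :=
    Module.Flat.rTensor_preserves_injective_linearMap _ Subtype.val_injective
  have hcomp : ∀ m, Z.subtype.rTensor R (d₀'.rTensor R m) = d₀.rTensor R m := fun m ↦ by
    rw [← LinearMap.comp_apply, ← LinearMap.rTensor_comp]
    rfl
  -- By exactness of tensoring with R, differing by a coboundary means having equal classes in E ⊗
  -- R, where the basis b provides unique coordinates r.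
  have key : ∀ r : Fin (Module.finrank K E) → R,
      (Z.subtype.rTensor R t - ∑ j, (z j : L₁) ⊗ₜ r j ∈ LinearMap.range (d₀.rTensor R)) ↔
      q.rTensor R t = ∑ j, b j ⊗ₜ r j := by
    intro r
    have e1 : Z.subtype.rTensor R t - ∑ j, (z j : L₁) ⊗ₜ r j =
        Z.subtype.rTensor R (t - ∑ j, z j ⊗ₜ r j) := by
      rw [map_sub, map_sum]
      rfl
    have e2 : q.rTensor R (t - ∑ j, z j ⊗ₜ r j) = q.rTensor R t - ∑ j, b j ⊗ₜ r j := by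
      rw [map_sub, map_sum]
      simp only [LinearMap.rTensor_tmul, hz]
    rw [e1, ← sub_eq_zero, ← e2]
    constructor
    · rintro ⟨m, hm⟩
      rw [← hcomp] at hm
      rw [← hinj hm]
      exact ((rTensor_exact R hex hq) _).mpr ⟨m, rfl⟩
    · intro h0
      obtain ⟨m, hm⟩ := ((rTensor_exact R hex hq) _).mp h0
      exact ⟨m, by rw [← hm, hcomp]⟩
  simp only [key]
  have hsum : ∀ r : Fin (Module.finrank K E) → R, ∑ j, b j ⊗ₜ r j =
      (TensorProduct.equivFinsuppOfBasisLeft b).symm (Finsupp.equivFunOnFinite.symm r) := by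
    intro r
    rw [TensorProduct.equivFinsuppOfBasisLeft_symm_apply, Finsupp.sum_fintype _ _ (by simp)]
    rfl
  refine ⟨Finsupp.equivFunOnFinite (TensorProduct.equivFinsuppOfBasisLeft b (q.rTensor R t)), ?_,
    fun r hr ↦ ?_⟩
  · dsimp only
    rw [hsum, Equiv.symm_apply_apply, LinearEquiv.symm_apply_apply]
  · rw [hr, hsum, LinearEquiv.apply_symm_apply, Equiv.apply_symm_apply]

/-! ### Spaces of linear maps and tensor products -/

section Hom

variable {W W' : Type*} [AddCommGroup W] [Module K W] [Module.Finite K W]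
  [AddCommGroup W'] [Module K W'] [Module.Finite K W']
  {T T' : Type*} [AddCommGroup T] [Module K T] [AddCommGroup T'] [Module K T']
  {R : Type*} [CommRing R] [Algebra K R]

/-- The linear map `w ↦ l w ⊗ r`. -/
def homTmul (l : W →ₗ[K] T) (r : R) : W →ₗ[K] T ⊗[K] R := (TensorProduct.mk K T R).flip r ∘ₗ l

omit [Module.Finite K W] in
@[simp] theorem homTmul_apply (l : W →ₗ[K] T) (r : R) (w : W) : homTmul l r w = l w ⊗ₜ r := rfl

variable (K W T R) in
/-- `Hom(W, T) ⊗ R = Hom(W, T ⊗ R)` -/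
def homTensor : (W →ₗ[K] T) ⊗[K] R ≃ₗ[K] (W →ₗ[K] T ⊗[K] R) := rTensorHomEquivHomRTensor K W T R

theorem homTensor_tmul (l : W →ₗ[K] T) (r : R) :
    homTensor K W T R (l ⊗ₜ r) = homTmul l r := by
  rw [homTensor, rTensorHomEquivHomRTensor_apply]
  rfl

theorem homTensor_induction {P : (W →ₗ[K] T ⊗[K] R) → Prop} (h0 : P 0)
    (h : ∀ l r, P (homTmul l r)) (ha : ∀ l l', P l → P l' → P (l + l'))
    (l : W →ₗ[K] T ⊗[K] R) : P l := by
  obtain ⟨t, rfl⟩ := (homTensor K W T R).surjective l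
  induction t with
  | zero => rwa [map_zero]
  | tmul l r => rw [homTensor_tmul]; exact h l r
  | add s t hs ht => rw [map_add]; exact ha _ _ hs ht

variable (R) in
/-- Base change of a linear map between spaces of linear maps. -/
def homBase (d : (W →ₗ[K] T) →ₗ[K] (W' →ₗ[K] T')) :
    (W →ₗ[K] T ⊗[K] R) →ₗ[K] (W' →ₗ[K] T' ⊗[K] R) :=
  (homTensor K W' T' R).toLinearMap ∘ₗ d.rTensor R ∘ₗ (homTensor K W T R).symm.toLinearMap

theorem homBase_homTmul (d : (W →ₗ[K] T) →ₗ[K] (W' →ₗ[K] T')) (l : W →ₗ[K] T) (r : R) :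
    homBase R d (homTmul l r) = homTmul (d l) r := by
  rw [← homTensor_tmul, ← homTensor_tmul, homBase]
  simp

theorem homBase_homTensor (d : (W →ₗ[K] T) →ₗ[K] (W' →ₗ[K] T')) (t : (W →ₗ[K] T) ⊗[K] R) :
    homBase R d (homTensor K W T R t) = homTensor K W' T' R (d.rTensor R t) := by
  simp [homBase]

theorem lTensor_comp_homTensor {R' : Type*} [CommRing R'] [Algebra K R'] (f : R →ₐ[K] R')
    (t : (W →ₗ[K] T) ⊗[K] R) : f.toLinearMap.lTensor T ∘ₗ homTensor K W T R t =
      homTensor K W T R' (f.toLinearMap.lTensor _ t) := by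
  induction t with
  | zero => simp
  | tmul l r =>
    rw [homTensor_tmul, LinearMap.lTensor_tmul, homTensor_tmul]
    ext w
    simp
  | add s t hs ht => simp only [map_add, LinearMap.comp_add, hs, ht]

/-- For finite-dimensional W, Hom(W, T) ⊗ R is Hom(W, T ⊗ R); this restates the closedness of
solvability for the forms produced by logarithms. -/
theorem exists_obstruction_ideal_hom {X : Type*} [CommRing X] [Algebra K X]
    (d : (W →ₗ[K] T) →ₗ[K] (W' →ₗ[K] T')) (o : W' →ₗ[K] T' ⊗[K] X) :
    ∃ J : Ideal X, ∀ (R : Type u) [CommRing R] [Algebra K R] (f : X →ₐ[K] R),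
      (∃ l, homBase R d l = f.toLinearMap.lTensor T' ∘ₗ o) ↔ ∀ a ∈ J, f a = 0 := by
  obtain ⟨J, hJ⟩ := exists_obstruction_ideal d ((homTensor K W' T' X).symm o)
  refine ⟨J, fun R _ _ f ↦ ?_⟩
  rw [← hJ R f]
  have e := lTensor_comp_homTensor (T := T') f ((homTensor K W' T' X).symm o)
  rw [LinearEquiv.apply_symm_apply] at e
  rw [e]
  constructor
  · rintro ⟨l, hl⟩
    refine ⟨(homTensor K W T R).symm l, (homTensor K W' T' R).injective ?_⟩
    rw [← homBase_homTensor, LinearEquiv.apply_symm_apply, hl]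
  · rintro ⟨t, ht⟩
    exact ⟨homTensor K W T R t, by rw [homBase_homTensor, ht]⟩

theorem exists_cohomology_basis_hom {W₀ W₁ W₂ : Type*} [AddCommGroup W₀] [Module K W₀]
    [Module.Finite K W₀] [AddCommGroup W₁] [Module K W₁] [Module.Finite K W₁] [AddCommGroup W₂]
    [Module K W₂] [Module.Finite K W₂] {T₀ T₁ T₂ : Type*} [AddCommGroup T₀] [Module K T₀]
    [AddCommGroup T₁] [Module K T₁] [AddCommGroup T₂] [Module K T₂]
    (d₀ : (W₀ →ₗ[K] T₀) →ₗ[K] (W₁ →ₗ[K] T₁)) (d₁ : (W₁ →ₗ[K] T₁) →ₗ[K] (W₂ →ₗ[K] T₂))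
    (h : ∀ l, d₁ (d₀ l) = 0)
    (hfin : Module.Finite K (LinearMap.ker d₁ ⧸
      (LinearMap.range d₀).comap (LinearMap.ker d₁).subtype)) :
    ∃ (k : ℕ) (z : Fin k → (W₁ →ₗ[K] T₁)), (∀ j, d₁ (z j) = 0) ∧
      ∀ (R : Type u) [CommRing R] [Algebra K R] (l : W₁ →ₗ[K] T₁ ⊗[K] R), homBase R d₁ l = 0 →
        ∃! r : Fin k → R, ∃ m, l - ∑ j, homTmul (z j) (r j) = homBase R d₀ m := by
  obtain ⟨k, z, hz, H⟩ := exists_cohomology_basis d₀ d₁ h hfin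
  refine ⟨k, z, hz, fun R _ _ l hl ↦ ?_⟩
  obtain ⟨t, rfl⟩ := (homTensor K W₁ T₁ R).surjective l
  rw [homBase_homTensor, LinearEquiv.map_eq_zero_iff] at hl
  refine (existsUnique_congr fun r ↦ ?_).mp (H R t hl)
  have e : homTensor K W₁ T₁ R t - ∑ j, homTmul (z j) (r j) =
      homTensor K W₁ T₁ R (t - ∑ j, z j ⊗ₜ r j) := by
    rw [map_sub, map_sum]
    simp only [homTensor_tmul]
  rw [e]
  constructor
  · rintro ⟨m, hm⟩
    exact ⟨homTensor K W₀ T₀ R m, by rw [homBase_homTensor, hm]⟩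
  · rintro ⟨m, hm⟩
    refine ⟨(homTensor K W₀ T₀ R).symm m, (homTensor K W₁ T₁ R).injective ?_⟩
    rw [← homBase_homTensor, LinearEquiv.apply_symm_apply, hm]

end Hom

end TensorAlgebraLemmas

/-! ### The exponential as a map on forms on the cotangent space. -/

section Cotangent

variable {K : Type*} [Field K] {H : Type*} [CommRing H] [HopfAlgebra K H]

/-- The subspace of `H` killed by all derivations at the identity that vanish on `N`. -/
def cotKer (N : Submodule K H) : Submodule K H :=
  Submodule.span K {c | ∃ a b : H, c = a * b - Coalgebra.counit (R := K) a • b -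
    Coalgebra.counit (R := K) b • a} ⊔ N

/-- The cotangent space at the identity, modulo `N`. -/
abbrev Cot (N : Submodule K H) : Type _ := H ⧸ cotKer N

variable {N : Submodule K H}

theorem le_cotKer : N ≤ cotKer N := le_sup_right

theorem mk_mul_cot (a b : H) : (cotKer N).mkQ (a * b) = Coalgebra.counit (R := K) a •
    (cotKer N).mkQ b + Coalgebra.counit (R := K) b • (cotKer N).mkQ a := by
  have h : a * b - Coalgebra.counit (R := K) a • b - Coalgebra.counit (R := K) b • a ∈ cotKer N :=
    Submodule.mem_sup_left (Submodule.subset_span ⟨a, b, rfl⟩)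
  rw [← Submodule.Quotient.mk_eq_zero, ← Submodule.mkQ_apply, map_sub, map_sub, map_smul,
    map_smul] at h
  rw [sub_sub, sub_eq_zero] at h
  exact h

theorem cotKer_le {M : Type*} [AddCommGroup M] [Module K M] (D : H →ₗ[K] M)
    (hD : ∀ a b, D (a * b) = Coalgebra.counit (R := K) a • D b + Coalgebra.counit (R := K) b • D a)
    (hN : ∀ a ∈ N, D a = 0) : cotKer N ≤ LinearMap.ker D := by
  refine sup_le (Submodule.span_le.mpr ?_) hN
  rintro _ ⟨a, b, rfl⟩
  change D _ = 0
  rw [map_sub, map_sub, hD, map_smul, map_smul]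
  abel

/-- The class of a product is a linear combination of the classes of its factors, so algebra
generators span the cotangent space. -/
instance [Algebra.FiniteType K H] : Module.Finite K (Cot N) := by
  classical
  obtain ⟨s, hs⟩ := Algebra.FiniteType.out (R := K) (A := H)
  have h1 : (cotKer N).mkQ 1 = 0 := by
    have := mk_mul_cot (N := N) (1 : H) 1
    simpa using this
  refine ⟨⟨s.image (cotKer N).mkQ, ?_⟩⟩
  rw [eq_top_iff]
  rintro x -
  obtain ⟨a, rfl⟩ := (cotKer N).mkQ_surjective x
  have ha : a ∈ Algebra.adjoin K (s : Set H) := hs ▸ Algebra.mem_top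
  induction ha using Algebra.adjoin_induction with
  | mem a ha => exact Submodule.subset_span (Finset.mem_coe.mpr (Finset.mem_image_of_mem _ ha))
  | algebraMap r =>
    rw [Algebra.algebraMap_eq_smul_one, map_smul, h1, smul_zero]
    exact Submodule.zero_mem _
  | add a b _ _ ha hb => rw [map_add]; exact Submodule.add_mem _ ha hb
  | mul a b _ _ ha hb =>
    rw [mk_mul_cot]
    exact Submodule.add_mem _ (Submodule.smul_mem _ _ hb) (Submodule.smul_mem _ _ ha)

variable {S : Type*} [CommRing S] [Algebra K S] {S' : Type*} [CommRing S'] [Algebra K S']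

theorem isDer_cot (l : Cot N →ₗ[K] S) : IsDer (l ∘ₗ (cotKer N).mkQ) := by
  intro a b
  rw [LinearMap.comp_apply, mk_mul_cot, map_add, map_smul, map_smul, Algebra.smul_def,
    Algebra.smul_def]
  rfl

theorem IsDer.smul {D : H →ₗ[K] S} (hD : IsDer D) (a b : H) :
    D (a * b) = Coalgebra.counit (R := K) a • D b + Coalgebra.counit (R := K) b • D a := by
  rw [hD, Algebra.smul_def, Algebra.smul_def]

variable [CharZero K] (hH : IsConilpotent K H)

/-- The exponential map on the space of derivations vanishing on `N`. -/
def expCot (l : Cot N →ₗ[K] S) : Pts K H S := expPt hH (isDer_cot l)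

theorem logPt_expCot (l : Cot N →ₗ[K] S) (a : H) :
    logPt hH (expCot hH l) a = l ((cotKer N).mkQ a) := logPt_expPt hH _ a

theorem eq_expCot_iff {x : Pts K H S} {l : Cot N →ₗ[K] S} :
    x = expCot hH l ↔ ∀ a, logPt hH x a = l ((cotKer N).mkQ a) :=
  ⟨fun h a ↦ by rw [h, logPt_expCot], fun h ↦ logPt_injective hH fun a ↦ by rw [h, logPt_expCot]⟩

theorem expCot_injective : Function.Injective (expCot hH : (Cot N →ₗ[K] S) → Pts K H S) := by
  intro l l' h
  ext a
  have := logPt_expCot hH l a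
  rw [h, logPt_expCot] at this
  exact this.symm

/-- Every point is the exponential of its logarithm, and derivations vanishing on N are exactly
linear forms on `Cot N`. -/
theorem exists_expCot {x : Pts K H S} (hx : ∀ a ∈ N, logPt hH x a = 0) :
    ∃ l : Cot N →ₗ[K] S, x = expCot hH l :=
  ⟨(cotKer N).liftQ (logPt hH x) (cotKer_le _ (isDer_logPt hH x).smul hx),
    (eq_expCot_iff hH).mpr fun _ ↦ rfl⟩

theorem exists_expCot_bot (x : Pts K H S) :
    ∃ l : Cot (⊥ : Submodule K H) →ₗ[K] S, x = expCot hH l :=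
  exists_expCot hH fun a ha ↦ by rw [(Submodule.mem_bot K).mp ha, map_zero]

theorem map_expCot (f : S →ₐ[K] S') (l : Cot N →ₗ[K] S) :
    Pts.map f (expCot hH l) = expCot hH (f.toLinearMap ∘ₗ l) := by
  rw [eq_expCot_iff]
  intro a
  rw [logPt_map, logPt_expCot]
  rfl

theorem expCot_zero : expCot hH (0 : Cot N →ₗ[K] S) = 1 := by
  refine ((eq_expCot_iff hH).mpr fun a ↦ ?_).symm
  rw [logPt_one, LinearMap.zero_apply]

theorem expCot_add_of_commute {l l' : Cot N →ₗ[K] S}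
    (h : Commute (expCot hH l) (expCot hH l')) :
    expCot hH (l + l') = expCot hH l * expCot hH l' := by
  refine ((eq_expCot_iff hH).mpr fun a ↦ ?_).symm
  rw [logPt_mul hH h, logPt_expCot, logPt_expCot, LinearMap.add_apply]

variable {G : Type*} [Group G] (α : HopfAction G K H)

/-- The action on the cotangent space. -/
def cotAct (hN : ∀ g, ∀ a ∈ N, α.toHom g a ∈ N) (g : G) : Cot N →ₗ[K] Cot N :=
  (cotKer N).liftQ ((cotKer N).mkQ ∘ₗ (α.toHom g).toLinearMap) (cotKer_le _ (fun a b ↦ by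
    simp only [LinearMap.comp_apply, AlgEquiv.toLinearMap_apply, map_mul, mk_mul_cot,
      α.counit_apply]) fun a ha ↦ by
    change (cotKer N).mkQ (α.toHom g a) = 0
    rw [Submodule.mkQ_apply, Submodule.Quotient.mk_eq_zero]
    exact le_cotKer (hN g a ha))

omit [CharZero K] in
@[simp] theorem cotAct_mk (hN : ∀ g, ∀ a ∈ N, α.toHom g a ∈ N) (g : G) (a : H) :
    cotAct α hN g ((cotKer N).mkQ a) = (cotKer N).mkQ (α.toHom g a) := rfl

/-- The automorphism of the Hopf algebra given by `g`, as a homomorphism of bialgebras. -/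
def actBialgHom (g : G) : H →ₐc[K] H :=
  BialgHom.ofAlgHom (α.toHom g : H →ₐ[K] H) (AlgHom.ext (α.counit_apply g))
    (AlgHom.ext fun a ↦ (α.comul_apply g a).symm)

theorem logPt_ptsAct (σ : G →* (S ≃ₐ[K] S)) (g : G) (x : Pts K H S) (a : H) :
    logPt hH (ptsAct α σ g x) a = σ g (logPt hH x (α.toHom g⁻¹ a)) := by
  have e : ptsAct α σ g x = Pts.map ((σ g : S ≃ₐ[K] S) : S →ₐ[K] S)
    (Pts.res (actBialgHom α g⁻¹) x) := rfl
  rw [e, logPt_map, logPt_res hH hH]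
  rfl

theorem ptsAct_expCot (hN : ∀ g, ∀ a ∈ N, α.toHom g a ∈ N) (σ : G →* (S ≃ₐ[K] S)) (g : G)
    (l : Cot N →ₗ[K] S) : ptsAct α σ g (expCot hH l) =
      expCot hH ((σ g).toLinearMap ∘ₗ l ∘ₗ cotAct α hN g⁻¹) := by
  rw [eq_expCot_iff]
  intro a
  rw [logPt_ptsAct, logPt_expCot]
  rfl

end Cotangent

/-! ### Cochains with coefficients in (G → T) ⊗ R. -/

section Cochains

variable {K : Type*} [Field K] {G : Type*} {W : Type*} [AddCommGroup W] [Module K W]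
  {T : Type*} [AddCommGroup T] [Module K T] {T' : Type*} [AddCommGroup T'] [Module K T']

/-- The function `g ↦ τ g ∘ l ∘ w g - π ∘ l`, as a linear map to functions on `G`. -/
def orbitDiff (τ : G → (T →ₗ[K] T')) (π : T →ₗ[K] T') (w : G → (W →ₗ[K] W)) :
    (W →ₗ[K] T) →ₗ[K] (W →ₗ[K] (G → T')) where
  toFun l := LinearMap.pi fun g ↦ τ g ∘ₗ l ∘ₗ w g - π ∘ₗ l
  map_add' l l' := by
    ext v g
    simp only [LinearMap.pi_apply, LinearMap.sub_apply, LinearMap.comp_apply, LinearMap.add_apply,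
      map_add, Pi.add_apply]
    abel
  map_smul' c l := by
    ext v g
    simp [smul_sub]

variable [Module.Finite K W] {R : Type*} [CommRing R] [Algebra K R]

theorem proj_orbitDiff (τ : G → (T →ₗ[K] T')) (π : T →ₗ[K] T') (w : G → (W →ₗ[K] W))
    (l : W →ₗ[K] T ⊗[K] R) (v : W) (g : G) :
    (LinearMap.proj g : (G → T') →ₗ[K] T').rTensor R (homBase R (orbitDiff τ π w) l v) =
      (τ g).rTensor R (l (w g v)) - π.rTensor R (l v) := by
  induction l using homTensor_induction with
  | h0 => simp
  | h l r =>
    rw [homBase_homTmul, homTmul_apply, LinearMap.rTensor_tmul, homTmul_apply, homTmul_apply,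
      LinearMap.rTensor_tmul, LinearMap.rTensor_tmul, ← TensorProduct.sub_tmul]
    rfl
  | ha l l' h h' =>
    simp only [map_add, LinearMap.add_apply, h, h']
    abel

theorem eq_of_proj_rTensor {t t' : (G → T) ⊗[K] R}
    (h : ∀ g, (LinearMap.proj g : (G → T) →ₗ[K] T).rTensor R t =
      (LinearMap.proj g : (G → T) →ₗ[K] T).rTensor R t') : t = t' := by
  refine sub_eq_zero.mp (eq_zero_of_rTensor_eq_zero R
    (fun g : G ↦ (LinearMap.proj g : (G → T) →ₗ[K] T)) (fun m hm ↦ funext hm) _ fun g ↦ ?_)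
  rw [map_sub, h, sub_self]

variable {B : Type*} [CommRing B] [Algebra K B]

variable (K B R) in
/-- Evaluation at `g` of elements of `(G → B) ⊗ R`. -/
def evalFun (g : G) : (G → B) ⊗[K] R →ₐ[K] B ⊗[K] R :=
  Algebra.TensorProduct.map (Pi.evalAlgHom K (fun _ : G ↦ B) g) (AlgHom.id K R)

theorem evalFun_apply (g : G) (t : (G → B) ⊗[K] R) :
    evalFun K R B g t = (LinearMap.proj g : (G → B) →ₗ[K] B).rTensor R t := by
  induction t with
  | zero => simp
  | tmul f r => rfl
  | add s t hs ht => rw [map_add, map_add, hs, ht]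

theorem eq_zero_of_evalFun (t : (G → B) ⊗[K] R) (h : ∀ g, evalFun K R B g t = 0) : t = 0 := by
  refine eq_of_proj_rTensor fun g ↦ ?_
  rw [← evalFun_apply, h, map_zero]

theorem evalFun_map {R' : Type*} [CommRing R'] [Algebra K R'] (f : R →ₐ[K] R') (g : G)
    (t : (G → B) ⊗[K] R) :
    evalFun K R' B g (f.toLinearMap.lTensor _ t) =
      Algebra.TensorProduct.map (AlgHom.id K B) f (evalFun K R B g t) := by
  induction t with
  | zero => simp
  | tmul b r => rfl
  | add s t hs ht => simp only [map_add, hs, ht]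

end Cochains

/-! ### Families over G with finite-dimensional span. -/

section FiniteSpan

variable {K : Type*} [Field K]

/-- The values of `f` are combinations of finitely many vectors. -/
def HasFiniteSpan {X M : Type*} [AddCommGroup M] [Module K M] (f : X → M) : Prop :=
  ∃ (n : ℕ) (c : Fin n → X → K) (b : Fin n → M), ∀ x, f x = ∑ i, c i x • b i

variable {G : Type*} [Group G] {H : Type*} [CommRing H] [HopfAlgebra K H] (α : HopfAction G K H)
  {B : Type*} [Field B] [Algebra K B] (σ : G →* (B ≃ₐ[K] B))
  {R : Type*} [CommRing R] [Algebra K R]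

theorem tensorAct_apply' {B : Type u} [Field B] {K : Type u} [Field K] [Algebra K B]
    (σ : G →* (B ≃ₐ[K] B)) {R : Type u} [CommRing R] [Algebra K R] (g : G) (t : B ⊗[K] R) :
    tensorAct σ R g t = (σ g).toLinearMap.rTensor R t := by
  induction t with
  | zero => simp
  | tmul b r => rfl
  | add s t hs ht => rw [map_add, map_add, hs, ht]

variable (K R B) in
/-- Constant functions. -/
def constFun (G : Type*) : B ⊗[K] R →ₐ[K] (G → B) ⊗[K] R :=
  Algebra.TensorProduct.map (Pi.constAlgHom K G B) (AlgHom.id K R)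

omit [Group G] in
theorem evalFun_constFun (g : G) (t : B ⊗[K] R) : evalFun K R B g (constFun K B R G t) = t := by
  induction t with
  | zero => simp
  | tmul b r => rfl
  | add s t hs ht => rw [map_add, map_add, hs, ht]

omit [Group G] in
-- Finite span puts each coordinate function into (G → K) ⊗ R, which is in general smaller than all
-- functions from G to R. The family then becomes one point, whose lifts and logarithm are taken
-- simultaneously for all g.
theorem exists_point_of_hasFiniteSpan (c : G → Pts K H R)
    (hc : ∀ a, HasFiniteSpan (K := K) fun g ↦ c g a) :
    ∃ C : Pts K H ((G → K) ⊗[K] R), ∀ g a, (LinearMap.proj g : (G → K) →ₗ[K] K).rTensor R (C a) =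
      1 ⊗ₜ c g a := by
  obtain ⟨Φ, hΦ⟩ := exists_algHom_lift (K := K) (H := H) (T := (G → K) ⊗[K] R) (ι := G)
    (S := fun _ ↦ K ⊗[K] R) (evalFun K R K) eq_zero_of_evalFun
    (fun g ↦ (Algebra.TensorProduct.includeRight : R →ₐ[K] K ⊗[K] R).comp (c g).ofConv) fun a ↦ by
      obtain ⟨n, φ, b, h⟩ := hc a
      refine ⟨∑ i, φ i ⊗ₜ b i, fun g ↦ ?_⟩
      rw [map_sum]
      change _ = 1 ⊗ₜ c g a
      have h' : c g a = _ := h g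
      rw [h', TensorProduct.tmul_sum]
      refine Finset.sum_congr rfl fun i _ ↦ ?_
      rw [TensorProduct.tmul_smul, TensorProduct.smul_tmul']
      change φ i g ⊗ₜ b i = _
      rw [smul_eq_mul, mul_one]
  refine ⟨toConv Φ, fun g a ↦ ?_⟩
  rw [← evalFun_apply]
  exact hΦ g a

end FiniteSpan

/-! ### Orbits of points over B ⊗ R. -/

section Orbit

variable {K B H : Type u} [Field K] {G : Type v} [Group G] [CommRing H] [HopfAlgebra K H]
  (α : HopfAction G K H) [Field B] [Algebra K B] (σ : G →* (B ≃ₐ[K] B))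
  {R : Type u} [CommRing R] [Algebra K R]

/-- If g⁻¹ a = ∑ φ_i(g) b_i, then (g y)(a) = ∑ φ_i(g) g(y(b_i)), and each summand visibly lies in (G
→ B) ⊗ R. No continuity of the action on B is needed. -/
theorem exists_orbit_point (hα : ∀ a, HasFiniteSpan (K := K) fun g ↦ α.toHom g⁻¹ a)
    (y : Pts K H (B ⊗[K] R)) : ∃ Y : Pts K H ((G → B) ⊗[K] R), ∀ g,
      Pts.map (evalFun K R B g) Y = ptsAct α (tensorAct σ R) g y := by
  obtain ⟨Φ, hΦ⟩ := exists_algHom_lift (K := K) (H := H) (T := (G → B) ⊗[K] R) (ι := G)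
    (S := fun _ ↦ B ⊗[K] R) (evalFun K R B) eq_zero_of_evalFun
    (fun g ↦ (ptsAct α (tensorAct σ R) g y).ofConv) fun a ↦ by
      obtain ⟨n, φ, b, h⟩ := hα a
      refine ⟨∑ i, ((fun g ↦ algebraMap K B (φ i g)) ⊗ₜ 1) *
        (LinearMap.pi fun g ↦ (σ g).toLinearMap).rTensor R (y (b i)), fun g ↦ ?_⟩
      change _ = tensorAct σ R g (y (α.toHom g⁻¹ a))
      have e : ∀ t : B ⊗[K] R, evalFun K R B g
          ((LinearMap.pi fun g ↦ (σ g).toLinearMap).rTensor R t) = tensorAct σ R g t := by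
        intro t
        induction t with
        | zero => simp
        | tmul b r => rfl
        | add s t hs ht => simp only [map_add, hs, ht]
      have h' : α.toHom g⁻¹ a = _ := h g
      rw [h', map_sum, map_sum, map_sum]
      refine Finset.sum_congr rfl fun i _ ↦ ?_
      rw [map_mul, e, map_smul, map_smul, Algebra.smul_def]
      rfl
  exact ⟨toConv Φ, fun g ↦ Pts.ext_apply fun a ↦ hΦ g a⟩

variable (H) in
/-- Points over `R`, as points over `B ⊗ R`. -/
abbrev inclPts (B : Type u) [Field B] [Algebra K B] (R : Type u) [CommRing R] [Algebra K R] :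
    Pts K H R →* Pts K H (B ⊗[K] R) :=
  Pts.map (Algebra.TensorProduct.includeRight : R →ₐ[K] B ⊗[K] R)

omit [Group G] in
theorem exists_incl_point_of_hasFiniteSpan (B : Type u) [Field B] [Algebra K B] (c : G → Pts K H R)
    (hc : ∀ a, HasFiniteSpan (K := K) fun g ↦ c g a) :
    ∃ C : Pts K H ((G → B) ⊗[K] R), ∀ g, Pts.map (evalFun K R B g) C = inclPts H B R (c g) := by
  obtain ⟨C, hC⟩ := exists_point_of_hasFiniteSpan c hc
  let ψ : (G → K) →ₐ[K] (G → B) := AlgHom.pi fun g ↦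
    (Algebra.ofId K B).comp (Pi.evalAlgHom K (fun _ : G ↦ K) g)
  refine ⟨Pts.map (Algebra.TensorProduct.map ψ (AlgHom.id K R)) C, fun g ↦
    Pts.ext_apply fun a ↦ ?_⟩
  have e : ∀ t : (G → K) ⊗[K] R, evalFun K R B g (Algebra.TensorProduct.map ψ (AlgHom.id K R) t) =
      (Algebra.linearMap K B).rTensor R
        ((LinearMap.proj g : (G → K) →ₗ[K] K).rTensor R t) := by
    intro t
    induction t with
    | zero => simp
    | tmul f r => rfl
    | add s t hs ht => simp only [map_add, hs, ht]
  change evalFun K R B g (Algebra.TensorProduct.map ψ (AlgHom.id K R) (C a)) = 1 ⊗ₜ c g a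
  rw [e, hC]
  simp

variable {R' : Type u} [CommRing R'] [Algebra K R']

variable (K B) in
/-- Base change of coefficients `B ⊗ R → B ⊗ R'`. -/
abbrev baseHom (f : R →ₐ[K] R') : B ⊗[K] R →ₐ[K] B ⊗[K] R' :=
  Algebra.TensorProduct.map (AlgHom.id K B) f

theorem map_baseHom_inclPts (f : R →ₐ[K] R') (x : Pts K H R) :
    Pts.map (baseHom K B f) (inclPts H B R x) = inclPts H B R' (Pts.map f x) :=
  Pts.ext_apply fun a ↦ by simp [baseHom]

theorem map_baseHom_ptsAct (f : R →ₐ[K] R') (g : G) (x : Pts K H (B ⊗[K] R)) :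
    Pts.map (baseHom K B f) (ptsAct α (tensorAct σ R) g x) =
      ptsAct α (tensorAct σ R') g (Pts.map (baseHom K B f) x) := by
  refine map_ptsAct α _ (fun t ↦ ?_) x
  induction t with
  | zero => simp
  | tmul b r => rfl
  | add s t hs ht => simp only [map_add, hs, ht]

variable {H' : Type u} [CommRing H'] [HopfAlgebra K H'] (α' : HopfAction G K H')

theorem res_ptsAct {S : Type*} [CommRing S] [Algebra K S] {φ : H' →ₐc[K] H}
    (hφ : ∀ g a, φ (α'.toHom g a) = α.toHom g (φ a)) (τ : G →* (S ≃ₐ[K] S)) (g : G)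
    (x : Pts K H S) : Pts.res φ (ptsAct α τ g x) = ptsAct α' τ g (Pts.res φ x) :=
  Pts.ext_apply fun a ↦ by
    rw [Pts.res_apply, ptsAct_apply, ptsAct_apply, Pts.res_apply, hφ]

end Orbit

/-! ### Closedness of the locus where a cocycle becomes trivial over B. -/

section TrivialLocus

variable {K B : Type u} [Field K] {G : Type v} [Group G] [Field B] [Algebra K B]
  (σ : G →* (B ≃ₐ[K] B))

/-- A cocycle with values in `U(X)` becomes trivial over `B` on a closed subscheme of `Spec X`. -/
def TrivialLocusClosed {H : Type u} [CommRing H] [HopfAlgebra K H] (α : HopfAction G K H) : Prop :=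
  ∀ (X : Type u) [CommRing X] [Algebra K X] (c : G → Pts K H X),
    (∀ a, HasFiniteSpan (K := K) fun g ↦ c g a) →
    ∃ J : Ideal X, ∀ (R : Type u) [CommRing R] [Algebra K R] (f : X →ₐ[K] R),
      (∃ b : Pts K H (B ⊗[K] R), ∀ g, b * inclPts H B R (Pts.map f (c g)) *
        ptsAct α (tensorAct σ R) g b⁻¹ = 1) ↔ ∀ a ∈ J, f a = 0

variable {H H' : Type u} [CommRing H] [HopfAlgebra K H] [CommRing H'] [HopfAlgebra K H']
  {α : HopfAction G K H} {α' : HopfAction G K H'} {φ : H' →ₐc[K] H} [CharZero K]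

/-- Solving `g(h) = h z_g` is a linear problem for the logarithms, if the values of `z` are
central. -/
theorem exists_coboundary_iff (hH : IsConilpotent K H) [Algebra.FiniteType K H]
    {R : Type u} [CommRing R] [Algebra K R]
    (z : G → Pts K H (B ⊗[K] R)) (hz : ∀ g x, x * z g = z g * x)
    (o : Cot (⊥ : Submodule K H) →ₗ[K] (G → B) ⊗[K] R)
    (ho : ∀ g, z g = expCot hH ((evalFun K R B g).toLinearMap ∘ₗ o))
    (hbot : ∀ g, ∀ a ∈ (⊥ : Submodule K H), α.toHom g a ∈ (⊥ : Submodule K H)) :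
    (∃ h, ∀ g, ptsAct α (tensorAct σ R) g h = h * z g) ↔
      ∃ l, homBase R (orbitDiff (fun g ↦ (σ g).toLinearMap) LinearMap.id
        (fun g : G ↦ cotAct α hbot g⁻¹)) l = o := by
  have key : ∀ l : Cot (⊥ : Submodule K H) →ₗ[K] B ⊗[K] R,
      (∀ g, ptsAct α (tensorAct σ R) g (expCot hH l) = expCot hH l * z g) ↔
      homBase R (orbitDiff (fun g ↦ (σ g).toLinearMap) LinearMap.id
        (fun g : G ↦ cotAct α hbot g⁻¹)) l = o := by
    intro l
    -- The point h is arbitrary, but z_g commutes with it, so log(h z_g) = log h + log z_g and the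
    -- equation is linear in l = log h.
    have e1 : ∀ g, (ptsAct α (tensorAct σ R) g (expCot hH l) = expCot hH l * z g) ↔
        ∀ v, (σ g).toLinearMap.rTensor R (l (cotAct α hbot g⁻¹ v)) - l v =
          evalFun K R B g (o v) := by
      intro g
      rw [ptsAct_expCot hH α hbot, eq_comm, eq_expCot_iff]
      constructor
      · intro h v
        obtain ⟨a, rfl⟩ := (cotKer (⊥ : Submodule K H)).mkQ_surjective v
        have := h a
        rw [logPt_mul hH (hz g _), logPt_expCot, ho, logPt_expCot] at this
        rw [sub_eq_iff_eq_add', ← tensorAct_apply']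
        exact this.symm
      · intro h a
        rw [logPt_mul hH (hz g _), logPt_expCot, ho, logPt_expCot]
        have := h ((cotKer (⊥ : Submodule K H)).mkQ a)
        rw [sub_eq_iff_eq_add', ← tensorAct_apply'] at this
        exact this.symm
    simp only [e1]
    constructor
    · intro h
      refine LinearMap.ext fun v ↦ ?_
      refine eq_of_proj_rTensor fun g ↦ ?_
      rw [proj_orbitDiff, ← evalFun_apply, ← h g v, LinearMap.rTensor_id, LinearMap.id_apply]
    · rintro rfl g v
      rw [evalFun_apply, proj_orbitDiff, LinearMap.rTensor_id, LinearMap.id_apply]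
  constructor
  · rintro ⟨h, hh⟩
    obtain ⟨l, rfl⟩ := exists_expCot_bot hH h
    exact ⟨l, (key l).mp hh⟩
  · rintro ⟨l, hl⟩
    exact ⟨_, (key l).mpr hl⟩

/-- On the closed locus where the image in U' is trivial, lift a trivialisation to b. Twisting by b
makes the cocycle central-valued, and triviality becomes a linear system for log h, solvable on a
smaller closed subscheme. -/
theorem TrivialLocusClosed.step (hH : IsConilpotent K H) [Algebra.FiniteType K H]
    (hφ : Function.Injective φ) (hφα : ∀ g a, φ (α'.toHom g a) = α.toHom g (φ a))
    (hα : ∀ a, HasFiniteSpan (K := K) fun g ↦ α.toHom g⁻¹ a)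
    (hc : ∀ (S : Type u) [CommRing S] [Algebra K S] (x y : Pts K H S), Pts.res φ y = 1 →
      x * y = y * x)
    (ih : TrivialLocusClosed σ α') : TrivialLocusClosed σ α := by
  intro X _ _ c hfs
  obtain ⟨J', hJ'⟩ := ih X (fun g ↦ Pts.res φ (c g)) fun a ↦ hfs (φ a)
  -- Every algebra over which the image becomes trivial is an algebra over X/J', so one
  -- trivialisation there serves them all.
  obtain ⟨b', hb'⟩ := (hJ' (X ⧸ J') (Ideal.Quotient.mkₐ K J')).mpr fun a ha ↦
    Ideal.Quotient.eq_zero_iff_mem.mpr ha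
  obtain ⟨b, rfl⟩ := Pts.res_surjective hH φ hφ b'
  obtain ⟨C, hC⟩ := exists_incl_point_of_hasFiniteSpan B c hfs
  obtain ⟨Y, hY⟩ := exists_orbit_point α σ hα b
  let mk := Ideal.Quotient.mkₐ K J'
  -- The family g ↦ b c_g g(b)⁻¹ as a single point, whose logarithm o is the right-hand side of the
  -- linear system.
  let Z : Pts K H ((G → B) ⊗[K] (X ⧸ J')) := Pts.map (constFun K B _ G) b *
    Pts.map (Algebra.TensorProduct.map (AlgHom.id K (G → B)) mk) C * Y⁻¹
  have hevmap : ∀ {R R' : Type u} [CommRing R] [Algebra K R] [CommRing R'] [Algebra K R']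
      (f : R →ₐ[K] R') (g : G) (y : Pts K H ((G → B) ⊗[K] R)), Pts.map (evalFun K R' B g)
        (Pts.map (Algebra.TensorProduct.map (AlgHom.id K (G → B)) f) y) =
        Pts.map (baseHom K B f) (Pts.map (evalFun K R B g) y) := fun f g y ↦
    Pts.ext_apply fun a ↦ evalFun_map f g (y a)
  have hZ : ∀ g, Pts.map (evalFun K _ B g) Z =
      b * inclPts H B _ (Pts.map mk (c g)) * ptsAct α (tensorAct σ _) g b⁻¹ := by
    intro g
    rw [map_mul, map_mul, map_inv, hevmap, hY, hC, map_baseHom_inclPts, map_inv]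
    congr 3
    exact Pts.ext_apply fun a ↦ evalFun_constFun g (b a)
  have hresZ : ∀ g, Pts.res φ (Pts.map (evalFun K _ B g) Z) = 1 := by
    intro g
    rw [hZ, ← hb' g, map_mul, map_mul, res_ptsAct α α' hφα, map_inv]
    rfl
  obtain ⟨o, ho⟩ := exists_expCot_bot hH Z
  have hbot : ∀ g, ∀ a ∈ (⊥ : Submodule K H), α.toHom g a ∈ (⊥ : Submodule K H) := by
    rintro g a ha
    rw [Submodule.mem_bot] at ha ⊢
    rw [ha, map_zero]
  obtain ⟨J'', hJ''⟩ := exists_obstruction_ideal_hom (orbitDiff (fun g ↦ (σ g).toLinearMap)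
    LinearMap.id (fun g : G ↦ cotAct α hbot g⁻¹)) o
  have hle : J' ≤ J''.comap mk := fun a ha ↦ by
    have : mk a = 0 := Ideal.Quotient.eq_zero_iff_mem.mpr ha
    rw [Ideal.mem_comap, this]
    exact J''.zero_mem
  -- over the locus where the image in `U'` is trivial, triviality is a linear condition
  have main : ∀ (R : Type u) [CommRing R] [Algebra K R] (f : X ⧸ J' →ₐ[K] R),
      (∃ h : Pts K H (B ⊗[K] R), ∀ g, h * inclPts H B R (Pts.map (f.comp mk) (c g)) *
        ptsAct α (tensorAct σ R) g h⁻¹ = 1) ↔ ∀ a ∈ J'', f a = 0 := by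
    intro R _ _ f
    rw [← hJ'' R f]
    let z : G → Pts K H (B ⊗[K] R) := fun g ↦
      Pts.map (baseHom K B f) (Pts.map (evalFun K _ B g) Z)
    have hzc : ∀ g x, x * z g = z g * x := fun g x ↦ hc _ _ _ (by
      rw [Pts.res_map, hresZ, map_one])
    have hz : ∀ g, z g = Pts.map (baseHom K B f) b * inclPts H B R (Pts.map (f.comp mk) (c g)) *
        (ptsAct α (tensorAct σ R) g (Pts.map (baseHom K B f) b))⁻¹ := by
      intro g
      change Pts.map _ (Pts.map _ Z) = _
      rw [hZ, map_mul, map_mul, map_baseHom_inclPts, map_baseHom_ptsAct, map_inv, map_inv]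
      rfl
    have hzo : ∀ g, z g = expCot hH ((evalFun K R B g).toLinearMap ∘ₗ
        (f.toLinearMap.lTensor (G → B) ∘ₗ o)) := by
      intro g
      change Pts.map _ (Pts.map _ Z) = _
      rw [ho, map_expCot, map_expCot]
      congr 1
      refine LinearMap.ext fun v ↦ ?_
      exact (evalFun_map f g (o v)).symm
    rw [← exists_coboundary_iff σ hH z hzc _ hzo hbot]
    -- Since z_g = b₀ c_g g(b₀)⁻¹, the point h trivialises c exactly when h' = h b₀⁻¹ satisfies
    -- g(h') = h' z_g.
    set b₀ := Pts.map (baseHom K B f) b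
    constructor
    · rintro ⟨h, hh⟩
      refine ⟨h * b₀⁻¹, fun g ↦ ?_⟩
      have := hh g
      rw [map_inv, mul_inv_eq_one] at this
      rw [hz, map_mul, map_inv, ← this]
      group
    · rintro ⟨h, hh⟩
      refine ⟨h * b₀, fun g ↦ ?_⟩
      have := hh g
      rw [map_inv, mul_inv_eq_one, map_mul, this, hz]
      group
  refine ⟨J''.comap mk, fun R _ _ f ↦ ?_⟩
  constructor
  · rintro ⟨h, hh⟩
    have hf : ∀ a ∈ J', f a = 0 := by
      refine (hJ' R f).mp ⟨Pts.res φ h, fun g ↦ ?_⟩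
      have := congrArg (Pts.res φ) (hh g)
      rwa [map_mul, map_mul, res_ptsAct α α' hφα, map_inv, map_one] at this
    have := (main R (Ideal.Quotient.liftₐ J' f hf)).mp ⟨h, by
      have e : (Ideal.Quotient.liftₐ J' f hf).comp mk = f := Ideal.Quotient.liftₐ_comp J' f hf
      rw [e]
      exact hh⟩
    exact fun a ha ↦ this (mk a) ha
  · intro h
    have hf : ∀ a ∈ J', f a = 0 := fun a ha ↦ h a (hle ha)
    obtain ⟨h', hh'⟩ := (main R (Ideal.Quotient.liftₐ J' f hf)).mpr fun a ha ↦ by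
      obtain ⟨a, rfl⟩ := Ideal.Quotient.mkₐ_surjective K J' a
      exact h a ha
    have e : (Ideal.Quotient.liftₐ J' f hf).comp mk = f := Ideal.Quotient.liftₐ_comp J' f hf
    rw [e] at hh'
    exact ⟨h', hh'⟩

end TrivialLocus

/-! ### Continuous maps from a compact space to an inductive limit space. -/

section InductiveTopology

variable {k : Type*} [Field k] [TopologicalSpace k] {M : Type*} [AddCommGroup M] [Module k M]
  {M' : Type*} [AddCommGroup M'] [Module k M']

/-- The function `f` is a combination of finitely many vectors with continuous coefficients. -/
def IsContComb (k : Type*) [Field k] [TopologicalSpace k] {X M : Type*} [TopologicalSpace X]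
    [AddCommGroup M] [Module k M] (f : X → M) : Prop :=
  ∃ (n : ℕ) (c : Fin n → X → k) (b : Fin n → M), (∀ i, Continuous (c i)) ∧
    ∀ x, f x = ∑ i, c i x • b i

variable {X : Type*} [TopologicalSpace X]

theorem IsContComb.hasFiniteSpan {f : X → M} (h : IsContComb k f) : HasFiniteSpan (K := k) f := by
  obtain ⟨n, c, b, -, h⟩ := h
  exact ⟨n, c, b, h⟩

theorem IsContComb.map {f : X → M} (h : IsContComb k f) (l : M →ₗ[k] M') :
    IsContComb k fun x ↦ l (f x) := by
  obtain ⟨n, c, b, hc, h⟩ := h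
  exact ⟨n, c, fun i ↦ l (b i), hc, fun x ↦ by simp [h]⟩

theorem IsContComb.comp {Y : Type*} [TopologicalSpace Y] {f : X → M} (h : IsContComb k f)
    {u : Y → X} (hu : Continuous u) : IsContComb k fun y ↦ f (u y) := by
  obtain ⟨n, c, b, hc, h⟩ := h
  exact ⟨n, fun i y ↦ c i (u y), b, fun i ↦ (hc i).comp hu, fun y ↦ h _⟩

theorem continuous_comb {n : ℕ} (b : Fin n → M) :
    Continuous[inferInstance, indTopology k M] fun c : Fin n → k ↦ ∑ i, c i • b i :=
  continuous_iff_coinduced_le.mpr (le_iSup₂_of_le (f := fun (m : ℕ) (w : Fin m → M) ↦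
    TopologicalSpace.coinduced (fun c : Fin m → k ↦ ∑ i, c i • w i) inferInstance) n b le_rfl)

theorem IsContComb.continuous {f : X → M} (h : IsContComb k f) :
    Continuous[inferInstance, indTopology k M] f := by
  obtain ⟨n, c, b, hc, h⟩ := h
  obtain rfl : f = _ := funext h
  let _ := indTopology k M
  exact (continuous_comb b).comp (continuous_pi hc)

theorem continuous_functional_indTopology [IsTopologicalRing k] (l : M →ₗ[k] k) :
    Continuous[indTopology k M, inferInstance] l := by
  refine continuous_iSup_dom.mpr fun m ↦ continuous_iSup_dom.mpr fun w ↦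
    continuous_coinduced_dom.mpr ?_
  have : (l ∘ fun c : Fin m → k ↦ ∑ i, c i • w i) = fun c ↦ ∑ i, c i * l (w i) := by
    ext c
    simp
  rw [this]
  fun_prop

variable [IsTopologicalRing k] [T2Space k]

theorem isClosed_singleton_indTopology (p : M) : IsClosed[indTopology k M] {p} := by
  have : ({p} : Set M) = ⋂ l : M →ₗ[k] k, l ⁻¹' {l p} := by
    ext x
    simp only [Set.mem_singleton_iff, Set.mem_iInter, Set.mem_preimage]
    exact ⟨fun h l ↦ by rw [h], fun h ↦ sub_eq_zero.mp
      ((Module.forall_dual_apply_eq_zero_iff k (x - p)).mp fun l ↦ by rw [map_sub, h, sub_self])⟩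
  rw [this]
  let _ := indTopology k M
  exact isClosed_iInter fun l ↦ isClosed_singleton.preimage (continuous_functional_indTopology l)

/-- An independent set meets each finite-dimensional subspace in a finite set, and points are closed
because continuous functionals separate them. -/
theorem isClosed_of_linearIndependent {s : Set M} (hs : LinearIndependent k ((↑) : s → M)) :
    IsClosed[indTopology k M] s := by
  refine isClosed_iSup_iff.mpr fun m ↦ isClosed_iSup_iff.mpr fun w ↦ isClosed_coinduced.mpr ?_
  have hfin : (s ∩ Submodule.span k (Set.range w) : Set M).Finite := by
    have : LinearIndependent k ((↑) : (s ∩ Submodule.span k (Set.range w) : Set M) → M) :=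
      LinearIndepOn.mono (v := id) hs Set.inter_subset_left
    have h2 : LinearIndependent k (fun x : (s ∩ Submodule.span k (Set.range w) : Set M) ↦
        (⟨x, x.2.2⟩ : Submodule.span k (Set.range w))) :=
      LinearIndependent.of_comp (Submodule.span k (Set.range w)).subtype this
    have : Module.Finite k (Submodule.span k (Set.range w)) :=
      Module.Finite.span_of_finite k (Set.finite_range w)
    have := h2.finite
    exact Set.toFinite _
  have e : (fun c : Fin m → k ↦ ∑ i, c i • w i) ⁻¹' s =
      ⋃ p ∈ (s ∩ Submodule.span k (Set.range w) : Set M),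
        (fun c : Fin m → k ↦ ∑ i, c i • w i) ⁻¹' {p} := by
    ext c
    simp only [Set.mem_preimage, Set.mem_iUnion, Set.mem_singleton_iff, exists_prop,
      exists_eq_right', Set.mem_inter_iff]
    exact ⟨fun h ↦ ⟨h, Submodule.sum_mem _ fun i _ ↦ Submodule.smul_mem _ _
      (Submodule.subset_span ⟨i, rfl⟩)⟩, fun h ↦ h.1⟩
  rw [e]
  refine hfin.isClosed_biUnion fun p _ ↦ ?_
  exact @IsClosed.preimage _ _ _ (indTopology k M) _ (continuous_comb w) _
    (isClosed_singleton_indTopology p)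

/-- Take a basis of the span inside the image. It and all its subsets are closed, so it is compact
and discrete, hence finite. The coefficients are linear functionals extended to M, which are
automatically continuous. -/
theorem isContComb_of_continuous [CompactSpace X] {f : X → M}
    (hf : Continuous[inferInstance, indTopology k M] f) : IsContComb k f := by
  obtain ⟨s, hs, hspan, hli⟩ := exists_linearIndependent k (Set.range f)
  have hfin : s.Finite := by
    let _ := indTopology k M
    have hc : IsCompact s := (isCompact_range hf).of_isClosed_subset
      (isClosed_of_linearIndependent hli) hs
    refine hc.finite (isDiscrete_iff_discreteTopology.mpr
      (discreteTopology_iff_forall_isClosed.mpr fun t ↦ ?_))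
    have ht : LinearIndependent k ((↑) : ((↑) '' t : Set M) → M) :=
      LinearIndepOn.mono (v := id) hli (by rintro _ ⟨x, -, rfl⟩; exact x.2)
    have := (isClosed_of_linearIndependent ht).preimage (continuous_subtype_val (p := (· ∈ s)))
    rwa [Set.preimage_image_eq _ Subtype.val_injective] at this
  let V := Submodule.span k (Set.range f)
  have : Module.Finite k V := by
    change Module.Finite k (Submodule.span k (Set.range f))
    rw [← hspan]
    exact Module.Finite.span_of_finite k hfin
  let b := Module.finBasis k V
  choose l hl using fun i ↦ LinearMap.exists_extend (b.coord i)
  refine ⟨_, fun i x ↦ l i (f x), fun i ↦ b i, fun i ↦ @Continuous.comp _ _ _ _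
    (indTopology k M) _ _ _ (continuous_functional_indTopology (l i)) hf, fun x ↦ ?_⟩
  have hx : f x ∈ V := Submodule.subset_span ⟨x, rfl⟩
  have := congrArg Subtype.val (b.sum_repr ⟨f x, hx⟩)
  rw [Submodule.coe_sum] at this
  refine this.symm.trans (Finset.sum_congr rfl fun i _ ↦ ?_)
  change b.coord i ⟨f x, hx⟩ • (b i : M) = _
  rw [← hl i]
  rfl

end InductiveTopology

/-! ### Continuity of families of points, coordinate by coordinate. -/

section PointsTopology

variable {k : Type*} [Field k] [TopologicalSpace k] [IsTopologicalRing k] [T2Space k]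
  {X : Type*} [TopologicalSpace X] [CompactSpace X] {K : Type*} [Field K] {H : Type*} [CommRing H]
  [HopfAlgebra K H] {S : Type*} [CommRing S] [Algebra K S] [Module k S]

/-- Compactness gives the forward direction. Conversely, the combinations for finitely many
coordinates are concatenated into one combination in the product space. -/
theorem continuous_pts_iff {c : X → Pts K H S} :
    Continuous[inferInstance, ptsTopology k K H S] c ↔ ∀ a, IsContComb k fun x ↦ c x a := by
  constructor
  · intro h a
    have h1 := continuous_induced_rng.mp (continuous_iInf_rng.mp (continuous_iInf_rng.mp h 1)
      fun _ ↦ a)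
    exact (isContComb_of_continuous h1).map (LinearMap.proj (0 : Fin 1))
  · intro h
    refine continuous_iInf_rng.mpr fun m ↦ continuous_iInf_rng.mpr fun e ↦
      continuous_induced_rng.mpr (IsContComb.continuous ?_)
    choose n φ b hφ hb using fun i ↦ h (e i)
    let E := finSigmaFinEquiv (n := n)
    refine ⟨_, fun j ↦ φ (E.symm j).1 (E.symm j).2,
      fun j ↦ Pi.single (E.symm j).1 (b _ (E.symm j).2), fun j ↦ hφ _ _, fun x ↦ ?_⟩
    rw [← E.sum_comp, Fintype.sum_sigma]
    ext i
    simp only [Finset.sum_apply, Pi.smul_apply]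
    rw [Finset.sum_eq_single i]
    · refine (hb i x).trans (Finset.sum_congr rfl fun l _ ↦ ?_)
      rw [E.symm_apply_apply, Pi.single_eq_same]
    · intro j _ hj
      exact Finset.sum_eq_zero fun l _ ↦ by
        rw [E.symm_apply_apply, Pi.single_eq_of_ne hj.symm, smul_zero]
    · simp

end PointsTopology

/-! ### Finiteness of the action on the coordinate ring of U_n. -/

section ActionTopology

variable {K A : Type u} [Field K] [TopologicalSpace K] [IsTopologicalRing K] [T2Space K]
  {G : Type v} [Group G] [TopologicalSpace G] [IsTopologicalGroup G] [CompactSpace G]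
  [CommRing A] [HopfAlgebra K A] {α : HopfAction G K A}

/-- The orbit in A is a finite combination with vectors in A; a linear retraction onto the
coordinate ring of U_n moves these vectors into it without changing the orbit. -/
theorem isContComb_quot (hα : Continuous[instTopologicalSpaceProd (t₂ := indTopology K A),
    indTopology K A] fun p : G × A ↦ α.toHom p.1 p.2) (n : ℕ) (a : lcsQuot K A n) :
    IsContComb K fun g ↦ (α.quot n).toHom g⁻¹ a := by
  have h1 : Continuous[inferInstance, indTopology K A] fun g ↦ α.toHom g (a : A) := by
    let _ := indTopology K A
    exact hα.comp (continuous_id.prodMk continuous_const)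
  obtain ⟨l, hl⟩ := (lcsQuot K A n).val.toLinearMap.exists_leftInverse_of_injective
    (LinearMap.ker_eq_bot.mpr Subtype.val_injective)
  have h2 := ((isContComb_of_continuous h1).comp continuous_inv).map l
  have e : (fun g ↦ l (α.toHom g⁻¹ (a : A))) = fun g ↦ (α.quot n).toHom g⁻¹ a :=
    funext fun g ↦ congr($hl ((α.quot n).toHom g⁻¹ a))
  rwa [e] at h2

end ActionTopology

/-! ### Closed trivial locus for every U_n. -/

section TrivialLocusLcs

variable {K A B : Type u} [Field K] [CharZero K] {G : Type v} [Group G] [Field B] [Algebra K B]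
  [CommRing A] [HopfAlgebra K A] {α : HopfAction G K A} (σ : G →* (B ≃ₐ[K] B))

theorem trivialLocusClosed_quot (hA : IsConilpotent K A)
    (hfg : ∀ n, Algebra.FiniteType K (lcsQuot K A n))
    (hα : ∀ n (a : lcsQuot K A n), HasFiniteSpan (K := K) fun g ↦ (α.quot n).toHom g⁻¹ a) (n : ℕ) :
    TrivialLocusClosed σ (α.quot n) := by
  induction n with
  | zero =>
    intro X _ _ c _
    refine ⟨⊥, fun R _ _ f ↦ iff_of_true ⟨1, fun g ↦ lcsQuot_zero_pts _ _⟩ fun a ha ↦ ?_⟩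
    rw [Ideal.mem_bot.mp ha, map_zero]
  | succ n ih =>
    have := hfg (n + 1)
    exact ih.step σ (φ := lcsStep K A n) (lcsQuot_isConilpotent hA _) (lcsStep_injective n)
      (fun g a ↦ rfl) (hα _) (fun S _ _ x y hy ↦ commute_of_res_eq_one hA x y hy)

end TrivialLocusLcs

/-! ### From cocycles to classes: the closed subvariety H¹_f. -/

section TrivialClasses

open CategoryTheory

variable {K B : Type u} [Field K] [TopologicalSpace K] [IsTopologicalRing K] [T2Space K]
  {G : Type v} [Group G] [TopologicalSpace G] [CompactSpace G] [Field B] [TopologicalSpace B]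
  [Algebra K B] {σ : G →* (B ≃ₐ[K] B)} {H : Type u} [CommRing H] [HopfAlgebra K H]
  {α : HopfAction G K H}

omit [IsTopologicalRing K] [T2Space K] [CompactSpace G] in
theorem H1.toField_eq_basepoint_iff (hK : Continuous (algebraMap K B))
    (c : Cocycles K α (1 : G →* (K ≃ₐ[K] K))) :
    H1.toField α hK σ (Quotient.mk _ c) = H1.basepoint B α σ ↔
      ∃ b : Pts K H (B ⊗[K] K), ∀ g, b * inclPts H B K (c.1 g) *
        ptsAct α (tensorAct σ K) g b⁻¹ = 1 := by
  let e := Algebra.TensorProduct.rid K K B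
  let e' : B ⊗[K] K →ₐ[K] B := e
  have he : Function.Injective (Pts.map (A := H) e') := Pts.map_injective e.injective
  have hσ : ∀ g (s : B ⊗[K] K), e' (tensorAct σ K g s) = σ g (e' s) := by
    intro g s
    induction s with
    | zero => simp
    | tmul b r =>
      change e (σ g b ⊗ₜ r) = σ g (e (b ⊗ₜ r))
      simp [e]
    | add s t hs ht => simp only [map_add, hs, ht]
  have key : ∀ (b : Pts K H (B ⊗[K] K)) g, Pts.map e' (b * inclPts H B K (c.1 g) *
      ptsAct α (tensorAct σ K) g b⁻¹) = Pts.map e' b * Pts.map (Algebra.ofId K B) (c.1 g) *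
        ptsAct α σ g (Pts.map e' b)⁻¹ := by
    intro b g
    rw [map_mul, map_mul, map_ptsAct α e' (hσ g), map_inv (Pts.map e')]
    congr 2
    refine Pts.ext_apply fun a ↦ ?_
    change e (1 ⊗ₜ c.1 g a) = algebraMap K B (c.1 g a)
    simp [e, Algebra.smul_def]
  constructor
  · intro h
    obtain ⟨u, hu⟩ := Quotient.exact h
    have hsurj : Pts.map e' (Pts.map (e.symm : B →ₐ[K] B ⊗[K] K) u) = u :=
      Pts.ext_apply fun a ↦ e.apply_symm_apply _
    refine ⟨Pts.map (e.symm : B →ₐ[K] B ⊗[K] K) u, fun g ↦ he ?_⟩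
    rw [key, hsurj, map_one]
    exact (hu g).symm
  · rintro ⟨b, hb⟩
    refine Quotient.sound ⟨Pts.map e' b, fun g ↦ ?_⟩
    have := congrArg (Pts.map e') (hb g)
    rw [key, map_one] at this
    exact this.symm

/-- The image of a cocycle under a homomorphism of coefficient algebras. -/
def Cocycles.mapAlg {R R' : Type u} [CommRing R] [Algebra K R] [CommRing R'] [Algebra K R']
    (f : R →ₐ[K] R') (c : Cocycles K α (1 : G →* (R ≃ₐ[K] R))) :
    Cocycles K α (1 : G →* (R' ≃ₐ[K] R')) :=
  ⟨fun g ↦ Pts.map f (c.1 g), continuous_pts_iff.mpr fun a ↦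
    (continuous_pts_iff.mp c.2.1 a).map f.toLinearMap, fun g h ↦ by
      beta_reduce
      rw [c.2.2, map_mul, map_ptsAct α (σ' := (1 : G →* (R' ≃ₐ[K] R'))) f fun s ↦ rfl]⟩

theorem H1Functor_map_mk {R R' : CommAlgCat.{u} K} (f : R →ₐ[K] R')
    (c : Cocycles K α (1 : G →* (R ≃ₐ[K] R))) :
    (H1Functor α).map (CommAlgCat.ofHom f) (Quotient.mk _ c) =
      Quotient.mk (cocycleSetoid K α (1 : G →* (R' ≃ₐ[K] R'))) (c.mapAlg f) := rfl

/-- By Yoneda, the class attached to φ is the push-forward of the universal class, so the trivial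
locus of one cocycle representing the universal class is the required subvariety. -/
theorem TrivialLocusClosed.exists_ideal (h : TrivialLocusClosed σ α)
    (hK : Continuous (algebraMap K B)) {X : CommAlgCat.{u} K}
    (r : (H1Functor α).CorepresentableBy X) : ∃ J : Ideal X, ∀ φ : X →ₐ[K] K,
      (∀ a ∈ J, φ a = 0) ↔
        H1.toField α hK σ (r.homEquiv (CommAlgCat.ofHom φ)) = H1.basepoint B α σ := by
  obtain ⟨c, hc⟩ := Quotient.exists_rep (s := cocycleSetoid K α (1 : G →* (X ≃ₐ[K] X)))
    (r.homEquiv (𝟙 X))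
  obtain ⟨J, hJ⟩ := h X c.1 fun a ↦ (continuous_pts_iff.mp c.2.1 a).hasFiniteSpan
  refine ⟨J, fun φ ↦ ?_⟩
  have e : r.homEquiv (CommAlgCat.ofHom φ) = Quotient.mk _ (c.mapAlg φ) := by
    rw [r.homEquiv_eq, ← hc]
    exact H1Functor_map_mk (R' := CommAlgCat.of K K) φ c
  rw [← hJ K φ, e]
  exact (H1.toField_eq_basepoint_iff hK (c.mapAlg φ)).symm

end TrivialClasses

/-! ### Parametrising solutions of an affine-linear system modulo translations. -/

section Torsor

variable {K : Type u} [Field K]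

theorem homBase_lTensor {W W' : Type*} [AddCommGroup W] [Module K W] [Module.Finite K W]
    [AddCommGroup W'] [Module K W'] [Module.Finite K W'] {T T' : Type*} [AddCommGroup T]
    [Module K T] [AddCommGroup T'] [Module K T'] {R R' : Type*} [CommRing R] [Algebra K R]
    [CommRing R'] [Algebra K R'] (d : (W →ₗ[K] T) →ₗ[K] (W' →ₗ[K] T')) (f : R →ₐ[K] R')
    (l : W →ₗ[K] T ⊗[K] R) : homBase R' d (f.toLinearMap.lTensor T ∘ₗ l) =
      f.toLinearMap.lTensor T' ∘ₗ homBase R d l := by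
  obtain ⟨t, rfl⟩ := (homTensor K W T R).surjective l
  rw [lTensor_comp_homTensor, homBase_homTensor, homBase_homTensor, lTensor_comp_homTensor]
  have h1 := congr($(LinearMap.rTensor_comp_lTensor (f := d) (g := f.toLinearMap)) t)
  have h2 := congr($(LinearMap.lTensor_comp_rTensor (f := d) (g := f.toLinearMap)) t)
  rw [LinearMap.comp_apply] at h1 h2
  rw [h1, h2]

theorem lTensor_comp_lTensor_comp {R₁ R₂ R₃ : Type*} [CommRing R₁] [Algebra K R₁] [CommRing R₂]
    [Algebra K R₂] [CommRing R₃] [Algebra K R₃] (f : R₁ →ₐ[K] R₂) (g : R₂ →ₐ[K] R₃) {W T : Type*}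
    [AddCommGroup W] [Module K W] [AddCommGroup T] [Module K T] (l : W →ₗ[K] T ⊗[K] R₁) :
    g.toLinearMap.lTensor T ∘ₗ f.toLinearMap.lTensor T ∘ₗ l =
      (g.comp f).toLinearMap.lTensor T ∘ₗ l := by
  rw [← LinearMap.comp_assoc, ← LinearMap.lTensor_comp]
  rfl

/-- Solutions of an affine-linear system, up to a space of translations of finite codimension
in the space of solutions of the homogeneous system, are parametrized by an affine scheme. -/
theorem exists_torsor {W₀ W₁ W₂ : Type*} [AddCommGroup W₀] [Module K W₀]
    [Module.Finite K W₀] [AddCommGroup W₁] [Module K W₁] [Module.Finite K W₁] [AddCommGroup W₂]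
    [Module K W₂] [Module.Finite K W₂] {T₀ T₁ T₂ : Type*} [AddCommGroup T₀] [Module K T₀]
    [AddCommGroup T₁] [Module K T₁] [AddCommGroup T₂] [Module K T₂]
    (d₀ : (W₀ →ₗ[K] T₀) →ₗ[K] (W₁ →ₗ[K] T₁)) (d₁ : (W₁ →ₗ[K] T₁) →ₗ[K] (W₂ →ₗ[K] T₂))
    (h : ∀ l, d₁ (d₀ l) = 0)
    (hfin : Module.Finite K (LinearMap.ker d₁ ⧸
      (LinearMap.range d₀).comap (LinearMap.ker d₁).subtype))
    {P' : Type u} [CommRing P'] [Algebra K P'] [Algebra.FiniteType K P']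
    (o : W₂ →ₗ[K] T₂ ⊗[K] P') :
    ∃ (P : Type u) (_ : CommRing P) (_ : Algebra K P) (_ : Algebra.FiniteType K P)
      (ι : P' →ₐ[K] P) (l : W₁ →ₗ[K] T₁ ⊗[K] P),
      homBase P d₁ l = ι.toLinearMap.lTensor T₂ ∘ₗ o ∧
      ∀ (R : Type u) [CommRing R] [Algebra K R] (f : P' →ₐ[K] R) (m : W₁ →ₗ[K] T₁ ⊗[K] R),
        homBase R d₁ m = f.toLinearMap.lTensor T₂ ∘ₗ o →
        ∃! F : P →ₐ[K] R, F.comp ι = f ∧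
          ∃ n, m - F.toLinearMap.lTensor T₁ ∘ₗ l = homBase R d₀ n := by
  obtain ⟨J, hJ⟩ := exists_obstruction_ideal_hom d₁ o
  let mk := Ideal.Quotient.mkₐ K J
  -- J cuts out the locus where the system is solvable; a particular solution exists over the
  -- universal such algebra P'/J.
  obtain ⟨l₁, hl₁⟩ := (hJ (P' ⧸ J) mk).mpr fun a ha ↦ Ideal.Quotient.eq_zero_iff_mem.mpr ha
  obtain ⟨k, z, hz, H⟩ := exists_cohomology_basis_hom d₀ d₁ h hfin
  let C : P' ⧸ J →ₐ[K] MvPolynomial (Fin k) (P' ⧸ J) := IsScalarTower.toAlgHom K _ _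
  -- The polynomial variables are coordinates along cocycles z representing a basis of ker d₁ / im
  -- d₀; they are added to the particular solution.
  refine ⟨MvPolynomial (Fin k) (P' ⧸ J), inferInstance, inferInstance, inferInstance, C.comp mk,
    C.toLinearMap.lTensor T₁ ∘ₗ l₁ + ∑ j, homTmul (z j) (MvPolynomial.X j), ?_, ?_⟩
  · rw [map_add, homBase_lTensor, hl₁, lTensor_comp_lTensor_comp, map_sum]
    simp only [homBase_homTmul, hz]
    refine (add_eq_left.mpr (Finset.sum_eq_zero fun j _ ↦ ?_))
    ext w
    simp
  · intro R _ _ f m hm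
    have hf := (hJ R f).mp ⟨m, hm⟩
    let f₁ := Ideal.Quotient.liftₐ J f hf
    have e₁ : f₁.comp mk = f := Ideal.Quotient.liftₐ_comp J f hf
    have h0 : homBase R d₁ (m - f₁.toLinearMap.lTensor T₁ ∘ₗ l₁) = 0 := by
      rw [map_sub, hm, homBase_lTensor, hl₁, lTensor_comp_lTensor_comp, e₁, sub_self]
    have key : ∀ F : MvPolynomial (Fin k) (P' ⧸ J) →ₐ[K] R, F.comp C = f₁ →
        m - F.toLinearMap.lTensor T₁ ∘ₗ (C.toLinearMap.lTensor T₁ ∘ₗ l₁ +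
          ∑ j, homTmul (z j) (MvPolynomial.X j)) =
        m - f₁.toLinearMap.lTensor T₁ ∘ₗ l₁ - ∑ j, homTmul (z j) (F (MvPolynomial.X j)) := by
      intro F hF
      rw [LinearMap.comp_add, lTensor_comp_lTensor_comp, hF, sub_sub]
      congr 2
      ext w
      simp [LinearMap.sum_apply]
    have hf₁ : ∀ F : MvPolynomial (Fin k) (P' ⧸ J) →ₐ[K] R, F.comp (C.comp mk) = f →
        F.comp C = f₁ := by
      intro F hF
      refine Ideal.Quotient.algHom_ext K ?_
      change (F.comp C).comp mk = f₁.comp mk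
      rw [e₁, ← hF]
      rfl
    obtain ⟨r, hr, hr'⟩ := H R _ h0
    let F := MvPolynomial.aevalTower f₁ r
    have hFC : F.comp C = f₁ := by
      ext a
      exact MvPolynomial.aevalTower_C f₁ r _
    refine ⟨F, ⟨?_, ?_⟩, ?_⟩
    · rw [← AlgHom.comp_assoc, hFC, e₁]
    · rw [key F hFC]
      have : ∀ j, F (MvPolynomial.X j) = r j := fun j ↦ MvPolynomial.aevalTower_X f₁ r j
      simp only [this]
      exact hr
    · rintro F' ⟨h1, h2⟩
      have hFC' := hf₁ F' h1
      rw [key F' hFC'] at h2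
      have h3 := hr' _ h2
      refine MvPolynomial.algHom_ext' ((hFC'.trans hFC.symm)) fun j ↦ ?_
      rw [congrFun h3 j]
      exact (MvPolynomial.aevalTower_X f₁ r j).symm

end Torsor

/-! ### The central kernel as a vector group. -/

section Kernel

variable {K : Type*} [Field K] [CharZero K] {H H' : Type*} [CommRing H] [HopfAlgebra K H]
  [CommRing H'] [HopfAlgebra K H'] (φ : H' →ₐc[K] H) {S : Type*} [CommRing S] [Algebra K S]

omit [CharZero K] in
/-- The image of `H'` in `H`. -/
def imSub : Submodule K H := LinearMap.range ((φ : H' →ₐ[K] H).toLinearMap)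

variable {φ}

omit [CharZero K] in
theorem apply_mem_imSub (a : H') : φ a ∈ imSub φ := ⟨a, rfl⟩

theorem res_expCot (hH : IsConilpotent K H) (hH' : IsConilpotent K H')
    (l : Cot (imSub φ) →ₗ[K] S) : Pts.res φ (expCot hH l) = 1 := by
  refine logPt_injective hH' fun a ↦ ?_
  rw [logPt_res hH hH', logPt_expCot, logPt_one, Submodule.mkQ_apply,
    (Submodule.Quotient.mk_eq_zero _).mpr (le_cotKer (apply_mem_imSub a)), map_zero]

/-- By naturality the logarithm of a point of the kernel vanishes on the image of H', so it descends
to the relative cotangent space. -/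
theorem exists_expCot_of_res_eq_one (hH : IsConilpotent K H) (hH' : IsConilpotent K H')
    {x : Pts K H S} (hx : Pts.res φ x = 1) : ∃ l : Cot (imSub φ) →ₗ[K] S, x = expCot hH l := by
  refine exists_expCot hH ?_
  rintro _ ⟨a, rfl⟩
  change logPt hH x (φ a) = 0
  rw [← logPt_res hH hH', hx, logPt_one]

theorem expCot_add (hH : IsConilpotent K H) (hH' : IsConilpotent K H')
    (hc : ∀ x y : Pts K H S, Pts.res φ y = 1 → x * y = y * x) (l l' : Cot (imSub φ) →ₗ[K] S) :
    expCot hH (l + l') = expCot hH l * expCot hH l' :=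
  expCot_add_of_commute hH (hc _ _ (res_expCot hH hH' l'))

theorem expCot_neg (hH : IsConilpotent K H) (hH' : IsConilpotent K H')
    (hc : ∀ x y : Pts K H S, Pts.res φ y = 1 → x * y = y * x) (l : Cot (imSub φ) →ₗ[K] S) :
    expCot hH (-l) = (expCot hH l)⁻¹ := by
  rw [eq_inv_iff_mul_eq_one, ← expCot_add hH hH' hc, neg_add_cancel, expCot_zero]

omit [CharZero K] in
/-- Points with values in the image of an injective homomorphism of coefficients. -/
theorem Pts.exists_map_eq {S' : Type*} [CommRing S'] [Algebra K S'] (ι : S →ₐ[K] S')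
    (hι : Function.Injective ι) (y : Pts K H S') (hy : ∀ a, y a ∈ ι.range) :
    ∃ x, Pts.map ι x = y :=
  ⟨toConv (((AlgEquiv.ofInjective ι hι).symm : ι.range →ₐ[K] S).comp
    (y.ofConv.codRestrict ι.range hy)), Pts.ext_apply fun a ↦
      congrArg Subtype.val ((AlgEquiv.ofInjective ι hι).apply_symm_apply ⟨y a, hy a⟩)⟩

variable {G : Type*} [Group G] {α : HopfAction G K H} {α' : HopfAction G K H'}

omit [CharZero K] in
theorem imSub_stable (hφα : ∀ g a, φ (α'.toHom g a) = α.toHom g (φ a)) (g : G) :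
    ∀ a ∈ imSub φ, α.toHom g a ∈ imSub φ := by
  rintro _ ⟨a, rfl⟩
  exact ⟨α'.toHom g a, hφα g a⟩

end Kernel

/-! ### Rational points inside the points over B ⊗ R. -/

section RationalElements

variable {K B : Type u} [Field K] [Field B] [Algebra K B] {G : Type v}

variable (K B) in
/-- The quotient space `B / K`. -/
abbrev QuotScalars : Type u := B ⧸ LinearMap.range (Algebra.linearMap K B)

variable (K B) in
/-- The projection `B → B / K`. -/
abbrev quotScalars : B →ₗ[K] QuotScalars K B := (LinearMap.range (Algebra.linearMap K B)).mkQ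

theorem quotScalars_algebraMap (c : K) : quotScalars K B (algebraMap K B c) = 0 :=
  (Submodule.Quotient.mk_eq_zero (LinearMap.range (Algebra.linearMap K B))).mpr ⟨c, rfl⟩

variable {R : Type u} [CommRing R] [Algebra K R]

theorem rTensor_quotScalars_eq_zero_iff {t : B ⊗[K] R} :
    (quotScalars K B).rTensor R t = 0 ↔ ∃ r : R, (1 : B) ⊗ₜ[K] r = t := by
  have e : ∀ s : K ⊗[K] R, (Algebra.linearMap K B).rTensor R s =
      (1 : B) ⊗ₜ[K] TensorProduct.lid K R s := by
    intro s
    induction s with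
    | zero => simp
    | tmul c r => simp [Algebra.algebraMap_eq_smul_one, TensorProduct.smul_tmul]
    | add s t hs ht => simp only [map_add, TensorProduct.tmul_add, hs, ht]
  rw [← mem_range_rTensor_iff]
  constructor
  · rintro ⟨s, rfl⟩
    exact ⟨_, (e s).symm⟩
  · rintro ⟨r, rfl⟩
    exact ⟨1 ⊗ₜ r, by simp⟩

variable {W : Type*} [AddCommGroup W] [Module K W]

variable (K B W) in
/-- Extension of scalars of linear forms from `K` to `B`. -/
def scalarExt : (W →ₗ[K] K) →ₗ[K] (W →ₗ[K] B) := LinearMap.compRight K (Algebra.linearMap K B)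

theorem rTensor_quotScalars_comp_eq_zero_iff [Module.Finite K W] {l : W →ₗ[K] B ⊗[K] R} :
    (∀ v, (quotScalars K B).rTensor R (l v) = 0) ↔ ∃ n, l = homBase R (scalarExt K B W) n := by
  have e : ∀ n : W →ₗ[K] K ⊗[K] R,
      homBase R (scalarExt K B W) n = (Algebra.linearMap K B).rTensor R ∘ₗ n := by
    intro n
    induction n using homTensor_induction with
    | h0 => simp
    | h l r =>
      rw [homBase_homTmul]
      ext w
      rfl
    | ha l l' h h' => rw [map_add, h, h', LinearMap.comp_add]
  simp only [← mem_range_rTensor_iff, e]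
  have hinj : Function.Injective ((Algebra.linearMap K B).rTensor R) :=
    Module.Flat.rTensor_preserves_injective_linearMap _ (algebraMap K B).injective
  constructor
  · intro h
    refine ⟨(LinearEquiv.ofInjective _ hinj).symm.toLinearMap ∘ₗ l.codRestrict _ h, ?_⟩
    ext1 v
    exact congrArg Subtype.val
      ((LinearEquiv.ofInjective _ hinj).apply_symm_apply ⟨l v, h v⟩).symm
  · rintro ⟨n, rfl⟩ v
    exact ⟨n v, rfl⟩

/-- Exponential and logarithm are natural in the coefficients, so rationality of a point is
rationality of its logarithm. -/
theorem expCot_mem_ratPts_iff [CharZero K] {H : Type u} [CommRing H] [HopfAlgebra K H]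
    (hH : IsConilpotent K H) {N : Submodule K H} (l : Cot N →ₗ[K] B ⊗[K] R) :
    expCot hH l ∈ ratPts K H B R ↔ ∀ v, (quotScalars K B).rTensor R (l v) = 0 := by
  constructor
  · rintro ⟨y, hy⟩ v
    obtain ⟨a, rfl⟩ := (cotKer N).mkQ_surjective v
    rw [← logPt_expCot hH, ← hy, logPt_map]
    exact rTensor_quotScalars_eq_zero_iff.mpr ⟨_, rfl⟩
  · intro h
    let ι := (Algebra.TensorProduct.includeRight : R →ₐ[K] B ⊗[K] R)
    have hinj : Function.Injective ι :=
      Algebra.TensorProduct.includeRight_injective (algebraMap K B).injective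
    have h' : ∀ v, l v ∈ LinearMap.range ι.toLinearMap := fun v ↦
      rTensor_quotScalars_eq_zero_iff.mp (h v)
    refine ⟨expCot hH ((LinearEquiv.ofInjective ι.toLinearMap hinj).symm.toLinearMap ∘ₗ
      l.codRestrict _ h'), ?_⟩
    rw [map_expCot]
    congr 1
    refine LinearMap.ext fun v ↦ ?_
    exact congrArg Subtype.val
      ((LinearEquiv.ofInjective ι.toLinearMap hinj).apply_symm_apply ⟨l v, h' v⟩)

variable (K B G R) in
/-- The inclusion of functions with values in `K` into functions with values in `B`. -/
def scalarFun : (G → K) ⊗[K] R →ₐ[K] (G → B) ⊗[K] R :=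
  Algebra.TensorProduct.map (AlgHom.pi fun g ↦
    (Algebra.ofId K B).comp (Pi.evalAlgHom K (fun _ : G ↦ K) g)) (AlgHom.id K R)

theorem scalarFun_apply (t : (G → K) ⊗[K] R) : scalarFun K B G R t =
    ((Algebra.linearMap K B).compLeft G).rTensor R t := by
  induction t with
  | zero => simp
  | tmul f r => rfl
  | add s t hs ht => simp only [map_add, hs, ht]

theorem scalarFun_injective : Function.Injective (scalarFun K B G R) := by
  have : Function.Injective (((Algebra.linearMap K B).compLeft G).rTensor R) :=
    Module.Flat.rTensor_preserves_injective_linearMap _ fun f f' h ↦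
      funext fun g ↦ (algebraMap K B).injective (congrFun h g)
  intro s t h
  rw [scalarFun_apply, scalarFun_apply] at h
  exact this h

/-- Functions on G with values in K, B and B/K form an exact sequence, which stays exact after
tensoring with R; so rationality at each g is rationality of the family. -/
theorem mem_range_scalarFun {t : (G → B) ⊗[K] R}
    (h : ∀ g, (quotScalars K B).rTensor R (evalFun K R B g t) = 0) :
    t ∈ (scalarFun K B G R).range := by
  have hex : Function.Exact ((Algebra.linearMap K B).compLeft G)
      ((quotScalars K B).compLeft G) := by
    intro f
    constructor
    · intro hf
      choose c hc using fun g ↦ (Submodule.Quotient.mk_eq_zero _).mp (congrFun hf g)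
      exact ⟨c, funext hc⟩
    · rintro ⟨c, rfl⟩
      exact funext fun g ↦ (Submodule.Quotient.mk_eq_zero _).mpr ⟨c g, rfl⟩
  have h0 : ((quotScalars K B).compLeft G).rTensor R t = 0 := by
    refine eq_of_proj_rTensor fun g ↦ ?_
    rw [map_zero, ← h g]
    clear h
    induction t with
    | zero => simp
    | tmul f r => rfl
    | add s t hs ht => simp only [map_add, hs, ht]
  obtain ⟨s, hs⟩ := (Module.Flat.rTensor_exact R hex t).mp h0
  exact ⟨s, by rw [← hs]; exact scalarFun_apply s⟩

theorem map_evalFun_scalarFun_mem {H : Type u} [CommRing H] [HopfAlgebra K H]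
    (u : Pts K H ((G → K) ⊗[K] R)) (g : G) :
    Pts.map (evalFun K R B g) (Pts.map (scalarFun K B G R) u) ∈ ratPts K H B R := by
  let ev : (G → K) ⊗[K] R →ₐ[K] R := (Algebra.TensorProduct.lid K R).toAlgHom.comp
    (Algebra.TensorProduct.map (Pi.evalAlgHom K (fun _ : G ↦ K) g) (AlgHom.id K R))
  refine ⟨Pts.map ev u, Pts.ext_apply fun a ↦ ?_⟩
  change (1 : B) ⊗ₜ[K] ev (u a) = evalFun K R B g (scalarFun K B G R (u a))
  induction u a with
  | zero => simp
  | tmul f r =>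
    change (1 : B) ⊗ₜ[K] (f g • r) = algebraMap K B (f g) ⊗ₜ r
    rw [Algebra.algebraMap_eq_smul_one, TensorProduct.smul_tmul]
  | add s t hs ht => simp only [map_add, TensorProduct.tmul_add, hs, ht]

end RationalElements

/-! ### The obstruction to lifting a fixed class. -/

section RationalOrbits

variable {K B : Type u} [Field K] [Field B] [Algebra K B] {G : Type v} [Group G]
  (σ : G →* (B ≃ₐ[K] B)) {H H' : Type u} [CommRing H] [HopfAlgebra K H] [CommRing H']
  [HopfAlgebra K H'] (α : HopfAction G K H) (α' : HopfAction G K H') {φ : H' →ₐc[K] H}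
  {R : Type u} [CommRing R] [Algebra K R]

/-- The class of `x` in `U(B ⊗ R) / U(R)` is fixed by `G`. -/
def OrbitRational (x : Pts K H (B ⊗[K] R)) : Prop :=
  ∀ g, x⁻¹ * ptsAct α (tensorAct σ R) g x ∈ ratPts K H B R

/-- The difference between `g l` and `l` modulo `K`. -/
def quotDiff {W : Type*} [AddCommGroup W] [Module K W] (w : G → W →ₗ[K] W) :
    (W →ₗ[K] B) →ₗ[K] (W →ₗ[K] (G → QuotScalars K B)) :=
  orbitDiff (fun g ↦ quotScalars K B ∘ₗ (σ g).toLinearMap) (quotScalars K B) w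

theorem proj_quotDiff {W : Type*} [AddCommGroup W] [Module K W] [Module.Finite K W]
    (w : G → W →ₗ[K] W) (l : W →ₗ[K] B ⊗[K] R) (v : W) (g : G) :
    (LinearMap.proj g : (G → QuotScalars K B) →ₗ[K] QuotScalars K B).rTensor R
      (homBase R (quotDiff σ w) l v) =
      (quotScalars K B ∘ₗ (σ g).toLinearMap).rTensor R (l (w g v)) -
        (quotScalars K B).rTensor R (l v) := proj_orbitDiff _ _ w l v g

theorem quotDiff_scalarExt {W : Type*} [AddCommGroup W] [Module K W] (w : G → W →ₗ[K] W)
    (l : W →ₗ[K] K) : quotDiff σ w (scalarExt K B W l) = 0 := by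
  ext v g
  change quotScalars K B (σ g (algebraMap K B (l (w g v)))) - quotScalars K B (algebraMap K B (l v))
    = 0
  rw [AlgEquiv.commutes, quotScalars_algebraMap, quotScalars_algebraMap, sub_zero]

variable {α α'}

theorem OrbitRational.mul_ratPts {x y : Pts K H (B ⊗[K] R)} (hx : OrbitRational σ α x)
    (hy : y ∈ ratPts K H B R) : OrbitRational σ α (x * y) := by
  intro g
  have := mul_mem (mul_mem (inv_mem hy) (hx g)) (ptsAct_mem_ratPts α σ R g hy)
  rw [map_mul, mul_inv_rev]
  simpa only [mul_assoc] using this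

theorem OrbitRational.res (hφα : ∀ g a, φ (α'.toHom g a) = α.toHom g (φ a))
    {x : Pts K H (B ⊗[K] R)} (hx : OrbitRational σ α x) : OrbitRational σ α' (Pts.res φ x) := by
  intro g
  obtain ⟨y, hy⟩ := hx g
  refine ⟨Pts.res φ y, ?_⟩
  rw [← Pts.res_map, hy, map_mul, map_inv, res_ptsAct α α' hφα]

/-- Since x is fixed modulo rational points in U', the family x⁻¹ g(x) is a rational family times
central elements exp ω_g. Multiplying x by exp l adds g l - l to ω_g, so rationality is the linear
condition that ω_g + g l - l vanishes modulo K. -/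
theorem exists_rational_obstruction [CharZero K] [Algebra.FiniteType K H] (hH : IsConilpotent K H)
    (hH' : IsConilpotent K H') (hφ : Function.Injective φ)
    (hφα : ∀ g a, φ (α'.toHom g a) = α.toHom g (φ a))
    (hα : ∀ a, HasFiniteSpan (K := K) fun g ↦ α.toHom g⁻¹ a)
    (hc : ∀ (S : Type u) [CommRing S] [Algebra K S] (x y : Pts K H S), Pts.res φ y = 1 →
      x * y = y * x)
    {P : Type u} [CommRing P] [Algebra K P] {x : Pts K H (B ⊗[K] P)}
    (hx : OrbitRational σ α' (Pts.res φ x)) :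
    ∃ o : Cot (imSub φ) →ₗ[K] (G → QuotScalars K B) ⊗[K] P,
      ∀ (R : Type u) [CommRing R] [Algebra K R] (f : P →ₐ[K] R) (l : Cot (imSub φ) →ₗ[K] B ⊗[K] R),
        OrbitRational σ α (Pts.map (baseHom K B f) x * expCot hH l) ↔
          homBase R (quotDiff σ fun g ↦ cotAct α (imSub_stable hφα) g⁻¹) l =
            f.toLinearMap.lTensor _ ∘ₗ o := by
  obtain ⟨X, hX⟩ := exists_orbit_point α σ hα x
  let D := (Pts.map (constFun K B P G) x)⁻¹ * X
  have hD : ∀ g, Pts.map (evalFun K P B g) D = x⁻¹ * ptsAct α (tensorAct σ P) g x := by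
    intro g
    rw [map_mul, map_inv, hX]
    congr 2
    exact Pts.ext_apply fun a ↦ evalFun_constFun g (x a)
  -- The image of D in U' is rational for every g, hence is one point over (G → K) ⊗ P. Lifting that
  -- point to u extracts a rational factor from D for all g at once.
  obtain ⟨u', hu'⟩ := Pts.exists_map_eq (scalarFun K B G P) scalarFun_injective (Pts.res φ D)
    fun a ↦ mem_range_scalarFun fun g ↦ by
      obtain ⟨y, hy⟩ := hx g
      refine rTensor_quotScalars_eq_zero_iff.mpr ⟨y a, ?_⟩
      change inclPts H' B P y a = (Pts.res φ (Pts.map (evalFun K P B g) D)) a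
      rw [hD, map_mul, map_inv, res_ptsAct α α' hφα, ← hy]
  obtain ⟨u, rfl⟩ := Pts.res_surjective hH φ hφ u'
  obtain ⟨ω, hω⟩ := exists_expCot_of_res_eq_one (φ := φ) hH hH'
    (x := (Pts.map (scalarFun K B G P) u)⁻¹ * D) (by
      rw [map_mul, map_inv, Pts.res_map, hu', inv_mul_cancel])
  rw [inv_mul_eq_iff_eq_mul] at hω
  refine ⟨-(((quotScalars K B).compLeft G).rTensor P ∘ₗ ω), fun R _ _ f l ↦ ?_⟩
  set w : G → Cot (imSub φ) →ₗ[K] Cot (imSub φ) := fun g ↦ cotAct α (imSub_stable hφα) g⁻¹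
  have key : ∀ g, (Pts.map (baseHom K B f) x * expCot hH l)⁻¹ *
      ptsAct α (tensorAct σ R) g (Pts.map (baseHom K B f) x * expCot hH l) =
      Pts.map (baseHom K B f) (Pts.map (evalFun K P B g) (Pts.map (scalarFun K B G P) u)) *
        expCot hH ((baseHom K B f).toLinearMap ∘ₗ (evalFun K P B g).toLinearMap ∘ₗ ω +
          ((tensorAct σ R g).toLinearMap ∘ₗ l ∘ₗ w g + -l)) := by
    intro g
    rw [expCot_add hH hH' (hc _), expCot_add hH hH' (hc _), expCot_neg hH hH' (hc _),
      ← ptsAct_expCot, map_mul, ← map_baseHom_ptsAct, mul_inv_rev, ← map_expCot, ← map_expCot]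
    have h1 : ptsAct α (tensorAct σ P) g x = x * Pts.map (evalFun K P B g) D := by
      rw [hD, mul_inv_cancel_left]
    rw [h1, hω, map_mul, map_mul, map_mul]
    have h2 := hc _ ((Pts.map (baseHom K B f) (Pts.map (evalFun K P B g)
      (Pts.map (scalarFun K B G P) u)) * (Pts.map (baseHom K B f) (Pts.map (evalFun K P B g)
        (expCot hH ω)) * ptsAct α (tensorAct σ R) g (expCot hH l)))) (expCot hH l)⁻¹ (by
          rw [map_inv, res_expCot hH hH', inv_one])
    simp only [mul_assoc] at h2 ⊢
    rw [inv_mul_cancel_left, ← h2]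
  have hmem : ∀ g, (Pts.map (baseHom K B f) (Pts.map (evalFun K P B g)
      (Pts.map (scalarFun K B G P) u))) ∈ ratPts K H B R := by
    intro g
    obtain ⟨y, hy⟩ := map_evalFun_scalarFun_mem (B := B) u g
    exact ⟨Pts.map f y, by rw [← hy]; exact (map_baseHom_inclPts f y).symm⟩
  have e1 : OrbitRational σ α (Pts.map (baseHom K B f) x * expCot hH l) ↔
      ∀ g v, (quotScalars K B ∘ₗ (σ g).toLinearMap).rTensor R (l (w g v)) -
        (quotScalars K B).rTensor R (l v) =
        -(quotScalars K B).rTensor R (baseHom K B f (evalFun K P B g (ω v))) := by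
    refine forall_congr' fun g ↦ ?_
    rw [key, Subgroup.mul_mem_cancel_left _ (hmem g), expCot_mem_ratPts_iff]
    refine forall_congr' fun v ↦ ?_
    change (quotScalars K B).rTensor R (baseHom K B f (evalFun K P B g (ω v)) +
      (tensorAct σ R g (l (w g v)) + -l v)) = 0 ↔ _
    rw [map_add, map_add, map_neg, tensorAct_apply', ← LinearMap.comp_apply (LinearMap.rTensor _ _),
      ← LinearMap.rTensor_comp, add_comm, ← sub_eq_add_neg, add_eq_zero_iff_eq_neg]
  have e2 : ∀ g (t : (G → B) ⊗[K] P), (LinearMap.proj g : (G → QuotScalars K B) →ₗ[K] _).rTensor R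
      (f.toLinearMap.lTensor _ (((quotScalars K B).compLeft G).rTensor P t)) =
      (quotScalars K B).rTensor R (baseHom K B f (evalFun K P B g t)) := by
    intro g t
    induction t with
    | zero => simp
    | tmul b r => rfl
    | add s t hs ht => simp only [map_add, hs, ht]
  rw [e1]
  constructor
  · intro h
    refine LinearMap.ext fun v ↦ eq_of_proj_rTensor fun g ↦ ?_
    rw [proj_quotDiff, h g v, ← e2, ← map_neg, ← map_neg]
    rfl
  · intro h g v
    refine (proj_quotDiff σ w l v g).symm.trans ((congrArg _ congr($h v)).trans ?_)
    rw [← e2, ← map_neg, ← map_neg]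
    rfl

end RationalOrbits

/-! ### Finiteness of the cohomology of a three-term complex. -/

section FiniteCohomology

variable {K : Type*} [Field K] {L₀ L₁ L₂ : Type*} [AddCommGroup L₀] [Module K L₀]
  [AddCommGroup L₁] [Module K L₁] [AddCommGroup L₂] [Module K L₂]

/-- The cohomology `ker d₁ / im d₀` of a complex is finite-dimensional. -/
def FiniteCohomology (d₀ : L₀ →ₗ[K] L₁) (d₁ : L₁ →ₗ[K] L₂) : Prop :=
  Module.Finite K (LinearMap.ker d₁ ⧸ (LinearMap.range d₀).comap (LinearMap.ker d₁).subtype)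

end FiniteCohomology

/-! ### Representability of the invariants of U(B ⊗ R)/U(R). -/

section InvariantsRepresentable

variable {K B : Type u} [Field K] [Field B] [Algebra K B] {G : Type v} [Group G]
  (σ : G →* (B ≃ₐ[K] B)) {H H' : Type u} [CommRing H] [HopfAlgebra K H] [CommRing H']
  [HopfAlgebra K H'] {α : HopfAction G K H} {α' : HopfAction G K H'} {φ : H' →ₐc[K] H}

variable (α) in
/-- There is a universal `G`-fixed class in `U(B ⊗ P) / U(P)`, with `P` of finite type. -/
def HasUniversalOrbit : Prop :=
  ∃ (P : Type u) (_ : CommRing P) (_ : Algebra K P) (_ : Algebra.FiniteType K P)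
    (x : Pts K H (B ⊗[K] P)), OrbitRational σ α x ∧
      ∀ (R : Type u) [CommRing R] [Algebra K R] (z : Pts K H (B ⊗[K] R)), OrbitRational σ α z →
        ∃! f : P →ₐ[K] R, (Pts.map (baseHom K B f) x)⁻¹ * z ∈ ratPts K H B R

/-- Above a fixed class for U', the fixed classes for U are the solutions l of the obstruction
equation modulo forms with rational values, and these are parametrised by `exists_torsor`. -/
theorem HasUniversalOrbit.step [CharZero K] [Algebra.FiniteType K H] (hH : IsConilpotent K H)
    (hH' : IsConilpotent K H') (hφ : Function.Injective φ)
    (hφα : ∀ g a, φ (α'.toHom g a) = α.toHom g (φ a))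
    (hα : ∀ a, HasFiniteSpan (K := K) fun g ↦ α.toHom g⁻¹ a)
    (hc : ∀ (S : Type u) [CommRing S] [Algebra K S] (x y : Pts K H S), Pts.res φ y = 1 →
      x * y = y * x)
    (hfin : FiniteCohomology (scalarExt K B (Cot (imSub φ)))
      (quotDiff σ fun g ↦ cotAct α (imSub_stable hφα) g⁻¹))
    (ih : HasUniversalOrbit σ α') : HasUniversalOrbit σ α := by
  obtain ⟨P', _, _, _, x', hx', hu⟩ := ih
  obtain ⟨x, rfl⟩ := Pts.res_surjective hH φ hφ x'
  obtain ⟨o, ho⟩ := exists_rational_obstruction σ hH hH' hφ hφα hα hc hx'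
  obtain ⟨P, _, _, _, ι, l, hl, huniv⟩ := exists_torsor (scalarExt K B (Cot (imSub φ)))
    (quotDiff σ fun g ↦ cotAct α (imSub_stable hφα) g⁻¹) (quotDiff_scalarExt σ _) hfin o
  refine ⟨P, inferInstance, inferInstance, inferInstance,
    Pts.map (baseHom K B ι) x * expCot hH l, (ho P ι l).mpr hl, fun R _ _ z hz ↦ ?_⟩
  have hmapx : ∀ F : P →ₐ[K] R, Pts.map (baseHom K B F) (Pts.map (baseHom K B ι) x * expCot hH l) =
      Pts.map (baseHom K B (F.comp ι)) x * expCot hH (F.toLinearMap.lTensor B ∘ₗ l) := by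
    intro F
    rw [map_mul, map_expCot]
    congr 1
    refine Pts.ext_apply fun a ↦ ?_
    change baseHom K B F (baseHom K B ι (x a)) = baseHom K B (F.comp ι) (x a)
    rw [baseHom, baseHom, baseHom, ← AlgHom.comp_apply, ← Algebra.TensorProduct.map_comp]
    rfl
  -- The rational discrepancy ρ' in U' lifts to a rational ρ. Dividing z by ρ keeps its class and
  -- makes its image equal to that of x, so the two then differ by a central exp m.
  obtain ⟨f', ⟨ρ', hρ'⟩, hf'⟩ := hu R (Pts.res φ z) (hz.res σ hφα)
  obtain ⟨ρ, rfl⟩ := Pts.res_surjective hH φ hφ ρ'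
  have hρmem : inclPts H B R ρ ∈ ratPts K H B R := ⟨ρ, rfl⟩
  obtain ⟨m, hm⟩ := exists_expCot_of_res_eq_one (φ := φ) hH hH'
    (x := (Pts.map (baseHom K B f') x)⁻¹ * (z * (inclPts H B R ρ)⁻¹)) (by
      rw [map_mul, map_mul, map_inv, map_inv, Pts.res_map, Pts.res_map, hρ', mul_inv_rev, inv_inv,
        mul_inv_cancel_left, inv_mul_cancel])
  have hz' : z = Pts.map (baseHom K B f') x * expCot hH m * inclPts H B R ρ := by
    rw [← hm]
    group
  have hmo : homBase R (quotDiff σ fun g ↦ cotAct α (imSub_stable hφα) g⁻¹) m =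
      f'.toLinearMap.lTensor _ ∘ₗ o := by
    rw [← ho R f' m, ← hm, mul_inv_cancel_left]
    exact hz.mul_ratPts σ (inv_mem hρmem)
  refine (existsUnique_congr fun F ↦ ?_).mp (huniv R f' m hmo)
  have key : ∀ hF : F.comp ι = f', ((Pts.map (baseHom K B F) (Pts.map (baseHom K B ι) x *
      expCot hH l))⁻¹ * z ∈ ratPts K H B R ↔
      ∃ n, m - F.toLinearMap.lTensor B ∘ₗ l = homBase R (scalarExt K B _) n) := by
    intro hF
    rw [hmapx, hF, hz', ← rTensor_quotScalars_comp_eq_zero_iff, ← expCot_mem_ratPts_iff hH,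
      sub_eq_neg_add, expCot_add hH hH' (hc _), expCot_neg hH hH' (hc _), ← mul_assoc,
      Subgroup.mul_mem_cancel_right _ hρmem]
    congr! 1
    group
  constructor
  · rintro ⟨hF, h⟩
    exact (key hF).mpr h
  · intro h
    -- Equality of classes in U implies equality in U', where uniqueness of f' applies.
    have hF : F.comp ι = f' := by
      refine hf' _ ?_
      obtain ⟨y, hy⟩ := h
      refine ⟨Pts.res φ y, ?_⟩
      rw [← Pts.res_map, hy, hmapx, map_mul, map_inv, map_mul, res_expCot hH hH', mul_one]
      rfl
    exact ⟨hF, (key hF).mp h⟩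

open CategoryTheory

theorem HasUniversalOrbit.corepresentable (h : HasUniversalOrbit σ α) :
    ∃ X : CommAlgCat.{u} K, Algebra.FiniteType K X ∧
      Nonempty ((H0Functor α σ).CorepresentableBy X) := by
  obtain ⟨P, _, _, hP, x, hx, hu⟩ := h
  have hinv : ∀ (R : Type u) [CommRing R] [Algebra K R] (z : Pts K H (B ⊗[K] R)),
      (∀ g, quotientAct α σ R g (QuotientGroup.mk z) = QuotientGroup.mk z) ↔
        OrbitRational σ α z := fun R _ _ z ↦ forall_congr' fun g ↦
    eq_comm.trans (QuotientGroup.eq (s := ratPts K H B R) (a := z))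
  let ξ : (H0Functor α σ).obj (CommAlgCat.of K P) := ⟨QuotientGroup.mk x, (hinv P x).mpr hx⟩
  have key : ∀ (R : CommAlgCat.{u} K) (q : (H0Functor α σ).obj R),
      ∃! f : CommAlgCat.of K P ⟶ R, (H0Functor α σ).map f ξ = q := by
    rintro R ⟨q, hq⟩
    obtain ⟨z, rfl⟩ := QuotientGroup.mk_surjective q
    obtain ⟨f, hf, hf'⟩ := hu R z ((hinv R z).mp hq)
    refine ⟨CommAlgCat.ofHom f, Subtype.ext (QuotientGroup.eq.mpr hf), fun F hF ↦ ?_⟩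
    have := hf' F.hom (QuotientGroup.eq.mp (congrArg Subtype.val hF))
    rw [← this]
    rfl
  refine ⟨CommAlgCat.of K P, hP, ⟨⟨fun {R} ↦ Equiv.ofBijective (fun f ↦ (H0Functor α σ).map f ξ)
    (Function.bijective_iff_existsUnique _ |>.mpr (key R)), fun f g ↦ ?_⟩⟩⟩
  simp

end InvariantsRepresentable

/-! ### Finiteness over K from finiteness over a finite extension. -/

section SemilinearFiniteness

variable {K F : Type*} [Field K] [Field F] [Algebra K F] [Module.Finite K F] {V : Type*}
  [AddCommGroup V] [Module F V] [Module.Finite F V]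

theorem finite_quotient_ker_of_semilinear {Z : Type*} [AddCommGroup Z] [Module K Z]
    (θ : Z →ₛₗ[algebraMap K F] V) : Module.Finite K (Z ⧸ LinearMap.ker θ) := by
  let _ : Module K V := Module.compHom V (algebraMap K F)
  have : IsScalarTower K F V := ⟨fun c x v ↦ by
    rw [Algebra.smul_def, mul_smul]
    rfl⟩
  have : Module.Finite K V := Module.Finite.trans F V
  let θ' : Z →ₗ[K] V :=
    { toFun := θ
      map_add' := map_add θ
      map_smul' := fun c z ↦ map_smulₛₗ θ c z }
  have e : LinearMap.ker θ' = LinearMap.ker θ := rfl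
  rw [← e]
  exact Module.Finite.of_injective ((LinearMap.ker θ').liftQ θ' le_rfl)
    (LinearMap.ker_eq_bot.mp (Submodule.ker_liftQ_eq_bot _ _ _ le_rfl))

/-- Modulo S, the kernel of θ is covered by the finite-dimensional I, while Z / ker θ embeds in V,
which is finite over K because F is. -/
theorem finite_quotient_of_semilinear {Z : Type*} [AddCommGroup Z] [Module K Z]
    (θ : Z →ₛₗ[algebraMap K F] V) {S I : Submodule K Z} [Module.Finite K I]
    (h : LinearMap.ker θ ≤ S ⊔ I) : Module.Finite K (Z ⧸ S) := by
  have := finite_quotient_ker_of_semilinear θ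
  let I' := I.map S.mkQ
  have : Module.Finite K I' := inferInstance
  have hle : LinearMap.ker θ ≤ LinearMap.ker (I'.mkQ ∘ₗ S.mkQ) := by
    intro z hz
    obtain ⟨s, hs, i, hi, rfl⟩ := Submodule.mem_sup.mp (h hz)
    have h1 : S.mkQ s = 0 := (Submodule.Quotient.mk_eq_zero S).mpr hs
    rw [LinearMap.mem_ker, LinearMap.comp_apply, map_add, h1, zero_add]
    exact (Submodule.Quotient.mk_eq_zero I').mpr ⟨i, hi, rfl⟩
  have : Module.Finite K ((Z ⧸ S) ⧸ I') :=
    Module.Finite.of_surjective ((LinearMap.ker θ).liftQ _ hle) (by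
      intro x
      obtain ⟨y, rfl⟩ := I'.mkQ_surjective x
      obtain ⟨z, rfl⟩ := S.mkQ_surjective y
      exact ⟨(LinearMap.ker θ).mkQ z, rfl⟩)
  exact Module.Finite.of_submodule_quotient I'

end SemilinearFiniteness

/-! ### Continuous cohomology in degrees 0 and 1. -/

section LowDegrees

variable {G : Type*} [Group G] {F : Type*} [Field F] {M : Type*} [AddCommGroup M] [Module F M]
  (ρ : Representation F G M)

theorem cochainD_zero_apply (f : (Fin 0 → G) → M) (g : Fin 1 → G) :
    cochainD ρ 0 f g = ρ (g 0) (f default) - f default := by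
  change ρ (g 0) (f _) + ∑ i : Fin 1, _ = _
  rw [Fin.sum_univ_one, sub_eq_add_neg]
  congr 1
  · exact congrArg _ (congrArg f (Subsingleton.elim _ _))
  · rw [Subsingleton.elim (Fin.contractNth (0 : Fin 1) (· * ·) g) default]
    simp

theorem cochainD_one_apply (f : (Fin 1 → G) → M) (g : Fin 2 → G) :
    cochainD ρ 1 f g = ρ (g 0) (f fun _ ↦ g 1) - f (fun _ ↦ g 0 * g 1) + f fun _ ↦ g 0 := by
  have h0 : Fin.contractNth (0 : Fin 2) (· * ·) g = fun _ ↦ g 0 * g 1 := by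
    ext i
    rw [Subsingleton.elim i 0]
    rfl
  have h1 : Fin.contractNth (1 : Fin 2) (· * ·) g = fun _ ↦ g 0 := by
    ext i
    rw [Subsingleton.elim i 0]
    rfl
  have h2 : (fun i : Fin 1 ↦ g i.succ) = fun _ ↦ g 1 := by
    ext i
    rw [Subsingleton.elim i 0]
    rfl
  change ρ (g 0) (f fun i ↦ g i.succ) + ∑ i : Fin 2, _ = _
  rw [Fin.sum_univ_two, h0, h1, h2]
  simp
  abel

variable [TopologicalSpace G] [TopologicalSpace M] [IsTopologicalAddGroup M]
  [ContinuousConstSMul F M]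

theorem const_mem_contCocycles {m : M} (hm : ∀ g, ρ g m = m) :
    (fun _ ↦ m) ∈ contCocycles ρ 0 := by
  refine ⟨continuous_const, ?_⟩
  refine LinearMap.mem_ker.mpr ?_
  ext g
  rw [cochainD_zero_apply, hm, sub_self]
  rfl

theorem eq_zero_of_invariant [Subsingleton (ContH ρ 0)] {m : M} (hm : ∀ g, ρ g m = m) :
    m = 0 := by
  have h : Submodule.Quotient.mk (p := (contCoboundaries ρ 0).comap (contCocycles ρ 0).subtype)
      ⟨_, const_mem_contCocycles ρ hm⟩ = 0 := Subsingleton.elim _ _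
  rw [Submodule.Quotient.mk_eq_zero] at h
  exact congrFun (show (fun _ : Fin 0 → G ↦ m) = 0 from h) default

variable {K : Type*} [Field K] [Algebra K F] [Module.Finite K F]

theorem finite_of_finite_H0 [Module.Finite F (ContH ρ 0)] {I : Type*} [AddCommGroup I]
    [Module K I] (b : I →+ M) (hb : ∀ (c : K) l, b (c • l) = algebraMap K F c • b l)
    (hinj : ∀ l, b l = 0 → l = 0) (hinv : ∀ l g, ρ g (b l) = b l) : Module.Finite K I := by
  let θ : I →ₛₗ[algebraMap K F] ContH ρ 0 :=
    { toFun := fun l ↦ Submodule.Quotient.mk ⟨_, const_mem_contCocycles ρ (hinv l)⟩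
      map_add' := fun l l' ↦ congrArg Submodule.Quotient.mk (Subtype.ext (funext fun _ ↦
        map_add b l l'))
      map_smul' := fun c l ↦ congrArg Submodule.Quotient.mk (Subtype.ext (funext fun _ ↦ hb c l)) }
  have hθ : LinearMap.ker θ ≤ ⊥ := by
    intro l hl
    have h := (Submodule.Quotient.mk_eq_zero _).mp (LinearMap.mem_ker.mp hl)
    exact hinj l (congrFun (show (fun _ : Fin 0 → G ↦ b l) = 0 from h) default)
  have := finite_quotient_of_semilinear θ (S := ⊥) (I := ⊥) (hθ.trans bot_le)
  exact Module.Finite.equiv (Submodule.quotEquivOfEqBot (⊥ : Submodule K I) rfl)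

/-- The map b sends elements of ker d₁ to continuous 1-cocycles. Those with trivial class are images
of d₀ up to the finite-dimensional correction I, so ker d₁ / im d₀ is finite-dimensional. -/
theorem finiteCohomology_of_finite_H1 [Module.Finite F (ContH ρ 1)] {L₀ L₁ L₂ : Type*}
    [AddCommGroup L₀] [Module K L₀] [AddCommGroup L₁] [Module K L₁] [AddCommGroup L₂] [Module K L₂]
    (d₀ : L₀ →ₗ[K] L₁) (d₁ : L₁ →ₗ[K] L₂) (b : LinearMap.ker d₁ →+ (G → M))
    (hb : ∀ (c : K) l g, b (c • l) g = algebraMap K F c • b l g) (hcont : ∀ l, Continuous (b l))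
    (hcoc : ∀ l g h, b l (g * h) = b l g + ρ g (b l h))
    (I : Submodule K (LinearMap.ker d₁)) [Module.Finite K I]
    (hker : ∀ l, (∃ m, ∀ g, b l g = ρ g m - m) →
      l ∈ (LinearMap.range d₀).comap (LinearMap.ker d₁).subtype ⊔ I) : FiniteCohomology d₀ d₁ := by
  have hmem : ∀ l, (fun x : Fin 1 → G ↦ b l (x 0)) ∈ contCocycles ρ 1 := by
    refine fun l ↦ ⟨(hcont l).comp (continuous_apply 0), ?_⟩
    refine LinearMap.mem_ker.mpr ?_
    ext g
    rw [cochainD_one_apply, hcoc]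
    simp
  let θ : LinearMap.ker d₁ →ₛₗ[algebraMap K F] ContH ρ 1 :=
    { toFun := fun l ↦ Submodule.Quotient.mk ⟨_, hmem l⟩
      map_add' := fun l l' ↦ congrArg Submodule.Quotient.mk (Subtype.ext (funext fun x ↦
        congrFun (map_add b l l') (x 0)))
      map_smul' := fun c l ↦ congrArg Submodule.Quotient.mk (Subtype.ext (funext fun x ↦
        hb c l (x 0))) }
  refine finite_quotient_of_semilinear θ (I := I) fun l hl ↦ hker l ?_
  obtain ⟨f, -, hf⟩ := (Submodule.Quotient.mk_eq_zero _).mp (LinearMap.mem_ker.mp hl)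
  refine ⟨f default, fun g ↦ ?_⟩
  have := congrFun hf fun _ ↦ g
  rw [cochainD_zero_apply] at this
  exact this.symm

end LowDegrees

/-! ### Forms on the cotangent space as points of the graded pieces. -/

section GradedPieces

variable {G : Type v} [Group G] {K : Type u} [Field K] [CharZero K] {A : Type u} [CommRing A]
  [HopfAlgebra K A] (α : HopfAction G K A) {S : Type u} [Field S] [Algebra K S]
  (σ : G →* (S ≃ₐ[K] S)) (n : ℕ)

variable (K A) in
/-- The cotangent space of `U^{n+1} / U^{n+2}`. -/
abbrev GradedCot : Type u := Cot (imSub (lcsStep K A n))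

omit [CharZero K] in
theorem lcsStep_equivariant (g : G) (a : lcsQuot K A n) :
    lcsStep K A n ((α.quot n).toHom g a) = (α.quot (n + 1)).toHom g (lcsStep K A n a) := rfl

/-- The action of `G` on the cotangent space of `U^{n+1} / U^{n+2}`. -/
abbrev gradedCotAct (g : G) : GradedCot K A n →ₗ[K] GradedCot K A n :=
  cotAct (α.quot (n + 1)) (imSub_stable (lcsStep_equivariant α n)) g⁻¹

variable (A S) in
omit [CharZero K] in
theorem comp_mkQ_mem_gradedPts (l : GradedCot K A n →ₗ[K] S) :
    l ∘ₗ (cotKer (imSub (lcsStep K A n))).mkQ ∈ gradedPts (K := K) A S n :=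
  ⟨isDer_cot l, fun a ha ↦ by
    have : a ∈ imSub (lcsStep K A n) := ⟨⟨a, ha⟩, rfl⟩
    rw [LinearMap.comp_apply, Submodule.mkQ_apply,
      (Submodule.Quotient.mk_eq_zero _).mpr (le_cotKer this), map_zero]⟩

variable (A S) in
/-- Linear forms on the cotangent space as points of `U^{n+1} / U^{n+2}`. -/
def toGraded : (GradedCot K A n →ₗ[K] S) →+ gradedPts (K := K) A S n where
  toFun l := ⟨_, comp_mkQ_mem_gradedPts A S n l⟩
  map_zero' := Subtype.ext (LinearMap.ext fun _ ↦ rfl)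
  map_add' _ _ := Subtype.ext (LinearMap.ext fun _ ↦ rfl)

omit [CharZero K] in
theorem toGraded_apply (l : GradedCot K A n →ₗ[K] S) (a : lcsQuot K A (n + 1)) :
    (toGraded A S n l).1 a = l ((cotKer (imSub (lcsStep K A n))).mkQ a) := rfl

omit [CharZero K] in
theorem toGraded_injective : Function.Injective (toGraded (K := K) A S n) := by
  intro l l' h
  refine LinearMap.ext fun v ↦ ?_
  obtain ⟨a, rfl⟩ := (cotKer (imSub (lcsStep K A n))).mkQ_surjective v
  rw [← toGraded_apply, h, toGraded_apply]

omit [CharZero K] in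
theorem toGraded_surjective : Function.Surjective (toGraded (K := K) A S n) := by
  rintro ⟨D, hD, hD'⟩
  refine ⟨(cotKer (imSub (lcsStep K A n))).liftQ D (cotKer_le D (IsDer.smul hD) ?_),
    Subtype.ext (LinearMap.ext fun a ↦ ?_)⟩
  · rintro _ ⟨a, rfl⟩
    exact hD' _ a.2
  · rfl

omit [CharZero K] in
theorem gradedRep_toGraded (g : G) (l : GradedCot K A n →ₗ[K] S) :
    gradedRep α σ n g (toGraded A S n l) =
      toGraded A S n ((σ g).toLinearMap ∘ₗ l ∘ₗ gradedCotAct α n g) :=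
  Subtype.ext (LinearMap.ext fun _ ↦ rfl)

omit [CharZero K] in
theorem toGraded_smul (F : IntermediateField K S) (c : K) (l : GradedCot K A n →ₗ[K] S) :
    toGraded A S n (c • l) = algebraMap K F c • toGraded A S n l := by
  refine Subtype.ext (LinearMap.ext fun a ↦ ?_)
  change c • _ = algebraMap K S c * _
  rw [Algebra.smul_def]
  rfl

end GradedPieces

theorem finite_comap_subtype {K L : Type*} [Field K] [AddCommGroup L] [Module K L]
    (Z I : Submodule K L) [Module.Finite K I] : Module.Finite K (I.comap Z.subtype) :=
  Module.Finite.of_injective ((Z.subtype ∘ₗ (I.comap Z.subtype).subtype).codRestrict I fun l ↦ l.2)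
    fun _ _ h ↦ Subtype.ext (Subtype.ext congr(($h : L)))

/-! ### The connecting map from H⁰(G, V(B)/V(K)) to H¹(G, V(K)). -/

section Forms

variable {K B : Type u} [Field K] [Field B] [Algebra K B] {G : Type v} [Group G]
  {W : Type*} [AddCommGroup W] [Module K W] (σ : G →* (B ≃ₐ[K] B)) (w : G → W →ₗ[K] W)

/-- The difference between `g l` and `l`. -/
def actDiff (g : G) : (W →ₗ[K] B) →ₗ[K] (W →ₗ[K] B) where
  toFun l := (σ g).toLinearMap ∘ₗ l ∘ₗ w g - l
  map_add' l l' := by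
    ext v
    simp
    ring
  map_smul' c l := by
    refine LinearMap.ext fun v ↦ ?_
    simp [smul_sub]

theorem actDiff_apply (g : G) (l : W →ₗ[K] B) (v : W) :
    actDiff σ w g l v = σ g (l (w g v)) - l v := rfl

/-- Forms fixed by `G`. -/
def invForms : Submodule K (W →ₗ[K] B) := ⨅ g, LinearMap.ker (actDiff σ w g)

variable {σ w}

theorem mem_invForms {l : W →ₗ[K] B} : l ∈ invForms σ w ↔ ∀ g, actDiff σ w g l = 0 := by
  simp [invForms]

variable [TopologicalSpace K] [IsTopologicalRing K] [TopologicalSpace B] [IsTopologicalRing B]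
  [TopologicalSpace G] {F : Type*} [Field F] [Algebra K F] [Module.Finite K F] {M : Type*}
  [AddCommGroup M] [Module F M] [TopologicalSpace M] [IsTopologicalAddGroup M]
  [ContinuousConstSMul F M]

omit [IsTopologicalRing K] in
-- This is part of the long exact sequence of 0 → V(K) → V(B) → V(B)/V(K) → 0. A form l fixed modulo
-- K gives the cocycle g ↦ g l - l with values over K; if it is the coboundary of a form m over K,
-- then l - m is fixed by G.
theorem finiteCohomology_scalarExt_quotDiff (hK : Topology.IsInducing (algebraMap K B))
    (hσ : Continuous fun p : G × B ↦ σ p.1 p.2) (hw : ∀ g h v, w (g * h) v = w h (w g v))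
    (hwc : ∀ v, IsContComb K fun g ↦ w g v) (ρ : Representation F G M)
    [Module.Finite F (ContH ρ 1)] [Module.Finite K (invForms σ w)] (e : (W →ₗ[K] K) →+ M)
    (he : Function.Bijective e) (hsmul : ∀ (c : K) l, e (c • l) = algebraMap K F c • e l)
    (hρ : ∀ g l, ρ g (e l) = e (l ∘ₗ w g))
    (hcont : ∀ c : G → (W →ₗ[K] K), (∀ v, Continuous fun g ↦ c g v) →
      Continuous fun g ↦ e (c g)) : FiniteCohomology (scalarExt K B W) (quotDiff σ w) := by
  -- A linear retraction of B onto K, not assumed continuous, serves only to regard K-valued forms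
  -- as forms over K.
  obtain ⟨r, hr⟩ := (Algebra.linearMap K B).exists_leftInverse_of_injective
    (LinearMap.ker_eq_bot.mpr (algebraMap K B).injective)
  have hrδ : ∀ (l : LinearMap.ker (quotDiff σ w)) g v,
      algebraMap K B (r (actDiff σ w g l.1 v)) = actDiff σ w g l.1 v := by
    intro l g v
    have h0 : quotScalars K B (actDiff σ w g l.1 v) = 0 := by
      rw [actDiff_apply, map_sub]
      exact congrFun congr($(LinearMap.mem_ker.mp l.2) v) g
    obtain ⟨c, hc⟩ := (Submodule.Quotient.mk_eq_zero _).mp h0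
    rw [← hc]
    exact congrArg _ congr($hr c)
  let b : LinearMap.ker (quotDiff σ w) →+ (G → M) :=
    { toFun := fun l g ↦ e (r ∘ₗ actDiff σ w g l.1)
      map_zero' := by
        ext1 g
        rw [ZeroMemClass.coe_zero, map_zero, LinearMap.comp_zero, map_zero]
        rfl
      map_add' := fun l l' ↦ by
        ext1 g
        rw [Submodule.coe_add, map_add, LinearMap.comp_add, map_add]
        rfl }
  let I := (invForms σ w).comap (LinearMap.ker (quotDiff σ w)).subtype
  have : Module.Finite K I := finite_comap_subtype _ _
  refine finiteCohomology_of_finite_H1 ρ _ _ b (fun c l g ↦ ?_) (fun l ↦ ?_) (fun l g h ↦ ?_) I ?_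
  · change e (r ∘ₗ actDiff σ w g (c • l.1)) = _
    rw [map_smul, LinearMap.comp_smul, hsmul]
    rfl
  · refine hcont _ fun v ↦ ?_
    -- K carries the topology induced from B, so continuity is tested in B, where the discontinuous
    -- r disappears.
    rw [hK.continuous_iff]
    refine Continuous.congr ?_ fun g ↦ (hrδ l g v).symm
    refine Continuous.sub ?_ continuous_const
    obtain ⟨m, c, x, hc, hx⟩ := (hwc v).map l.1
    have h1 : ∀ g, σ g (l.1 (w g v)) = ∑ i, algebraMap K B (c i g) * σ g (x i) := by
      intro g
      refine (congrArg (σ g) (hx g)).trans ?_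
      rw [map_sum]
      exact Finset.sum_congr rfl fun i _ ↦ by rw [map_smul, Algebra.smul_def]
    refine Continuous.congr ?_ fun g ↦ (h1 g).symm
    refine continuous_finsetSum _ fun i _ ↦ (hK.continuous.comp (hc i)).mul ?_
    exact hσ.comp (continuous_id.prodMk continuous_const)
  · change e _ = e _ + ρ g (e _)
    rw [hρ, ← map_add]
    congr 1
    refine LinearMap.ext fun v ↦ (algebraMap K B).injective ?_
    change algebraMap K B (r (actDiff σ w (g * h) l.1 v)) = algebraMap K B
      (r (actDiff σ w g l.1 v) + r (actDiff σ w h l.1 (w g v)))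
    -- The differences lie in K, on which G acts trivially.
    have h1 : σ g (actDiff σ w h l.1 (w g v)) = actDiff σ w h l.1 (w g v) := by
      rw [← hrδ, AlgEquiv.commutes]
    rw [map_add, hrδ, hrδ, hrδ, ← h1, actDiff_apply, actDiff_apply, actDiff_apply, map_sub, hw,
      map_mul, AlgEquiv.mul_apply]
    ring
  · rintro l ⟨m, hm⟩
    obtain ⟨m, rfl⟩ := he.2 m
    have hm' : ∀ g v, actDiff σ w g l.1 v = algebraMap K B (m (w g v)) -
        algebraMap K B (m v) := by
      intro g v
      have h1 : e (r ∘ₗ actDiff σ w g l.1) = e (m ∘ₗ w g - m) := by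
        rw [map_sub, ← hρ]
        exact hm g
      rw [← hrδ, ← map_sub]
      exact congrArg _ congr($(he.1 h1) v)
    have hd : scalarExt K B W m ∈ LinearMap.ker (quotDiff σ w) := quotDiff_scalarExt σ _ m
    refine Submodule.mem_sup.mpr ⟨⟨_, hd⟩, ⟨m, rfl⟩, ⟨_, Submodule.sub_mem _ l.2 hd⟩,
      mem_invForms.mpr fun g ↦ LinearMap.ext fun v ↦ ?_,
      Subtype.ext (add_sub_cancel (scalarExt K B W m) l.1)⟩
    change actDiff σ w g (l.1 - scalarExt K B W m) v = 0
    rw [map_sub, LinearMap.sub_apply, hm', actDiff_apply]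
    change _ - (σ g (algebraMap K B (m (w g v))) - algebraMap K B (m v)) = 0
    rw [AlgEquiv.commutes, sub_self]

omit [TopologicalSpace K] [IsTopologicalRing K] [TopologicalSpace B] [IsTopologicalRing B] in
theorem finite_invForms (ρ : Representation F G M) [Module.Finite F (ContH ρ 0)]
    (e : (W →ₗ[K] B) →+ M) (he : Function.Injective e)
    (hsmul : ∀ (c : K) l, e (c • l) = algebraMap K F c • e l)
    (hρ : ∀ g l, ρ g (e l) = e ((σ g).toLinearMap ∘ₗ l ∘ₗ w g)) :
    Module.Finite K (invForms σ w) := by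
  refine finite_of_finite_H0 (I := invForms σ w) ρ (e.comp (invForms σ w).subtype.toAddMonoidHom)
    (fun c l ↦ hsmul c l.1) (fun l hl ↦ ?_) fun l g ↦ ?_
  · exact Subtype.ext (he (hl.trans (map_zero _).symm))
  · refine (hρ g l.1).trans (congrArg e ?_)
    exact sub_eq_zero.mp (mem_invForms.mp l.2 g)

end Forms

/-! ### Finiteness of H⁰(G, V(B)/V(K)) for the graded pieces. -/

section GradedFiniteness

variable {K A B : Type u} [Field K] [CharZero K] [TopologicalSpace K] [IsTopologicalRing K]
  [Field B] [TopologicalSpace B] [IsTopologicalRing B] [Algebra K B]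
  {G : Type v} [Group G] [TopologicalSpace G] [CommRing A] [HopfAlgebra K A]
  {α : HopfAction G K A} {σ : G →* (B ≃ₐ[K] B)} {n : ℕ}

omit [CharZero K] [TopologicalSpace K] [IsTopologicalRing K] [TopologicalSpace G] in
theorem gradedCotAct_mul (g h : G) (v : GradedCot K A n) :
    gradedCotAct α n (g * h) v = gradedCotAct α n h (gradedCotAct α n g v) := by
  obtain ⟨a, rfl⟩ := (cotKer (imSub (lcsStep K A n))).mkQ_surjective v
  rw [gradedCotAct, cotAct_mk, gradedCotAct, gradedCotAct, cotAct_mk, cotAct_mk, mul_inv_rev,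
    map_mul, AlgEquiv.mul_apply]

omit [CharZero K] [IsTopologicalRing K] in
theorem isContComb_gradedCotAct (hα : ∀ a, IsContComb K fun g ↦ (α.quot (n + 1)).toHom g⁻¹ a)
    (v : GradedCot K A n) : IsContComb K fun g ↦ gradedCotAct α n g v := by
  obtain ⟨a, rfl⟩ := (cotKer (imSub (lcsStep K A n))).mkQ_surjective v
  exact (hα a).map (cotKer (imSub (lcsStep K A n))).mkQ

omit [CharZero K] [TopologicalSpace K] [IsTopologicalRing K] [IsTopologicalRing B] in
theorem continuous_toGraded {X : Type*} [TopologicalSpace X]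
    {c : X → GradedCot K A n →ₗ[K] B} (h : ∀ v, Continuous fun x ↦ c x v) :
    Continuous fun x ↦ toGraded A B n (c x) :=
  continuous_induced_rng.mpr (continuous_pi fun _ ↦ h _)

omit [CharZero K] in
theorem finiteCohomology_quotDiff (hK : Topology.IsInducing (algebraMap K B))
    (hσ : Continuous fun p : G × B ↦ σ p.1 p.2)
    (hF : Module.Finite K (IntermediateField.fixedField σ.range))
    (hα : ∀ a, IsContComb K fun g ↦ (α.quot (n + 1)).toHom g⁻¹ a)
    (hB : Module.Finite (IntermediateField.fixedField σ.range) (GradedH α σ n 0))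
    (hBK : Module.Finite (IntermediateField.fixedField (1 : G →* (K ≃ₐ[K] K)).range)
      (GradedH α (1 : G →* (K ≃ₐ[K] K)) n 1)) :
    FiniteCohomology (scalarExt K B (GradedCot K A n)) (quotDiff σ (gradedCotAct α n)) := by
  have := finite_invForms (σ := σ) (w := gradedCotAct α n) (gradedRep α σ n)
    (toGraded A B n) (toGraded_injective n) (toGraded_smul n _) (gradedRep_toGraded α σ n)
  exact finiteCohomology_scalarExt_quotDiff hK hσ gradedCotAct_mul (isContComb_gradedCotAct hα)
    (gradedRep α (1 : G →* (K ≃ₐ[K] K)) n) (toGraded A K n)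
    ⟨toGraded_injective n, toGraded_surjective n⟩ (toGraded_smul n _)
    (gradedRep_toGraded α (1 : G →* (K ≃ₐ[K] K)) n) fun c hc ↦ continuous_toGraded hc

end GradedFiniteness

/-! ### Universal fixed classes for every U_n. -/

section InvariantsLcs

variable {K A B : Type u} [Field K] [CharZero K] {G : Type v} [Group G] [Field B] [Algebra K B]
  [CommRing A] [HopfAlgebra K A] {α : HopfAction G K A} (σ : G →* (B ≃ₐ[K] B))

theorem hasUniversalOrbit_quot (hA : IsConilpotent K A)
    (hfg : ∀ n, Algebra.FiniteType K (lcsQuot K A n))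
    (hα : ∀ n (a : lcsQuot K A n), HasFiniteSpan (K := K) fun g ↦ (α.quot n).toHom g⁻¹ a)
    (hfin : ∀ n, FiniteCohomology (scalarExt K B (GradedCot K A n))
      (quotDiff σ (gradedCotAct α n))) (n : ℕ) : HasUniversalOrbit σ (α.quot n) := by
  induction n with
  | zero =>
    -- As U_0 is trivial, the base case is represented by the point Spec K.
    refine ⟨K, inferInstance, inferInstance, inferInstance, 1, fun g ↦ ?_, fun R _ _ z _ ↦
      ⟨Algebra.ofId K R, ?_, fun f _ ↦ Subsingleton.elim _ _⟩⟩
    · rw [lcsQuot_zero_pts (1⁻¹ * _) 1]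
      exact one_mem _
    · beta_reduce
      rw [lcsQuot_zero_pts (_ * z) 1]
      exact one_mem _
  | succ n ih =>
    have := hfg (n + 1)
    exact ih.step σ (φ := lcsStep K A n) (lcsQuot_isConilpotent hA _) (lcsQuot_isConilpotent hA _)
      (lcsStep_injective n) (lcsStep_equivariant α n) (hα _)
      (fun S _ _ x y hy ↦ commute_of_res_eq_one hA x y hy) (hfin n)

end InvariantsLcs

/-! ### Continuous families as points over C(X, K) ⊗ R. -/

section ContinuousFamilies

variable {K : Type*} [Field K] [TopologicalSpace K] {X : Type*} [TopologicalSpace X]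

theorem IsContComb.of_fintype {M ι : Type*} [AddCommGroup M] [Module K M] [Fintype ι] {f : X → M}
    (c : ι → X → K) (b : ι → M) (hc : ∀ i, Continuous (c i)) (h : ∀ x, f x = ∑ i, c i x • b i) :
    IsContComb K f := by
  let e := Fintype.equivFin ι
  refine ⟨_, fun i ↦ c (e.symm i), fun i ↦ b (e.symm i), fun i ↦ hc _, fun x ↦ ?_⟩
  rw [h, ← e.symm.sum_comp]

variable [IsTopologicalRing K]

theorem IsContComb.sum_smul {M ι : Type*} [AddCommGroup M] [Module K M] [Fintype ι]
    {f : ι → X → M} (c : ι → X → K) (hc : ∀ i, Continuous (c i)) (hf : ∀ i, IsContComb K (f i)) :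
    IsContComb K fun x ↦ ∑ i, c i x • f i x := by
  choose n φ b hφ hb using hf
  refine IsContComb.of_fintype (ι := Σ i, Fin (n i)) (fun j x ↦ c j.1 x * φ j.1 j.2 x)
    (fun j ↦ b j.1 j.2) (fun j ↦ (hc _).mul (hφ _ _)) fun x ↦ ?_
  rw [Fintype.sum_sigma]
  refine Finset.sum_congr rfl fun i _ ↦ ?_
  rw [hb, Finset.smul_sum]
  exact Finset.sum_congr rfl fun j _ ↦ smul_smul _ _ _

variable {R : Type*} [CommRing R] [Algebra K R] {R' : Type*} [CommRing R'] [Algebra K R']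

variable (K R) in
/-- Evaluation at `x` of elements of `C(X, K) ⊗ R`. -/
def evalCont (x : X) : C(X, K) ⊗[K] R →ₐ[K] R :=
  (Algebra.TensorProduct.lid K R).toAlgHom.comp
    (Algebra.TensorProduct.map (ContinuousMap.evalAlgHom K K x) (AlgHom.id K R))

@[simp] theorem evalCont_tmul (x : X) (f : C(X, K)) (r : R) : evalCont K R x (f ⊗ₜ r) = f x • r :=
  rfl

theorem eq_zero_of_evalCont (t : C(X, K) ⊗[K] R) (h : ∀ x, evalCont K R x t = 0) : t = 0 := by
  refine eq_zero_of_rTensor_eq_zero R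
    (fun x : X ↦ (ContinuousMap.evalAlgHom K K x : C(X, K) →ₐ[K] K).toLinearMap)
    (fun m hm ↦ ContinuousMap.ext hm) t fun x ↦ (TensorProduct.lid K R).injective ?_
  rw [map_zero, ← h x]
  clear h
  induction t with
  | zero => simp
  | tmul f r => rfl
  | add s t hs ht => simp only [map_add, hs, ht]

theorem eq_of_evalCont {s t : C(X, K) ⊗[K] R} (h : ∀ x, evalCont K R x s = evalCont K R x t) :
    s = t :=
  sub_eq_zero.mp (eq_zero_of_evalCont _ fun x ↦ by rw [map_sub, h, sub_self])

theorem evalCont_lTensor (f : R →ₐ[K] R') (x : X) (t : C(X, K) ⊗[K] R) :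
    evalCont K R' x (f.toLinearMap.lTensor _ t) = f (evalCont K R x t) := by
  induction t with
  | zero => simp
  | tmul b r => simp
  | add s t hs ht => simp only [map_add, hs, ht]

theorem evalCont_map (f : R →ₐ[K] R') (x : X) (t : C(X, K) ⊗[K] R) :
    evalCont K R' x (Algebra.TensorProduct.map (AlgHom.id K C(X, K)) f t) =
      f (evalCont K R x t) := by
  induction t with
  | zero => simp
  | tmul b r => simp
  | add s t hs ht => simp only [map_add, hs, ht]

theorem isContComb_evalCont (t : C(X, K) ⊗[K] R) : IsContComb K fun x ↦ evalCont K R x t := by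
  obtain ⟨s, rfl⟩ := TensorProduct.exists_finset t
  refine IsContComb.of_fintype (ι := s) (fun i x ↦ i.1.1 x) (fun i ↦ i.1.2)
    (fun i ↦ i.1.1.continuous) fun x ↦ ?_
  rw [map_sum, ← Finset.sum_coe_sort s]
  rfl

theorem IsContComb.exists_evalCont {f : X → R} (hf : IsContComb K f) :
    ∃ t : C(X, K) ⊗[K] R, ∀ x, evalCont K R x t = f x := by
  obtain ⟨n, c, b, hc, h⟩ := hf
  refine ⟨∑ i, (⟨c i, hc i⟩ : C(X, K)) ⊗ₜ b i, fun x ↦ ?_⟩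
  rw [map_sum, h]
  rfl

variable {H : Type*} [CommRing H] [HopfAlgebra K H]

theorem Pts.eq_of_evalCont {x y : Pts K H (C(X, K) ⊗[K] R)}
    (h : ∀ p, Pts.map (evalCont K R p) x = Pts.map (evalCont K R p) y) : x = y :=
  Pts.ext_apply fun a ↦ UnipotentCohomology.eq_of_evalCont fun p ↦ congr(($(h p)) a)

/-- The continuous version of collecting a family into one point: lifting this point and then
evaluating yields a lifted family that is again continuous. -/
theorem exists_point_of_isContComb (c : X → Pts K H R) (hc : ∀ a, IsContComb K fun x ↦ c x a) :
    ∃ C : Pts K H (C(X, K) ⊗[K] R), ∀ x, Pts.map (evalCont K R x) C = c x := by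
  obtain ⟨Φ, hΦ⟩ := exists_algHom_lift (K := K) (H := H) (T := C(X, K) ⊗[K] R) (ι := X)
    (S := fun _ ↦ R) (evalCont K R) eq_zero_of_evalCont (fun x ↦ (c x).ofConv)
    fun a ↦ (hc a).exists_evalCont
  exact ⟨toConv Φ, fun x ↦ Pts.ext_apply fun a ↦ hΦ x a⟩

end ContinuousFamilies

/-! ### Coboundaries of continuous forms. -/

section Coboundaries

variable {K : Type*} [Field K] [TopologicalSpace K] [IsTopologicalRing K] {G : Type*} [Group G]
  [TopologicalSpace G] [IsTopologicalGroup G] {W : Type*} [AddCommGroup W] [Module K W]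
  {w : G → W →ₗ[K] W} (hwc : ∀ v, IsContComb K fun g ↦ w g v)

omit [Group G] [IsTopologicalGroup G] in
include hwc in
theorem continuous_form_act (m : W →ₗ[K] K) (v : W) : Continuous fun g ↦ m (w g v) := by
  obtain ⟨n, c, b, hc, h⟩ := (hwc v).map m
  exact (continuous_finsetSum _ fun i _ ↦ (hc i).smul continuous_const).congr fun g ↦ (h g).symm

omit [Group G] [IsTopologicalGroup G] in
include hwc in
theorem continuous_form_act₂ (l : W →ₗ[K] C(G, K)) (v : W) :
    Continuous fun p : G × G ↦ l (w p.1 v) p.2 := by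
  obtain ⟨n, c, b, hc, h⟩ := (hwc v).map l
  have : ∀ p : G × G, ∑ i, c i p.1 • b i p.2 = l (w p.1 v) p.2 := by
    intro p
    have h' : l (w p.1 v) = ∑ i, c i p.1 • b i := h p.1
    rw [h', ContinuousMap.sum_apply]
    rfl
  exact (continuous_finsetSum _ fun i _ ↦ ((hc i).comp continuous_fst).smul
    ((b i).continuous.comp continuous_snd)).congr this

/-- The coboundary of a form with values in `K`. -/
def formCob₀ : (W →ₗ[K] K) →ₗ[K] (W →ₗ[K] C(G, K)) where
  toFun m :=
    { toFun := fun v ↦ ⟨fun g ↦ m v - m (w g v),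
        continuous_const.sub (continuous_form_act hwc m v)⟩
      map_add' := fun v v' ↦ by
        ext g
        simp
        ring
      map_smul' := fun c v ↦ by
        ext g
        simp [mul_sub] }
  map_add' m m' := by
    ext v g
    simp
    ring
  map_smul' c m := by
    ext v g
    simp [mul_sub]

/-- The failure of a form with values in `C(G, K)` to be a cocycle. -/
def formCob₁ : (W →ₗ[K] C(G, K)) →ₗ[K] (W →ₗ[K] C(G × G, K)) where
  toFun l :=
    { toFun := fun v ↦ ⟨fun p ↦ l v (p.1 * p.2) - (l v p.1 + l (w p.1 v) p.2),
        ((l v).continuous.comp (continuous_fst.mul continuous_snd)).sub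
          (((l v).continuous.comp continuous_fst).add (continuous_form_act₂ hwc l v))⟩
      map_add' := fun v v' ↦ by
        ext g
        simp
        ring
      map_smul' := fun c v ↦ by
        ext g
        simp
        ring }
  map_add' m m' := by
    ext v g
    simp
    ring
  map_smul' c m := by
    ext v g
    simp
    ring

omit [Group G] [IsTopologicalGroup G] in
theorem formCob₀_apply (m : W →ₗ[K] K) (v : W) (g : G) :
    formCob₀ hwc m v g = m v - m (w g v) := rfl

theorem formCob₁_apply (l : W →ₗ[K] C(G, K)) (v : W) (g h : G) :
    formCob₁ hwc l v (g, h) = l v (g * h) - (l v g + l (w g v) h) := rfl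

theorem formCob₁_formCob₀ (hw : ∀ g h v, w (g * h) v = w h (w g v)) (m : W →ₗ[K] K) :
    formCob₁ hwc (formCob₀ hwc m) = 0 := by
  ext v ⟨g, h⟩
  rw [formCob₁_apply, formCob₀_apply, formCob₀_apply, formCob₀_apply, hw]
  simp

variable [Module.Finite K W] {R : Type*} [CommRing R] [Algebra K R]

omit [Group G] [IsTopologicalGroup G] in
theorem evalCont_formCob₀ (n : W →ₗ[K] K ⊗[K] R) (v : W) (g : G) :
    evalCont K R g (homBase R (formCob₀ hwc) n v) =
      TensorProduct.lid K R (n v) - TensorProduct.lid K R (n (w g v)) := by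
  induction n using homTensor_induction with
  | h0 => simp
  | h l r =>
    rw [homBase_homTmul, homTmul_apply, evalCont_tmul, formCob₀_apply, sub_smul]
    rfl
  | ha l l' h h' =>
    simp only [map_add, LinearMap.add_apply, h, h']
    abel

theorem evalCont_formCob₁ (l : W →ₗ[K] C(G, K) ⊗[K] R) (v : W) (g h : G) :
    evalCont K R (g, h) (homBase R (formCob₁ hwc) l v) =
      evalCont K R (g * h) (l v) - (evalCont K R g (l v) + evalCont K R h (l (w g v))) := by
  induction l using homTensor_induction with
  | h0 => simp
  | h l r =>
    rw [homBase_homTmul, homTmul_apply, evalCont_tmul, formCob₁_apply, sub_smul, add_smul]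
    rfl
  | ha l l' h h' =>
    simp only [map_add, LinearMap.add_apply, h, h']
    abel

variable {F : Type*} [Field F] [Algebra K F] [Module.Finite K F] {M : Type*}
  [AddCommGroup M] [Module F M] [TopologicalSpace M] [IsTopologicalAddGroup M]
  [ContinuousConstSMul F M]

omit [Module.Finite K W] in
-- Evaluating a form at g identifies the kernel of `formCob₁` with continuous 1-cocycles of the
-- graded piece, so this cohomology embeds in H¹ and no finite correction is needed.
theorem finiteCohomology_formCob (ρ : Representation F G M) [Module.Finite F (ContH ρ 1)]
    (e : (W →ₗ[K] K) →+ M)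
    (he : Function.Bijective e) (hsmul : ∀ (c : K) l, e (c • l) = algebraMap K F c • e l)
    (hρ : ∀ g l, ρ g (e l) = e (l ∘ₗ w g))
    (hcont : ∀ c : G → (W →ₗ[K] K), (∀ v, Continuous fun g ↦ c g v) →
      Continuous fun g ↦ e (c g)) : FiniteCohomology (formCob₀ hwc) (formCob₁ hwc) := by
  let E : G → (W →ₗ[K] C(G, K)) →ₗ[K] (W →ₗ[K] K) := fun g ↦
    LinearMap.compRight K (ContinuousMap.evalAlgHom K K g : C(G, K) →ₐ[K] K).toLinearMap
  have hE : ∀ g l v, E g l v = l v g := fun g l v ↦ rfl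
  let b : LinearMap.ker (formCob₁ hwc) →+ (G → M) :=
    { toFun := fun l g ↦ e (E g l.1)
      map_zero' := by
        ext1 g
        rw [ZeroMemClass.coe_zero, map_zero, map_zero]
        rfl
      map_add' := fun l l' ↦ by
        ext1 g
        rw [Submodule.coe_add, map_add, map_add]
        rfl }
  have : Module.Finite K (⊥ : Submodule K (LinearMap.ker (formCob₁ hwc))) := inferInstance
  refine finiteCohomology_of_finite_H1 ρ _ _ b (fun c l g ↦ ?_) (fun l ↦ ?_) (fun l g h ↦ ?_) ⊥ ?_
  · change e (E g (c • l.1)) = _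
    rw [map_smul, hsmul]
    rfl
  · exact hcont _ fun v ↦ (l.1 v).continuous
  · change e _ = e _ + ρ g (e _)
    rw [hρ, ← map_add]
    congr 1
    refine LinearMap.ext fun v ↦ ?_
    have := congr($(LinearMap.mem_ker.mp l.2) v (g, h))
    rw [formCob₁_apply] at this
    exact sub_eq_zero.mp this
  · rintro l ⟨m, hm⟩
    obtain ⟨m, rfl⟩ := he.2 m
    -- The sign appears because `formCob₀` is m - g m, the opposite of the inhomogeneous
    -- differential.
    refine Submodule.mem_sup_left ⟨-m, ?_⟩
    ext v g
    have h1 : e (E g l.1) = e (m ∘ₗ w g - m) := by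
      rw [map_sub, ← hρ]
      exact hm g
    have h2 := congr($(he.1 h1) v)
    rw [hE] at h2
    rw [formCob₀_apply]
    refine Eq.trans ?_ h2.symm
    simp
    ring

end Coboundaries

/-! ### The obstruction to lifting a cocycle. -/

section Cocycles

variable {K : Type u} [Field K] [TopologicalSpace K] [IsTopologicalRing K] {G : Type v} [Group G]
  [TopologicalSpace G] [IsTopologicalGroup G] {H H' : Type u} [CommRing H] [HopfAlgebra K H]
  [CommRing H'] [HopfAlgebra K H'] {α : HopfAction G K H} {α' : HopfAction G K H'}
  {φ : H' →ₐc[K] H} {R : Type u} [CommRing R] [Algebra K R]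

variable (α) in
/-- The action of `G` on the points over an algebra with trivial action. -/
abbrev trivAct (g : G) : Pts K H R →* Pts K H R := ptsAct α (1 : G →* (R ≃ₐ[K] R)) g

omit [TopologicalSpace K] [IsTopologicalRing K] [TopologicalSpace G] [IsTopologicalGroup G] in
theorem map_trivAct {R' : Type u} [CommRing R'] [Algebra K R'] (f : R →ₐ[K] R') (g : G)
    (x : Pts K H R) : Pts.map f (trivAct α g x) = trivAct α g (Pts.map f x) :=
  map_ptsAct α (σ' := (1 : G →* (R' ≃ₐ[K] R'))) f (fun _ ↦ rfl) x

omit [TopologicalSpace K] [IsTopologicalRing K] [TopologicalSpace G] [IsTopologicalGroup G] in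
theorem trivAct_expCot [CharZero K] (hH : IsConilpotent K H) {N : Submodule K H}
    (hN : ∀ g, ∀ a ∈ N, α.toHom g a ∈ N) (g : G) (l : Cot N →ₗ[K] R) :
    trivAct α g (expCot hH l) = expCot hH (l ∘ₗ cotAct α hN g⁻¹) :=
  ptsAct_expCot hH α hN 1 g l

omit [TopologicalSpace K] [IsTopologicalRing K] [TopologicalSpace G] [IsTopologicalGroup G] in
theorem trivAct_mul (g h : G) (x : Pts K H R) :
    trivAct α (g * h) x = trivAct α g (trivAct α h x) := by
  refine Pts.ext_apply fun a ↦ ?_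
  rw [ptsAct_apply, ptsAct_apply, ptsAct_apply, mul_inv_rev, map_mul, map_mul,
    AlgEquiv.mul_apply]
  rfl

omit [IsTopologicalRing K] [IsTopologicalGroup G] in
theorem isContComb_cotAct {N : Submodule K H} (hN : ∀ g, ∀ a ∈ N, α.toHom g a ∈ N)
    (hα : ∀ a, IsContComb K fun g ↦ α.toHom g⁻¹ a) (v : Cot N) :
    IsContComb K fun g ↦ cotAct α hN g⁻¹ v := by
  obtain ⟨a, rfl⟩ := (cotKer N).mkQ_surjective v
  exact (hα a).map (cotKer N).mkQ

omit [IsTopologicalGroup G] in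
theorem isContComb_trivAct (hα : ∀ a, IsContComb K fun g ↦ α.toHom g⁻¹ a) {c : G → Pts K H R}
    (hc : ∀ a, IsContComb K fun g ↦ c g a) (a : H) :
    IsContComb K fun p : G × G ↦ trivAct α p.1 (c p.2) a := by
  obtain ⟨n, φ, b, hφ, hb⟩ := hα a
  have h1 := IsContComb.sum_smul (fun i (p : G × G) ↦ φ i p.1)
    (fun i ↦ (hφ i).comp continuous_fst) fun i ↦ (hc (b i)).comp continuous_snd
  refine (funext fun p ↦ ?_ : _ = fun p : G × G ↦ trivAct α p.1 (c p.2) a) ▸ h1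
  change _ = c p.2 (α.toHom p.1⁻¹ a)
  rw [show α.toHom p.1⁻¹ a = _ from hb p.1]
  simp [map_sum, map_smul]

/-- The failure of lifting a cocycle is measured by a `2`-cochain. -/
theorem exists_cocycle_obstruction [CharZero K] [Algebra.FiniteType K H] (hH : IsConilpotent K H)
    (hH' : IsConilpotent K H')
    (hφα : ∀ g a, φ (α'.toHom g a) = α.toHom g (φ a))
    (hα : ∀ a, IsContComb K fun g ↦ α.toHom g⁻¹ a)
    (hc : ∀ (S : Type u) [CommRing S] [Algebra K S] (x y : Pts K H S), Pts.res φ y = 1 →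
      x * y = y * x)
    {P : Type u} [CommRing P] [Algebra K P] (C : Pts K H (C(G, K) ⊗[K] P))
    (hC : ∀ g h, Pts.res φ (Pts.map (evalCont K P (g * h)) C) =
      Pts.res φ (Pts.map (evalCont K P g) C) *
        trivAct α' g (Pts.res φ (Pts.map (evalCont K P h) C))) :
    ∃ o : Cot (imSub φ) →ₗ[K] C(G × G, K) ⊗[K] P,
      ∀ (R : Type u) [CommRing R] [Algebra K R] (f : P →ₐ[K] R)
        (l : Cot (imSub φ) →ₗ[K] C(G, K) ⊗[K] R),
        (∀ g h, Pts.map f (Pts.map (evalCont K P (g * h)) C) *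
            expCot hH ((evalCont K R (g * h)).toLinearMap ∘ₗ l) =
          Pts.map f (Pts.map (evalCont K P g) C) * expCot hH ((evalCont K R g).toLinearMap ∘ₗ l) *
            trivAct α g (Pts.map f (Pts.map (evalCont K P h) C) *
              expCot hH ((evalCont K R h).toLinearMap ∘ₗ l))) ↔
          homBase R (formCob₁ (isContComb_cotAct (imSub_stable hφα) hα)) l =
            f.toLinearMap.lTensor _ ∘ₗ o := by
  set c : G → Pts K H P := fun g ↦ Pts.map (evalCont K P g) C with hcdef
  have hcc : ∀ a, IsContComb K fun g ↦ c g a := fun a ↦ isContComb_evalCont (C a)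
  -- The families c(gh), c(g) and g c(h) as points over C(G × G, K) ⊗ P; the logarithm ω of Y₁⁻¹ Y₂
  -- Y₃ is the 2-cochain measuring the failure of the cocycle identity.
  obtain ⟨Y₁, hY₁⟩ := exists_point_of_isContComb (fun p : G × G ↦ c (p.1 * p.2))
    fun a ↦ (hcc a).comp continuous_mul
  obtain ⟨Y₂, hY₂⟩ := exists_point_of_isContComb (fun p : G × G ↦ c p.1)
    fun a ↦ (hcc a).comp continuous_fst
  obtain ⟨Y₃, hY₃⟩ := exists_point_of_isContComb (fun p : G × G ↦ trivAct α p.1 (c p.2))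
    (isContComb_trivAct hα hcc)
  obtain ⟨ω, hω⟩ := exists_expCot_of_res_eq_one (φ := φ) hH hH' (x := Y₁⁻¹ * (Y₂ * Y₃)) (by
    refine Pts.eq_of_evalCont fun p ↦ ?_
    rw [← Pts.res_map]
    simp only [map_mul, map_inv, map_one, hY₁, hY₂, hY₃, res_ptsAct α α' hφα]
    rw [show Pts.res φ (c (p.1 * p.2)) = _ from hC p.1 p.2]
    exact inv_mul_cancel _)
  rw [inv_mul_eq_iff_eq_mul] at hω
  have hΔ : ∀ g h, c g * trivAct α g (c h) =
      c (g * h) * expCot hH ((evalCont K P (g, h)).toLinearMap ∘ₗ ω) := by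
    intro g h
    have := congrArg (Pts.map (evalCont K P (g, h))) hω
    rwa [map_mul, map_mul, hY₁, hY₂, hY₃, map_expCot] at this
  refine ⟨ω, fun R _ _ f l ↦ ?_⟩
  set w : G → Cot (imSub φ) →ₗ[K] Cot (imSub φ) := fun g ↦ cotAct α (imSub_stable hφα) g⁻¹
  let L : G → Cot (imSub φ) →ₗ[K] R := fun g ↦ (evalCont K R g).toLinearMap ∘ₗ l
  let Ω : G → G → Cot (imSub φ) →ₗ[K] R := fun g h ↦
    f.toLinearMap ∘ₗ (evalCont K P (g, h)).toLinearMap ∘ₗ ω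
  -- Central factors slide to the right and their exponents add, so the cocycle identity becomes
  -- L(gh) = Ω(g,h) + L(g) + g L(h).
  have key : ∀ g h, Pts.map f (c g) * expCot hH (L g) *
      trivAct α g (Pts.map f (c h) * expCot hH (L h)) =
      Pts.map f (c (g * h)) * expCot hH (Ω g h + (L g + L h ∘ₗ w g)) := by
    intro g h
    have hΩ : expCot hH (Ω g h) = Pts.map f (expCot hH ((evalCont K P (g, h)).toLinearMap ∘ₗ ω)) :=
      (map_expCot hH f _).symm
    rw [expCot_add hH hH' (hc _), expCot_add hH hH' (hc _), map_mul,
      trivAct_expCot hH (imSub_stable hφα), hΩ, ← map_trivAct, ← mul_assoc]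
    have h1 := congrArg (Pts.map f) (hΔ g h)
    rw [map_mul, map_mul] at h1
    have h2 := hc _ (Pts.map f (trivAct α g (c h))) (expCot hH (L g)) (res_expCot hH hH' _)
    rw [mul_assoc (Pts.map f (c g)), ← h2, ← mul_assoc (Pts.map f (c g)), h1]
    simp only [mul_assoc]
    rfl
  have e1 : ∀ g h, (Pts.map f (c (g * h)) * expCot hH (L (g * h)) =
      Pts.map f (c g) * expCot hH (L g) * trivAct α g (Pts.map f (c h) * expCot hH (L h))) ↔
        ∀ v, L (g * h) v = Ω g h v + (L g v + L h (w g v)) := by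
    intro g h
    rw [key, mul_right_inj, (expCot_injective hH).eq_iff, LinearMap.ext_iff]
    rfl
  refine (forall₂_congr e1).trans ⟨fun h ↦ ?_, fun h g g' v ↦ ?_⟩
  · refine LinearMap.ext fun v ↦ eq_of_evalCont ?_
    rintro ⟨g, g'⟩
    rw [evalCont_formCob₁, LinearMap.comp_apply, evalCont_lTensor, sub_eq_iff_eq_add]
    exact h g g' v
  · rw [← sub_eq_iff_eq_add]
    refine (evalCont_formCob₁ _ l v g g').symm.trans ((congrArg _ congr($h v)).trans ?_)
    rw [LinearMap.comp_apply, evalCont_lTensor]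
    rfl

end Cocycles

/-! ### Representability of H¹. -/

section UniversalCocycle

variable {K : Type u} [Field K] [TopologicalSpace K] [IsTopologicalRing K] {G : Type v} [Group G]
  [TopologicalSpace G] {H H' : Type u} [CommRing H] [HopfAlgebra K H]
  [CommRing H'] [HopfAlgebra K H'] {α : HopfAction G K H} {α' : HopfAction G K H'}
  {φ : H' →ₐc[K] H}

variable (α) in
/-- Cocycles with values in the points over an algebra with trivial action, whose coordinates are
finite combinations with continuous coefficients. -/
def IsContCocycle {R : Type u} [CommRing R] [Algebra K R] (z : G → Pts K H R) : Prop :=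
  (∀ a, IsContComb K fun g ↦ z g a) ∧ ∀ g h, z (g * h) = z g * trivAct α g (z h)

variable (α) in
/-- There is a universal cocycle, over an algebra of finite type. -/
def HasUniversalCocycle : Prop :=
  ∃ (P : Type u) (_ : CommRing P) (_ : Algebra K P) (_ : Algebra.FiniteType K P)
    (c : G → Pts K H P), IsContCocycle α c ∧
      ∀ (R : Type u) [CommRing R] [Algebra K R] (z : G → Pts K H R), IsContCocycle α z →
        ∃! f : P →ₐ[K] R, ∃ u : Pts K H R, ∀ g, z g = u * Pts.map f (c g) * trivAct α g u⁻¹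

variable (α) in
/-- The invariants of all twisted forms of `U` are trivial. -/
def TwistedInvariantsTrivial : Prop :=
  ∀ (R : Type u) [CommRing R] [Algebra K R] (z : G → Pts K H R) (v : Pts K H R),
    (∀ g, v * z g * trivAct α g v⁻¹ = z g) → v = 1

omit [TopologicalSpace K] [IsTopologicalRing K] [TopologicalSpace G] in
-- A twisted invariant is trivial in U' by induction, hence is a central exp n. Twisting does not
-- affect central elements, so n is an ordinary invariant form.
theorem TwistedInvariantsTrivial.step [CharZero K] (hH : IsConilpotent K H)
    (hH' : IsConilpotent K H') (hφα : ∀ g a, φ (α'.toHom g a) = α.toHom g (φ a))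
    (hc : ∀ (S : Type u) [CommRing S] [Algebra K S] (x y : Pts K H S), Pts.res φ y = 1 →
      x * y = y * x)
    (hinv : ∀ m : Cot (imSub φ) →ₗ[K] K,
      (∀ g, m ∘ₗ cotAct α (imSub_stable hφα) g⁻¹ = m) → m = 0)
    (ih : TwistedInvariantsTrivial α') : TwistedInvariantsTrivial α := by
  intro R _ _ z v hv
  have hres : Pts.res φ v = 1 := by
    refine ih R (fun g ↦ Pts.res φ (z g)) _ fun g ↦ ?_
    have := congrArg (Pts.res φ) (hv g)
    rwa [map_mul, map_mul, res_ptsAct α α' hφα, map_inv] at this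
  obtain ⟨n, rfl⟩ := exists_expCot_of_res_eq_one hH hH' hres
  have hn : ∀ g, n ∘ₗ cotAct α (imSub_stable hφα) g⁻¹ = n := by
    intro g
    have := hv g
    rw [map_inv, mul_inv_eq_iff_eq_mul, ← hc _ _ _ hres, mul_right_inj,
      trivAct_expCot hH (imSub_stable hφα)] at this
    exact (expCot_injective hH this).symm
  have : n = 0 := by
    -- Linear functionals on R reduce forms with values in R to forms with values in K.
    refine LinearMap.ext fun v ↦ (Module.forall_dual_apply_eq_zero_iff K (n v)).mp fun d ↦ ?_
    refine congr($(hinv (d ∘ₗ n) fun g ↦ ?_) v)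
    rw [LinearMap.comp_assoc, hn]
  rw [this, expCot_zero]

variable [IsTopologicalGroup G]

omit [IsTopologicalRing K] [IsTopologicalGroup G] in
theorem IsContCocycle.res (hφα : ∀ g a, φ (α'.toHom g a) = α.toHom g (φ a)) {R : Type u}
    [CommRing R] [Algebra K R] {z : G → Pts K H R} (hz : IsContCocycle α z) :
    IsContCocycle α' fun g ↦ Pts.res φ (z g) :=
  ⟨fun a ↦ hz.1 (φ a), fun g h ↦ by
    beta_reduce
    rw [hz.2, map_mul, res_ptsAct α α' hφα]⟩

/-- Above a class for U', the classes for U are solutions l of the obstruction equation modulo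
coboundaries of central forms. That no further equivalences occur is where `htriv` enters: an
equivalence whose image fixes the cocycle in U' must itself be central. -/
theorem HasUniversalCocycle.step [CharZero K] [Algebra.FiniteType K H] (hH : IsConilpotent K H)
    (hH' : IsConilpotent K H') (hφ : Function.Injective φ)
    (hφα : ∀ g a, φ (α'.toHom g a) = α.toHom g (φ a))
    (hα : ∀ a, IsContComb K fun g ↦ α.toHom g⁻¹ a)
    (hc : ∀ (S : Type u) [CommRing S] [Algebra K S] (x y : Pts K H S), Pts.res φ y = 1 →
      x * y = y * x)
    (hfin : FiniteCohomology (formCob₀ (isContComb_cotAct (imSub_stable hφα) hα))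
      (formCob₁ (isContComb_cotAct (imSub_stable hφα) hα)))
    (htriv : TwistedInvariantsTrivial α')
    (ih : HasUniversalCocycle α') : HasUniversalCocycle α := by
  obtain ⟨P', _, _, _, c', hc', hu⟩ := ih
  obtain ⟨C', hC'⟩ := exists_point_of_isContComb c' hc'.1
  obtain ⟨C, rfl⟩ := Pts.res_surjective hH φ hφ C'
  have hres : ∀ g, Pts.res φ (Pts.map (evalCont K P' g) C) = c' g := hC'
  obtain ⟨o, ho⟩ := exists_cocycle_obstruction hH hH' hφα hα hc C (by
    intro g h
    rw [hres, hres, hres, hc'.2])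
  have hw : ∀ g h (v : Cot (imSub φ)), cotAct α (imSub_stable hφα) (g * h)⁻¹ v =
      cotAct α (imSub_stable hφα) h⁻¹ (cotAct α (imSub_stable hφα) g⁻¹ v) := by
    intro g h v
    obtain ⟨a, rfl⟩ := (cotKer (imSub φ)).mkQ_surjective v
    rw [cotAct_mk, cotAct_mk, cotAct_mk, mul_inv_rev, map_mul, AlgEquiv.mul_apply]
  obtain ⟨P, _, _, _, ι, l, hl, huniv⟩ := exists_torsor _ _ (formCob₁_formCob₀ _ hw) hfin o
  have hcont : ∀ {R : Type u} [CommRing R] [Algebra K R] (f : P' →ₐ[K] R)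
      (m : Cot (imSub φ) →ₗ[K] C(G, K) ⊗[K] R) (a : H), IsContComb K fun g ↦
        (Pts.map f (Pts.map (evalCont K P' g) C) *
          expCot hH ((evalCont K R g).toLinearMap ∘ₗ m)) a := by
    intro R _ _ f m a
    have e : ∀ g, Pts.map f (Pts.map (evalCont K P' g) C) *
        expCot hH ((evalCont K R g).toLinearMap ∘ₗ m) = Pts.map (evalCont K R g)
          (Pts.map (Algebra.TensorProduct.map (AlgHom.id K C(G, K)) f) C * expCot hH m) := by
      intro g
      rw [map_mul, map_expCot]
      congr 1
      exact Pts.ext_apply fun a ↦ (evalCont_map f g (C a)).symm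
    simp only [e]
    exact isContComb_evalCont _
  let x : G → Pts K H P := fun g ↦ Pts.map ι (Pts.map (evalCont K P' g) C) *
    expCot hH ((evalCont K P g).toLinearMap ∘ₗ l)
  refine ⟨P, inferInstance, inferInstance, inferInstance, x, ⟨hcont ι l, (ho P ι l).mpr hl⟩,
    fun R _ _ z hz ↦ ?_⟩
  have hmapx : ∀ (F : P →ₐ[K] R) g, Pts.map F (x g) =
      Pts.map (F.comp ι) (Pts.map (evalCont K P' g) C) *
        expCot hH ((evalCont K R g).toLinearMap ∘ₗ (F.toLinearMap.lTensor _ ∘ₗ l)) := by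
    intro F g
    have e : F.toLinearMap ∘ₗ (evalCont K P g).toLinearMap ∘ₗ l =
        (evalCont K R g).toLinearMap ∘ₗ (F.toLinearMap.lTensor _ ∘ₗ l) :=
      LinearMap.ext fun v ↦ (evalCont_lTensor F g (l v)).symm
    rw [map_mul, map_expCot, e]
    rfl
  obtain ⟨f', ⟨u', hu'⟩, hf'⟩ := hu R _ (hz.res hφα)
  obtain ⟨u, rfl⟩ := Pts.res_surjective hH φ hφ u'
  -- a cocycle equivalent to `z` with image `f' (c')`
  let z' : G → Pts K H R := fun g ↦ u⁻¹ * z g * trivAct α g u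
  have hz' : ∀ g, z g = u * z' g * trivAct α g u⁻¹ := by
    intro g
    rw [map_inv]
    simp only [z']
    group
  have hz'res : ∀ g, Pts.res φ (z' g) = Pts.map f' (c' g) := by
    intro g
    simp only [z', map_mul, map_inv, res_ptsAct α α' hφα]
    rw [hu', map_inv]
    group
  have hz'coc : ∀ g h, z' (g * h) = z' g * trivAct α g (z' h) := by
    intro g h
    simp only [z', map_mul, map_inv]
    rw [hz.2, trivAct_mul]
    group
  -- The three factors of z' are made into points over C(G, K) ⊗ R, so that z' divided by the lift
  -- of f'(c') has a single logarithm m.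
  obtain ⟨Z, hZ⟩ := exists_point_of_isContComb z hz.1
  obtain ⟨Y, hY⟩ := exists_point_of_isContComb (fun g ↦ trivAct α g u) fun a ↦
    (hα a).map u.ofConv.toLinearMap
  obtain ⟨U, hU⟩ := exists_point_of_isContComb (X := G) (K := K) (fun _ ↦ u⁻¹) fun a ↦
    IsContComb.of_fintype (ι := Unit) (fun _ _ ↦ 1) (fun _ ↦ u⁻¹ a) (fun _ ↦ continuous_const)
      fun _ ↦ by simp
  let C₁ := Pts.map (Algebra.TensorProduct.map (AlgHom.id K C(G, K)) f') C
  have hC₁ : ∀ g, Pts.map (evalCont K R g) C₁ = Pts.map f' (Pts.map (evalCont K P' g) C) :=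
    fun g ↦ Pts.ext_apply fun a ↦ evalCont_map f' g (C a)
  have hev : ∀ g, Pts.map (evalCont K R g) (C₁⁻¹ * (U * Z * Y)) =
      (Pts.map f' (Pts.map (evalCont K P' g) C))⁻¹ * z' g := by
    intro g
    simp only [map_mul, map_inv, hC₁, hU, hZ, hY, z']
  obtain ⟨m, hm⟩ := exists_expCot_of_res_eq_one (φ := φ) hH hH' (x := C₁⁻¹ * (U * Z * Y)) (by
    refine Pts.eq_of_evalCont fun g ↦ ?_
    rw [← Pts.res_map, hev, map_mul, map_inv, hz'res, Pts.res_map, hres, inv_mul_cancel, map_one])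
  have hz'm : ∀ g, z' g = Pts.map f' (Pts.map (evalCont K P' g) C) *
      expCot hH ((evalCont K R g).toLinearMap ∘ₗ m) := by
    intro g
    rw [← map_expCot, ← hm, hev, mul_inv_cancel_left]
  have hmo := (ho R f' m).mp fun g h ↦ by
    rw [← hz'm, ← hz'm, ← hz'm, hz'coc]
  -- An equivalence by the central element exp n shifts the logarithm by n - g n, so it relates F(x)
  -- to z' exactly when m - F(l) is the coboundary of n.
  have key : ∀ (F : P →ₐ[K] R) (hF : F.comp ι = f') (n : Cot (imSub φ) →ₗ[K] K ⊗[K] R),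
      (m - F.toLinearMap.lTensor _ ∘ₗ l = homBase R (formCob₀ (isContComb_cotAct (imSub_stable hφα) hα)) n ↔
        ∀ g, z' g = expCot hH ((TensorProduct.lid K R).toLinearMap ∘ₗ n) * Pts.map F (x g) *
          trivAct α g (expCot hH ((TensorProduct.lid K R).toLinearMap ∘ₗ n))⁻¹) := by
    intro F hF n
    set N := (TensorProduct.lid K R).toLinearMap ∘ₗ n
    set M := F.toLinearMap.lTensor C(G, K) ∘ₗ l
    have e1 : ∀ g, expCot hH N * Pts.map F (x g) * trivAct α g (expCot hH N)⁻¹ =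
        Pts.map f' (Pts.map (evalCont K P' g) C) *
          expCot hH ((evalCont K R g).toLinearMap ∘ₗ M +
            (N + -(N ∘ₗ cotAct α (imSub_stable hφα) g⁻¹))) := by
      intro g
      rw [hmapx, hF, map_inv, trivAct_expCot hH (imSub_stable hφα), expCot_add hH hH' (hc _),
        expCot_add hH hH' (hc _), expCot_neg hH hH' (hc _),
        ← hc _ _ (expCot hH N) (res_expCot hH hH' _)]
      simp only [mul_assoc]
      rfl
    have e2 : ∀ g, (z' g = expCot hH N * Pts.map F (x g) * trivAct α g (expCot hH N)⁻¹ ↔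
        ∀ v, evalCont K R g (m v) = evalCont K R g (M v) +
          (N v - N (cotAct α (imSub_stable hφα) g⁻¹ v))) := by
      intro g
      rw [e1, hz'm, mul_right_inj, (expCot_injective hH).eq_iff, LinearMap.ext_iff]
      simp only [sub_eq_add_neg]
      rfl
    simp only [e2]
    constructor
    · intro h g v
      have := congrArg (evalCont K R g) congr($h v)
      rw [evalCont_formCob₀, LinearMap.sub_apply, map_sub, sub_eq_iff_eq_add'] at this
      exact this
    · intro h
      refine LinearMap.ext fun v ↦ eq_of_evalCont fun g ↦ ?_
      rw [evalCont_formCob₀, LinearMap.sub_apply, map_sub, sub_eq_iff_eq_add']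
      exact h g v
  refine (existsUnique_congr fun F ↦ ?_).mp (huniv R f' m hmo)
  constructor
  · rintro ⟨hF, n, hn⟩
    refine ⟨u * expCot hH ((TensorProduct.lid K R).toLinearMap ∘ₗ n), fun g ↦ ?_⟩
    rw [hz', (key F hF n).mp hn g, mul_inv_rev, map_mul (trivAct α g)]
    simp only [mul_assoc]
  · rintro ⟨y, hy⟩
    have hresx : ∀ g, Pts.res φ (Pts.map F (x g)) = Pts.map (F.comp ι) (c' g) := by
      intro g
      rw [hmapx, map_mul, res_expCot hH hH', mul_one, Pts.res_map, hres]
    have hF : F.comp ι = f' := by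
      refine hf' _ ⟨Pts.res φ y, fun g ↦ ?_⟩
      have := congrArg (Pts.res φ) (hy g)
      rwa [map_mul, map_mul, res_ptsAct α α' hφα, map_inv, hresx] at this
    have hy' : ∀ g, z' g = u⁻¹ * y * Pts.map F (x g) * trivAct α g (u⁻¹ * y)⁻¹ := by
      intro g
      simp only [z', mul_inv_rev, inv_inv, map_mul]
      rw [hy]
      simp only [mul_assoc]
    have hy1 : Pts.res φ (u⁻¹ * y) = 1 := by
      -- In U' both cocycles equal f'(c'), so the image of u⁻¹ y is a twisted invariant of it.
      refine htriv R (fun g ↦ Pts.map f' (c' g)) _ fun g ↦ ?_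
      have := congrArg (Pts.res φ) (hy' g)
      rw [hz'res, map_mul, map_mul, res_ptsAct α α' hφα, map_inv, hresx, hF] at this
      exact this.symm
    obtain ⟨N, hN⟩ := exists_expCot_of_res_eq_one hH hH' hy1
    refine ⟨hF, (TensorProduct.lid K R).symm.toLinearMap ∘ₗ N, (key F hF _).mpr fun g ↦ ?_⟩
    have e : (TensorProduct.lid K R).toLinearMap ∘ₗ (TensorProduct.lid K R).symm.toLinearMap ∘ₗ N =
        N := LinearMap.ext fun v ↦ (TensorProduct.lid K R).apply_symm_apply (N v)
    rw [e, ← hN]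
    exact hy' g

open CategoryTheory

variable [T2Space K] [CompactSpace G]

omit [IsTopologicalGroup G] in
theorem HasUniversalCocycle.corepresentable (h : HasUniversalCocycle α) :
    ∃ X : CommAlgCat.{u} K, Algebra.FiniteType K X ∧
      Nonempty ((H1Functor α).CorepresentableBy X) := by
  obtain ⟨P, _, _, hP, c, hc, hu⟩ := h
  let c' : Cocycles K α (1 : G →* (P ≃ₐ[K] P)) := ⟨c, continuous_pts_iff.mpr hc.1, hc.2⟩
  let ξ : (H1Functor α).obj (CommAlgCat.of K P) :=
    Quotient.mk (cocycleSetoid K α (1 : G →* (P ≃ₐ[K] P))) c'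
  have key : ∀ (R : CommAlgCat.{u} K) (q : (H1Functor α).obj R),
      ∃! f : CommAlgCat.of K P ⟶ R, (H1Functor α).map f ξ = q := by
    intro R q
    obtain ⟨z, rfl⟩ := Quotient.exists_rep (s := cocycleSetoid K α (1 : G →* (R ≃ₐ[K] R))) q
    have hz : IsContCocycle α z.1 := ⟨continuous_pts_iff.mp z.2.1, z.2.2⟩
    have heq : ∀ f : P →ₐ[K] R, (H1Functor α).map (CommAlgCat.ofHom f) ξ = Quotient.mk _ z ↔
        ∃ u : Pts K H R, ∀ g, z.1 g = u * Pts.map f (c g) * trivAct α g u⁻¹ := by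
      intro f
      exact Quotient.eq (r := cocycleSetoid K α (1 : G →* (R ≃ₐ[K] R))) (x := c'.mapAlg f) (y := z)
    obtain ⟨f, hf, hf'⟩ := hu R z.1 hz
    refine ⟨CommAlgCat.ofHom f, (heq f).mpr hf, fun F hF ↦ ?_⟩
    rw [← hf' F.hom ((heq F.hom).mp hF)]
    rfl
  refine ⟨CommAlgCat.of K P, hP, ⟨⟨fun {R} ↦ Equiv.ofBijective (fun f ↦ (H1Functor α).map f ξ)
    (Function.bijective_iff_existsUnique _ |>.mpr (key R)), fun f g ↦ ?_⟩⟩⟩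
  simp

end UniversalCocycle

/-! ### Universal cocycles for every U_n. -/

section CohomologyLcs

variable {K A : Type u} [Field K] [CharZero K] [TopologicalSpace K] [IsTopologicalRing K]
  {G : Type v} [Group G] [TopologicalSpace G] [CommRing A] [HopfAlgebra K A] {α : HopfAction G K A}

omit [CharZero K] in
theorem gradedForm_eq_zero {n : ℕ}
    (h : Subsingleton (GradedH α (1 : G →* (K ≃ₐ[K] K)) n 0)) {m : GradedCot K A n →ₗ[K] K}
    (hm : ∀ g, m ∘ₗ gradedCotAct α n g = m) : m = 0 := by
  refine toGraded_injective n ?_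
  rw [map_zero]
  refine eq_zero_of_invariant (M := gradedPts (K := K) A K n)
    (gradedRep α (1 : G →* (K ≃ₐ[K] K)) n) fun g ↦ ?_
  rw [gradedRep_toGraded]
  exact congrArg _ (hm g)

theorem twistedInvariantsTrivial_quot (hA : IsConilpotent K A)
    (hsub : ∀ i, Subsingleton (GradedH α (1 : G →* (K ≃ₐ[K] K)) i 0)) (n : ℕ) :
    TwistedInvariantsTrivial (α.quot n) := by
  induction n with
  | zero => exact fun R _ _ _ _ _ ↦ lcsQuot_zero_pts _ _
  | succ n ih =>
    exact ih.step (φ := lcsStep K A n) (lcsQuot_isConilpotent hA _) (lcsQuot_isConilpotent hA _)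
      (lcsStep_equivariant α n) (fun S _ _ x y hy ↦ commute_of_res_eq_one hA x y hy)
      fun m hm ↦ gradedForm_eq_zero (hsub n) hm

variable [IsTopologicalGroup G]

theorem hasUniversalCocycle_quot (hA : IsConilpotent K A)
    (hfg : ∀ n, Algebra.FiniteType K (lcsQuot K A n))
    (hα : ∀ n (a : lcsQuot K A n), IsContComb K fun g ↦ (α.quot n).toHom g⁻¹ a)
    (hfin : ∀ n, Module.Finite (IntermediateField.fixedField (1 : G →* (K ≃ₐ[K] K)).range)
      (GradedH α (1 : G →* (K ≃ₐ[K] K)) n 1))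
    (hsub : ∀ i, Subsingleton (GradedH α (1 : G →* (K ≃ₐ[K] K)) i 0)) (n : ℕ) :
    HasUniversalCocycle (α.quot n) := by
  induction n with
  | zero =>
    refine ⟨K, inferInstance, inferInstance, inferInstance, 1,
      ⟨fun a ↦ ?_, fun g h ↦ lcsQuot_zero_pts _ _⟩, fun R _ _ z _ ↦
      ⟨Algebra.ofId K R, ⟨1, fun g ↦ lcsQuot_zero_pts _ _⟩, fun f _ ↦ Subsingleton.elim _ _⟩⟩
    exact IsContComb.of_fintype (ι := Unit) (fun _ _ ↦ 1) (fun _ ↦ (1 : Pts K _ K) a)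
      (fun _ ↦ continuous_const) fun _ ↦ by simp
  | succ n ih =>
    have := hfg (n + 1)
    refine ih.step (φ := lcsStep K A n) (lcsQuot_isConilpotent hA _) (lcsQuot_isConilpotent hA _)
      (lcsStep_injective n) (lcsStep_equivariant α n) (hα _)
      (fun S _ _ x y hy ↦ commute_of_res_eq_one hA x y hy) ?_
      (twistedInvariantsTrivial_quot hA hsub n)
    exact finiteCohomology_formCob _ (gradedRep α (1 : G →* (K ≃ₐ[K] K)) n) (toGraded A K n)
      ⟨toGraded_injective n, toGraded_surjective n⟩ (toGraded_smul n _)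
      (gradedRep_toGraded α (1 : G →* (K ≃ₐ[K] K)) n) fun c hc ↦ continuous_toGraded hc

end CohomologyLcs

end UnipotentCohomology

end

theorem proposition3 {K B A : Type u} {G : Type v}
    [Field K] [CharZero K] [TopologicalSpace K] [IsTopologicalRing K]
    [Field B] [UniformSpace B] [IsUniformAddGroup B] [IsTopologicalDivisionRing B]
    [T2Space B] [CompleteSpace B] [Algebra K B] (hK : Topology.IsInducing (algebraMap K B))
    [Group G] [TopologicalSpace G] [IsTopologicalGroup G] [CompactSpace G]
    (σ : G →* (B ≃ₐ[K] B)) (hσ : Continuous fun p : G × B ↦ σ p.1 p.2)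
    (hF : Module.Finite K (IntermediateField.fixedField σ.range))
    [CommRing A] [HopfAlgebra K A] (hA : IsUnipotent K A)
    (hfg : ∀ n, Algebra.FiniteType K (lcsQuot K A n))
    (α : HopfAction G K A)
    (hα : Continuous[instTopologicalSpaceProd (t₂ := indTopology K A), indTopology K A]
      fun p : G × A ↦ α.toHom p.1 p.2)
    (hB : FiniteGradedCohomology α σ)
    (hBK : FiniteGradedCohomology α (1 : G →* (K ≃ₐ[K] K)))
    (n : ℕ) :
    (∃ X : CommAlgCat.{u} K, Algebra.FiniteType K X ∧
      Nonempty ((H0Functor (α.quot n) σ).CorepresentableBy X)) ∧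
    (∀ X : CommAlgCat.{u} K, Algebra.FiniteType K X →
      ∀ r : (H1Functor (α.quot n)).CorepresentableBy X, ∃ J : Ideal X,
        ∀ φ : X →ₐ[K] K, (∀ a ∈ J, φ a = 0) ↔
          H1.toField (α.quot n) hK.continuous σ (r.homEquiv (CommAlgCat.ofHom φ)) = H1.basepoint B (α.quot n) σ) ∧
    ((∀ i, Subsingleton (GradedH α (1 : G →* (K ≃ₐ[K] K)) i 0)) →
      ∃ X : CommAlgCat.{u} K, Algebra.FiniteType K X ∧
        Nonempty ((H1Functor (α.quot n)).CorepresentableBy X)) := by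
  -- Hausdorffness of K is what makes points closed in the inductive limit topology.
  have : T2Space K := T2Space.of_injective_continuous (algebraMap K B).injective hK.continuous
  have hA' := hA.isConilpotent
  have hα' := isContComb_quot hα
  refine ⟨(hasUniversalOrbit_quot σ hA' hfg (fun n a ↦ (hα' n a).hasFiniteSpan)
      (fun i ↦ finiteCohomology_quotDiff hK hσ hF (hα' (i + 1)) (hB i 0) (hBK i 1)) n).corepresentable,
    fun X _ r ↦ (trivialLocusClosed_quot σ hA' hfg
      (fun n a ↦ (hα' n a).hasFiniteSpan) n).exists_ideal hK.continuous r,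
    fun hsub ↦ (hasUniversalCocycle_quot hA' hfg hα' (fun i ↦ hBK i 1) hsub n).corepresentable⟩
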